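/- Let $q\in\mathbb C$ with $0<|q|<1$, and write $(u;q)_\infty=\prod_{j\ge 0}(1-uq^j)$, $(u;q)_k=\prod_{j=0}^{k-1}(1-uq^j)$ for integers $k\ge 0$, and $(u_1,\dots,u_m;q)_k=(u_1;q)_k\cdots(u_m;q)_k$ for $k$ a nonnegative integer or $\infty$. Let $r\ge 0$ be an integer, and let $a,b,c,d,e,f,x_1,\dots,x_r$ be nonzero complex numbers with $$a^2q^{2-r}=bcdef,$$ such that none of the denominators below vanishes, that is: $x_i\ne x_j$ for $i\neq j$; $ax_ix_j\neq 1$ for all $i,j$ (including $i=j$); and none of the numbers $$\frac{b^2}{a},\ \frac{bc}{a},\ \frac{bd}{a},\ \frac{be}{a},\ \frac{bq}{c},\ \frac{bq}{d},\ \frac{bq}{e},\ \frac{bf}{ax_i},\ \frac{ax_i}{b},\ \frac{ax_iq}{c},\ \frac{ax_iq}{d},\ \frac{ax_iq}{e},\ \frac{ax_i^2q}{f},\ \frac{bq}{ax_i},\ \frac{bx_iq}{f}\qquad(1\le i\le r)$$ is of the form $q^{-n}$ with an integer $n\ge 0$. Then all the $r$-fold series below converge absolutely, and $$\begin{aligned}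 \sum_{S\subseteq\{1,\dots,r\}}&\left(\frac ba\right)^{\binom{r-|S|}2}\prod_{i\notin S}\frac{(ax_i^2q,cx_i,dx_i,ex_i,f;q)_\infty}{(ax_i/b,ax_iq/c,ax_iq/d,ax_iq/e,ax_i^2q/f;q)_\infty}\\ &\times\prod_{i\notin S}\frac{(b/ax_i,bq/c,bq/d,bq/e,bx_iq/f;q)_\infty}{(b^2q/a,bc/a,bd/a,be/a,bf/ax_i;q)_\infty}\\ &\times\sum_{k_1,\dots,k_r=0}^\infty\ \prod_{\substack{1\le i<j\le r\\ i,j\in S}}\frac{(x_iq^{k_i}-x_jq^{k_j})(1-ax_ix_jq^{k_i+k_j})}{(x_i-x_j)(1-ax_ix_j)}\prod_{i\in S}\frac{1-ax_i^2q^{2k_i}}{1-ax_i^2}\\ &\times\prod_{\substack{1\le i<j\le r\\ i,j\notin S}}\frac{(q^{k_i}-q^{k_j})(1-b^2q^{k_i+k_j}/a)}{(x_i-x_j)(1-ax_ix_j)}\prod_{i\notin S}\frac{1-b^2q^{2k_i}/a}{1-b^2/a}\\ &\times\prod_{i\in S,\,j\notin S}\frac{(x_iq^{k_i}-bq^{k_j}/a)(1-bx_iq^{k_i+k_j})}{(x_i-x_j)(1-ax_ix_j)}\\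 &\times\prod_{i\in S}\frac{(ax_i^2,bx_i,cx_i,dx_i,ex_i,f;q)_{k_i}}{(q,ax_iq/b,ax_iq/c,ax_iq/d,ax_iq/e,ax_i^2q/f;q)_{k_i}}\\ &\times\prod_{i\notin S}\frac{(b^2/a,bx_i,bc/a,bd/a,be/a,bf/ax_i;q)_{k_i}}{(q,bq/ax_i,bq/c,bq/d,bq/e,bx_iq/f;q)_{k_i}}\; q^{k_1+\dots+k_r}\\ =\ &\prod_{1\le i<j\le r}\frac{1-ax_ix_j/f}{1-ax_ix_j}\prod_{i=1}^r\frac{(ax_i^2q,b/ax_i,aq^{2-i}/cd,aq^{2-i}/ce;q)_\infty}{(ax_iq/c,ax_iq/d,ax_iq/e,ax_i^2q/f;q)_\infty}\\ &\times\prod_{i=1}^r\frac{(ax_iq/cf,aq^{2-i}/de,ax_iq/df,ax_iq/ef;q)_\infty}{(bcq^{i-1}/a,bdq^{i-1}/a,beq^{i-1}/a,bf/ax_i;q)_\infty}. \end{aligned}$$ Here $u/vw$ means $u/(vw)$, and $b/ax_i$, $bq/ax_i$, $bf/ax_i$ mean $b/(ax_i)$, $bq/(ax_i)$, $bf/(ax_i)$.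 -/

import Mathlib

open Finset

/-- The finite `q`-shifted factorial `(a;q)_k = ∏_{j=0}^{k-1} (1 - a q^j)`, `k ≥ 0`. -/
def qPoch (a q : ℂ) (k : ℕ) : ℂ := ∏ j ∈ range k, (1 - a * q ^ j)

/-- The infinite `q`-shifted factorial `(a;q)_∞ = ∏_{j=0}^∞ (1 - a q^j)`. -/
noncomputable def qPochInf (a q : ℂ) : ℂ := ∏' j : ℕ, (1 - a * q ^ j)

/-- The infinite product defining `(a;q)_∞` converges for `|q| < 1`. -/
theorem multipliable_qPochInf (a : ℂ) {q : ℂ} (hq : ‖q‖ < 1) :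
    Multipliable (fun j : ℕ => 1 - a * q ^ j) := by
  have h : Summable (fun j : ℕ => ‖-(a * q ^ j)‖) := by
    simpa using (summable_geometric_of_lt_one (norm_nonneg q) hq).mul_left ‖a‖
  simpa [sub_eq_add_neg] using multipliable_one_add_of_summable h

/-- Condensed notation `(a₁, …, aₘ; q)_k = (a₁;q)_k ⋯ (aₘ;q)_k`. -/
def qPochs (l : List ℂ) (q : ℂ) (k : ℕ) : ℂ := (l.map fun a => qPoch a q k).prod

/-- Condensed notation `(a₁, …, aₘ; q)_∞ = (a₁;q)_∞ ⋯ (aₘ;q)_∞`. -/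
noncomputable def qPochInfs (l : List ℂ) (q : ℂ) : ℂ := (l.map fun a => qPochInf a q).prod

/-- The coefficient with which the `r`-fold series attached to the subset `S` enters the sum
over all subsets. -/
noncomputable def crCoeff {r : ℕ} (q a b c d e f : ℂ) (x : Fin r → ℂ) (S : Finset (Fin r)) : ℂ :=
  (b / a) ^ ((r - S.card).choose 2)
  * (∏ i ∈ Sᶜ,
      qPochInfs [a * x i ^ 2 * q, c * x i, d * x i, e * x i, f] q
      / qPochInfs [a * x i / b, a * x i * q / c, a * x i * q / d, a * x i * q / e,
          a * x i ^ 2 * q / f] q)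
  * (∏ i ∈ Sᶜ,
      qPochInfs [b / (a * x i), b * q / c, b * q / d, b * q / e, b * x i * q / f] q
      / qPochInfs [b ^ 2 * q / a, b * c / a, b * d / a, b * e / a, b * f / (a * x i)] q)

/-- The term with summation indices `k₁, …, k_r` of the `C_r` very-well-poised series attached
to the subset `S`. -/
noncomputable def crTerm {r : ℕ} (q a b c d e f : ℂ) (x : Fin r → ℂ) (S : Finset (Fin r))
    (k : Fin r → ℕ) : ℂ :=
  (∏ i ∈ S, ∏ j ∈ S with i < j,
      ((x i * q ^ k i - x j * q ^ k j) * (1 - a * x i * x j * q ^ (k i + k j)))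
      / ((x i - x j) * (1 - a * x i * x j)))
  * (∏ i ∈ S, (1 - a * x i ^ 2 * q ^ (2 * k i)) / (1 - a * x i ^ 2))
  * (∏ i ∈ Sᶜ, ∏ j ∈ Sᶜ with i < j,
      ((q ^ k i - q ^ k j) * (1 - b ^ 2 * q ^ (k i + k j) / a))
      / ((x i - x j) * (1 - a * x i * x j)))
  * (∏ i ∈ Sᶜ, (1 - b ^ 2 * q ^ (2 * k i) / a) / (1 - b ^ 2 / a))
  * (∏ i ∈ S, ∏ j ∈ Sᶜ,
      ((x i * q ^ k i - b * q ^ k j / a) * (1 - b * x i * q ^ (k i + k j)))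
      / ((x i - x j) * (1 - a * x i * x j)))
  * (∏ i ∈ S,
      qPochs [a * x i ^ 2, b * x i, c * x i, d * x i, e * x i, f] q (k i)
      / qPochs [q, a * x i * q / b, a * x i * q / c, a * x i * q / d, a * x i * q / e,
          a * x i ^ 2 * q / f] q (k i))
  * (∏ i ∈ Sᶜ,
      qPochs [b ^ 2 / a, b * x i, b * c / a, b * d / a, b * e / a, b * f / (a * x i)] q (k i)
      / qPochs [q, b * q / (a * x i), b * q / c, b * q / d, b * q / e, b * x i * q / f] q (k i))
  * q ^ (∑ i, k i)

/-- The product side. The index `i : Fin r` starts at `0`, so that `q^{2-i}` and `q^{i-1}` for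
`i = 1, …, r` become `q^{1-i}` and `q^i`. -/
noncomputable def crProduct {r : ℕ} (q a b c d e f : ℂ) (x : Fin r → ℂ) : ℂ :=
  (∏ i : Fin r, ∏ j : Fin r with i < j, (1 - a * x i * x j / f) / (1 - a * x i * x j))
  * (∏ i : Fin r,
      qPochInfs [a * x i ^ 2 * q, b / (a * x i), a * q ^ (1 - ((i : ℕ) : ℤ)) / (c * d),
          a * q ^ (1 - ((i : ℕ) : ℤ)) / (c * e)] q
      / qPochInfs [a * x i * q / c, a * x i * q / d, a * x i * q / e, a * x i ^ 2 * q / f] q)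
  * (∏ i : Fin r,
      qPochInfs [a * x i * q / (c * f), a * q ^ (1 - ((i : ℕ) : ℤ)) / (d * e),
          a * x i * q / (d * f), a * x i * q / (e * f)] q
      / qPochInfs [b * c * q ^ (i : ℕ) / a, b * d * q ^ (i : ℕ) / a, b * e * q ^ (i : ℕ) / a,
          b * f / (a * x i)] q)

/-! The identity is a determinant evaluation. Up to row factors, the cross products in the term
attached to `S` form the quotient of two type-C Vandermonde products: one in the points `y i`, equal
to `x i * q ^ k i` for `i ∈ S` and `b / a * q ^ k i` otherwise, and one in the `x i`. Such a product
is the determinant of the functions `projMonomial a j`. Summing over all `k` and `S` and using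
multilinearity in the rows, the left side times `crVandermonde` becomes the determinant of
`crMatrix`. Its entries are one-dimensional two-term sums `crMoment` of `projMonomial a j` against a
very-well-poised weight (`det_crEntry`, `det_crMatrix_eq_sum`).

The moments of `projMonomial` have no closed form in general, but those of another basis of the same
function space do. Multiplying the weight by `wpShift q a c d i j` replaces `c, d` by `c q^i, d
q^j`. When `i + j = r - 1`, the balancing condition becomes that of Bailey's nonterminating
very-well-poised sum, which gives a product (`crMoment_wpShift`). That product is a row factor times
a column factor times `wpShift` again, with `a` replaced by `a / f`. Both changes of basis have
explicit determinants (`det_twoNodeMatrix_wpNode`), so the determinant of the moments is a product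
too (`det_crMatrix_of_generic`).

Bailey's sum `vwpIntegral_eq_vwpValue` is proved from contiguous relations. A combination of two
weights with one parameter multiplied by `q` is a `q`-difference. It telescopes along each of the
two progressions, and the boundary terms cancel in `vwpIntegral`. The product `vwpValue` satisfies
the same first-order recurrence, so the quotient `vwpRatio` is invariant under moving a factor `q`
between parameters. Iterating such moves along `vwpDirection`, the first normalized series tends to
1, the second contribution vanishes and the normalized product tends to 1, so the quotient is 1.

Those steps need parameters in general position (`VwpGeneric`). The stated hypotheses are reached by
perturbing the parameters along a curve that respects the balancing condition and letting the
perturbation tend to zero; both sides are continuous by dominated convergence (`det_crMatrix`). -/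

open Filter Topology

/-! ### Basic properties of `q`-shifted factorials. -/

section qPochhammer

variable {q : ℂ}

theorem qPoch_zero (a q : ℂ) : qPoch a q 0 = 1 := by simp [qPoch]

theorem qPoch_add (a q : ℂ) (m k : ℕ) :
    qPoch a q (m + k) = qPoch a q m * qPoch (a * q ^ m) q k := by
  simp only [qPoch, prod_range_add, pow_add, mul_assoc]

theorem qPoch_succ_left (a q : ℂ) (k : ℕ) :
    qPoch a q (k + 1) = (1 - a) * qPoch (a * q) q k := by
  rw [add_comm, qPoch_add]; simp [qPoch]

theorem tendsto_qPoch (a : ℂ) (hq : ‖q‖ < 1) :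
    Tendsto (qPoch a q) atTop (𝓝 (qPochInf a q)) :=
  (multipliable_qPochInf a hq).hasProd.tendsto_prod_nat

theorem continuous_qPoch (q : ℂ) (k : ℕ) : Continuous fun a => qPoch a q k := by
  unfold qPoch; fun_prop

theorem qPochInf_eq_mul (a : ℂ) (hq : ‖q‖ < 1) (k : ℕ) :
    qPochInf a q = qPoch a q k * qPochInf (a * q ^ k) q := by
  have h1 := (tendsto_qPoch a hq).comp (tendsto_add_atTop_nat k)
  have h2 := (tendsto_qPoch (a * q ^ k) hq).const_mul (qPoch a q k)
  refine tendsto_nhds_unique h1 (h2.congr fun n => ?_)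
  rw [Function.comp_apply, add_comm, qPoch_add]

theorem qPochInf_eq_one_sub_mul (a : ℂ) (hq : ‖q‖ < 1) :
    qPochInf a q = (1 - a) * qPochInf (a * q) q := by
  simpa [qPoch] using qPochInf_eq_mul a hq 1

theorem qPochInf_ne_zero {a : ℂ} (hq : ‖q‖ < 1) (h : ∀ n : ℕ, a * q ^ n ≠ 1) :
    qPochInf a q ≠ 0 := by
  have := tprod_one_add_ne_zero_of_summable (f := fun n : ℕ => -(a * q ^ n)) (R := ℂ)
    (fun n => by rw [← sub_eq_add_neg]; exact sub_ne_zero.2 (h n).symm)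
    (by simpa using (summable_geometric_of_lt_one (norm_nonneg q) hq).mul_left ‖a‖)
  simpa [qPochInf, sub_eq_add_neg] using this

theorem qPoch_ne_zero {a : ℂ} (h : ∀ n : ℕ, a * q ^ n ≠ 1) (k : ℕ) : qPoch a q k ≠ 0 :=
  prod_ne_zero_iff.2 fun n _ => sub_ne_zero.2 (h n).symm

theorem tendsto_qPochInf {ι : Type*} {l : Filter ι} {f : ι → ℂ} {w : ℂ} (hq : ‖q‖ < 1)
    (hf : Tendsto f l (𝓝 w)) : Tendsto (fun i => qPochInf (f i) q) l (𝓝 (qPochInf w q)) := by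
  have := tendsto_tprod_one_add_of_dominated_convergence (𝓕 := l)
    (f := fun i (n : ℕ) => -(f i * q ^ n)) (g := fun n => -(w * q ^ n))
    (bound := fun n => (‖w‖ + 1) * ‖q‖ ^ n)
    ((summable_geometric_of_lt_one (norm_nonneg q) hq).mul_left _)
    (fun n => (hf.mul_const _).neg)
    (by
      filter_upwards [hf.norm.eventually (ge_mem_nhds (lt_add_one ‖w‖))] with i hi n
      rw [norm_neg, norm_mul, norm_pow]
      gcongr)
  simpa [qPochInf, sub_eq_add_neg] using this

theorem qPochInf_zero (q : ℂ) : qPochInf 0 q = 1 := by simp [qPochInf]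

theorem norm_qPoch_le (a : ℂ) (hq : ‖q‖ < 1) (k : ℕ) :
    ‖qPoch a q k‖ ≤ Real.exp (‖a‖ * (1 - ‖q‖)⁻¹) := by
  rw [qPoch, norm_prod]
  calc ∏ j ∈ range k, ‖1 - a * q ^ j‖ ≤ ∏ j ∈ range k, Real.exp (‖a‖ * ‖q‖ ^ j) := by
        refine prod_le_prod (fun _ _ => norm_nonneg _) fun j _ => ?_
        refine le_trans ?_ (Real.add_one_le_exp _)
        refine (norm_sub_le _ _).trans ?_
        rw [norm_one, norm_mul, norm_pow, add_comm]
    _ = Real.exp (‖a‖ * ∑ j ∈ range k, ‖q‖ ^ j) := by rw [← Real.exp_sum, mul_sum]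
    _ ≤ _ := by
        gcongr
        rw [← tsum_geometric_of_lt_one (norm_nonneg q) hq]
        exact (summable_geometric_of_lt_one (norm_nonneg q) hq).sum_le_tsum _
          fun _ _ => by positivity

theorem norm_qPochInf_le (a : ℂ) (hq : ‖q‖ < 1) :
    ‖qPochInf a q‖ ≤ Real.exp (‖a‖ * (1 - ‖q‖)⁻¹) :=
  le_of_tendsto (tendsto_qPoch a hq).norm (Eventually.of_forall fun k => norm_qPoch_le a hq k)

end qPochhammer

/-! ### Uniform bounds on `q`-shifted factorials, for dominated convergence. -/

section EventuallyBounded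

variable {ι κ : Type*} {l : Filter ι}

/-- The family `g i` of functions is bounded, uniformly for `i` eventually in `l`. -/
def EventuallyBounded (l : Filter ι) (g : ι → κ → ℂ) : Prop :=
  ∃ C : ℝ, ∀ᶠ i in l, ∀ k, ‖g i k‖ ≤ C

theorem EventuallyBounded.mul {g h : ι → κ → ℂ} (hg : EventuallyBounded l g)
    (hh : EventuallyBounded l h) : EventuallyBounded l fun i k => g i k * h i k := by
  obtain ⟨C, hC⟩ := hg
  obtain ⟨D, hD⟩ := hh
  refine ⟨C * D, ?_⟩
  filter_upwards [hC, hD] with i h1 h2 k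
  rw [norm_mul]
  exact mul_le_mul (h1 k) (h2 k) (norm_nonneg _) ((norm_nonneg _).trans (h1 k))

theorem EventuallyBounded.prod {σ : Type*} {s : Finset σ} {g : σ → ι → κ → ℂ}
    (hg : ∀ m ∈ s, EventuallyBounded l (g m)) :
    EventuallyBounded l fun i k => ∏ m ∈ s, g m i k := by
  classical
  induction s using Finset.induction_on with
  | empty => exact ⟨1, by simp⟩
  | insert m s hm ih =>
    simp only [prod_insert hm]
    exact (hg m (mem_insert_self _ _)).mul (ih fun j hj => hg j (mem_insert_of_mem hj))

theorem EventuallyBounded.of_tendsto {f : ι → ℂ} {w : ℂ} (hf : Tendsto f l (𝓝 w)) :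
    EventuallyBounded l fun i (_ : κ) => f i :=
  ⟨‖w‖ + 1, (hf.norm.eventually (ge_mem_nhds (lt_add_one ‖w‖))).mono fun _ h _ => h⟩

variable {q : ℂ}

theorem eventuallyBounded_qPoch {f : ι → ℂ} {w : ℂ} (hq : ‖q‖ < 1) (hf : Tendsto f l (𝓝 w)) :
    EventuallyBounded l fun i k => qPoch (f i) q k := by
  refine ⟨Real.exp ((‖w‖ + 1) * (1 - ‖q‖)⁻¹), ?_⟩
  filter_upwards [hf.norm.eventually (ge_mem_nhds (lt_add_one ‖w‖))] with i hi k
  refine (norm_qPoch_le _ hq k).trans ?_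
  have : 0 < 1 - ‖q‖ := sub_pos.2 hq
  gcongr

/-- The inverse of `(u;q)_k` is `(u q^k;q)_∞ / (u;q)_∞`. The numerator is bounded uniformly in `k`,
and the denominator tends to a nonzero limit. -/
theorem eventuallyBounded_inv_qPoch {f : ι → ℂ} {w : ℂ} (hq : ‖q‖ < 1) (hf : Tendsto f l (𝓝 w))
    (hw : ∀ n : ℕ, w * q ^ n ≠ 1) :
    EventuallyBounded l fun i k => (qPoch (f i) q k)⁻¹ := by
  have hne := qPochInf_ne_zero hq hw
  have hinf := tendsto_qPochInf hq hf
  obtain ⟨C, hC⟩ : EventuallyBounded l fun i (_ : Unit) => (qPochInf (f i) q)⁻¹ :=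
    .of_tendsto (hinf.inv₀ hne)
  refine ⟨Real.exp ((‖w‖ + 1) * (1 - ‖q‖)⁻¹) * C, ?_⟩
  filter_upwards [hf.norm.eventually (ge_mem_nhds (lt_add_one ‖w‖)), hC,
    hinf.eventually_ne hne] with i hi hCi hi0 k
  have h := qPochInf_eq_mul (f i) hq k
  have hk : qPoch (f i) q k ≠ 0 := fun h0 => hi0 (by rw [h, h0, zero_mul])
  have : (qPoch (f i) q k)⁻¹ = qPochInf (f i * q ^ k) q * (qPochInf (f i) q)⁻¹ := by
    rw [h] at hi0 ⊢
    have := right_ne_zero_of_mul hi0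
    field_simp
  rw [this, norm_mul]
  refine mul_le_mul ((norm_qPochInf_le _ hq).trans ?_) (hCi ()) (norm_nonneg _) (by positivity)
  have : 0 < 1 - ‖q‖ := sub_pos.2 hq
  gcongr
  rw [norm_mul, norm_pow]
  calc ‖f i‖ * ‖q‖ ^ k ≤ ‖f i‖ * 1 := by
        gcongr
        exact pow_le_one₀ (norm_nonneg _) hq.le
    _ ≤ _ := by simpa using hi

theorem tendsto_div_pow_cobounded {w : ℂ} (hw : w ≠ 0) (hq0 : 0 < ‖q‖) (hq : ‖q‖ < 1) :
    Tendsto (fun m : ℕ => ‖w / q ^ m‖) atTop atTop := by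
  have h := (tendsto_pow_atTop_nhdsWithin_zero_of_lt_one hq0 hq).inv_tendsto_nhdsGT_zero
  refine (h.const_mul_atTop (norm_pos_iff.2 hw)).congr fun m => ?_
  rw [norm_div, norm_pow, div_eq_mul_inv, Pi.inv_apply]

/-- Here the argument escapes to infinity. Once `‖w / q ^ m‖ ≥ 2`, each further step only prepends a
factor of modulus at least 1 to the symbol, so a bound valid at one `M` persists for all larger `m`.
-/
theorem eventuallyBounded_inv_qPoch_div_pow {w : ℂ} (hq0 : 0 < ‖q‖) (hq : ‖q‖ < 1) (hw0 : w ≠ 0)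
    (hw : ∀ n : ℤ, w * q ^ n ≠ 1) :
    EventuallyBounded atTop fun m k : ℕ => (qPoch (w / q ^ m) q k)⁻¹ := by
  have hqne : q ≠ 0 := norm_pos_iff.1 hq0
  obtain ⟨M, hM⟩ := eventually_atTop.1
    ((tendsto_div_pow_cobounded hw0 hq0 hq).eventually_ge_atTop 2)
  obtain ⟨C, hC⟩ := eventuallyBounded_inv_qPoch (q := q) (w := w / q ^ M)
    (f := fun _ : Unit => w / q ^ M) (l := ⊤) hq (tendsto_const_nhds) (fun n h => hw (n - M) (by
      rw [zpow_sub₀ hqne, zpow_natCast, zpow_natCast, ← h]; ring))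
  have hC : ∀ k, ‖(qPoch (w / q ^ M) q k)⁻¹‖ ≤ C := by simpa using hC
  refine ⟨C, eventually_atTop.2 ⟨M, fun m hm => ?_⟩⟩
  induction m, hm using Nat.le_induction with
  | base => exact hC
  | succ m hm ih =>
    intro k
    cases k with
    | zero => simpa [qPoch_zero] using hC 0
    | succ k =>
      have h1 : w / q ^ (m + 1) * q = w / q ^ m := by rw [pow_succ]; field_simp
      change ‖(qPoch (w / q ^ (m + 1)) q (k + 1))⁻¹‖ ≤ C
      rw [qPoch_succ_left, h1, mul_inv, norm_mul]
      have h2 : 1 ≤ ‖1 - w / q ^ (m + 1)‖ := by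
        have := norm_sub_norm_le (w / q ^ (m + 1)) 1
        rw [norm_sub_rev] at this
        have h3 := hM (m + 1) (by omega)
        simp only [norm_one] at this
        linarith
      calc _ ≤ 1 * C := by
            refine mul_le_mul ?_ (ih k) (norm_nonneg _) zero_le_one
            rw [norm_inv]
            exact inv_le_one_of_one_le₀ h2
        _ = C := one_mul C

theorem EventuallyBounded.inv_qPochInf {f : ι → ℂ} (hq : ‖q‖ < 1)
    (h : EventuallyBounded l fun i (k : ℕ) => (qPoch (f i) q k)⁻¹)
    (hne : ∀ i, qPochInf (f i) q ≠ 0) :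
    EventuallyBounded l fun i (_ : Unit) => (qPochInf (f i) q)⁻¹ := by
  obtain ⟨C, hC⟩ := h
  refine ⟨C, hC.mono fun i hi _ => ?_⟩
  exact le_of_tendsto ((tendsto_qPoch (f i) hq).inv₀ (hne i)).norm (Eventually.of_forall hi)

/-- The leading factor `1 - w / q ^ m` of a nonempty symbol tends to infinity, while the inverse of
the remaining factors stays bounded. -/
theorem tendsto_inv_qPoch_div_pow {w : ℂ} (hq0 : 0 < ‖q‖) (hq : ‖q‖ < 1) (hw0 : w ≠ 0)
    (hw : ∀ n : ℤ, w * q ^ n ≠ 1) {k : ℕ} (hk : k ≠ 0) :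
    Tendsto (fun m : ℕ => (qPoch (w / q ^ m) q k)⁻¹) atTop (𝓝 0) := by
  obtain ⟨k, rfl⟩ := Nat.exists_eq_succ_of_ne_zero hk
  rw [← tendsto_add_atTop_iff_nat 1]
  have hqne : q ≠ 0 := norm_pos_iff.1 hq0
  obtain ⟨C, hC⟩ := eventuallyBounded_inv_qPoch_div_pow hq0 hq hw0 hw
  have h1 : Tendsto (fun m : ℕ => (1 - w / q ^ (m + 1))⁻¹) atTop (𝓝 0) := by
    refine tendsto_inv₀_cobounded.comp ?_
    rw [← tendsto_norm_atTop_iff_cobounded]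
    have := ((tendsto_div_pow_cobounded hw0 hq0 hq).comp (tendsto_add_atTop_nat 1))
    refine tendsto_atTop_mono (fun m => ?_) (tendsto_atTop_add_const_right _ (-1) this)
    have := norm_sub_norm_le (w / q ^ (m + 1)) 1
    rw [norm_sub_rev] at this
    simpa [sub_eq_add_neg] using this
  refine squeeze_zero_norm' (a := fun m => ‖(1 - w / q ^ (m + 1))⁻¹‖ * C) ?_
    (by simpa using h1.norm.mul_const C)
  filter_upwards [hC] with m hm
  have h2 : w / q ^ (m + 1) * q = w / q ^ m := by rw [pow_succ]; field_simp
  rw [qPoch_succ_left, h2, mul_inv, norm_mul]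
  gcongr
  exact hm k

end EventuallyBounded

/-! ### Bailey's sum: contiguous relations by telescoping. -/

section Bailey

variable {q a : ℂ}

/-- The well-poised factor `(aqy/P;q)_∞ / (Py;q)_∞`. -/
noncomputable def wpFactor (q a P y : ℂ) : ℂ := qPochInf (a * q * y / P) q / qPochInf (P * y) q

/-- The very-well-poised weight function with parameters `p` on the geometric progressions
over which Bailey's nonterminating sum is extended. -/
noncomputable def vwpWeight (q a : ℂ) (p : Fin 6 → ℂ) (y : ℂ) : ℂ :=
  y * (1 - a * y ^ 2) * ∏ i, wpFactor q a (p i) y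

/-- The function whose `q`-difference combines contiguous very-well-poised weights. -/
noncomputable def vwpTele (q a : ℂ) (p : Fin 6 → ℂ) (y : ℂ) : ℂ :=
  ∏ i, qPochInf (a * y / p i) q / qPochInf (p i * y) q

theorem wpFactor_mul_right {P y : ℂ} (hq0 : q ≠ 0) (hq : ‖q‖ < 1) (h : P * y ≠ 1) :
    wpFactor q a (P * q) y = (1 - a * y / P) * (1 - P * y) * wpFactor q a P y := by
  have h1 : 1 - P * y ≠ 0 := sub_ne_zero.2 h.symm
  have e1 : a * q * y / (P * q) = a * y / P := by
    rcases eq_or_ne P 0 with rfl | hP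
    · simp
    · field_simp
  have e2 : a * y / P * q = a * q * y / P := by ring
  have e3 : P * y * q = P * q * y := by ring
  rw [wpFactor, wpFactor, e1, qPochInf_eq_one_sub_mul (a * y / P) hq,
    qPochInf_eq_one_sub_mul (P * y) hq, e2, e3]
  generalize qPochInf (P * q * y) q = u
  -- If the remaining product in the denominator vanishes, both quotients are 0 by the convention
  -- for division by zero. Hence `P * y ≠ 1` is the only nonvanishing needed.
  rcases eq_or_ne u 0 with rfl | h0
  · simp
  · generalize 1 - P * y = v at *
    field_simp

theorem teleFactor_eq {P y : ℂ} (hq : ‖q‖ < 1) :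
    qPochInf (a * y / P) q / qPochInf (P * y) q = (1 - a * y / P) * wpFactor q a P y := by
  have e2 : a * y / P * q = a * q * y / P := by ring
  rw [wpFactor, qPochInf_eq_one_sub_mul (a * y / P) hq, e2, mul_div_assoc]

theorem teleFactor_mul_eq {P y : ℂ} (hq : ‖q‖ < 1) (h : P * y ≠ 1) :
    qPochInf (a * (y * q) / P) q / qPochInf (P * (y * q)) q
      = (1 - P * y) * wpFactor q a P y := by
  have h1 : 1 - P * y ≠ 0 := sub_ne_zero.2 h.symm
  have e2 : a * (y * q) / P = a * q * y / P := by ring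
  have e3 : P * y * q = P * (y * q) := by ring
  rw [wpFactor, qPochInf_eq_one_sub_mul (P * y) hq, e2, e3]
  generalize qPochInf (P * (y * q)) q = u
  rcases eq_or_ne u 0 with rfl | h0
  · simp
  · generalize 1 - P * y = v at *
    field_simp

/-- Balancing makes the difference of the two sextic products change sign under `y ↦ 1/(ay)`, up to
the factor `a^3 y^6`. It is therefore divisible by `y (1 - a y^2)`, and the quotient lies in the
span of `1 + a y^2` and `y`. The products `(1 - ay/B)(1 - By)` and `(1 - ay/F)(1 - Fy)` lie in that
span; the coefficients are read off at `y = 1/F` and `y = 1/B`. -/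
theorem vwp_contiguous_identity {a y A B C D E F : ℂ} (hA : A ≠ 0) (hB : B ≠ 0) (hC : C ≠ 0)
    (hD : D ≠ 0) (hE : E ≠ 0) (hF : F ≠ 0) (h : A * B * C * D * E * F = a ^ 3) :
    (F - B) * ((1 - a * y / A) * (1 - a * y / B) * (1 - a * y / C) * (1 - a * y / D) *
      (1 - a * y / E) * (1 - a * y / F) - (1 - A * y) * (1 - B * y) * (1 - C * y) * (1 - D * y) *
      (1 - E * y) * (1 - F * y)) =
    y * (1 - a * y ^ 2) *
      (F ^ 2 * ((1 - a / (A * F)) * (1 - a / (C * F)) * (1 - a / (D * F)) * (1 - a / (E * F))) *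
          ((1 - a * y / B) * (1 - B * y)) -
        B ^ 2 * ((1 - a / (A * B)) * (1 - a / (C * B)) * (1 - a / (D * B)) * (1 - a / (E * B))) *
          ((1 - a * y / F) * (1 - F * y))) := by
  obtain rfl : A = a ^ 3 / (B * C * D * E * F) := by rw [← h]; field_simp
  have ha : a ≠ 0 := by rintro rfl; simp at hA
  field_simp
  ring

/-- Coefficient of the contiguous relation attached to the parameter `B`. -/
noncomputable def vwpCoeff (a B A C D E : ℂ) : ℂ :=
  B ^ 2 * ((1 - a / (A * B)) * (1 - a / (C * B)) * (1 - a / (D * B)) * (1 - a / (E * B)))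

/-- Both values of `vwpTele` are the common product of `wpFactor`s times one of the two sextic
products, and raising `B` or `F` by `q` multiplies the weight by one of the two quadratic products.
This is `vwp_contiguous_identity` with a common factor restored. -/
theorem vwpTele_sub {A B C D E F y : ℂ} (hq0 : q ≠ 0) (hq : ‖q‖ < 1)
    (hne : ∀ i, ![A, B, C, D, E, F] i ≠ 0) (hy : ∀ i, ![A, B, C, D, E, F] i * y ≠ 1)
    (h : A * B * C * D * E * F = a ^ 3) :
    (F - B) * (vwpTele q a ![A, B, C, D, E, F] y - vwpTele q a ![A, B, C, D, E, F] (y * q)) =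
      vwpCoeff a F A C D E * vwpWeight q a ![A, B * q, C, D, E, F] y -
        vwpCoeff a B A C D E * vwpWeight q a ![A, B, C, D, E, F * q] y := by
  have e1 : vwpTele q a ![A, B, C, D, E, F] y =
      ∏ i, (1 - a * y / ![A, B, C, D, E, F] i) * wpFactor q a (![A, B, C, D, E, F] i) y :=
    prod_congr rfl fun i _ => teleFactor_eq hq
  have e2 : vwpTele q a ![A, B, C, D, E, F] (y * q) =
      ∏ i, (1 - ![A, B, C, D, E, F] i * y) * wpFactor q a (![A, B, C, D, E, F] i) y :=
    prod_congr rfl fun i _ => teleFactor_mul_eq hq (hy i)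
  have hB : B * y ≠ 1 := hy 1
  have hF : F * y ≠ 1 := hy 5
  rw [e1, e2]
  simp only [vwpWeight, Fin.prod_univ_six, Matrix.cons_val]
  rw [wpFactor_mul_right hq0 hq hB, wpFactor_mul_right hq0 hq hF]
  have key := vwp_contiguous_identity (y := y) (hne 0) (hne 1) (hne 2) (hne 3) (hne 4) (hne 5) h
  simp only [Matrix.cons_val] at key
  unfold vwpCoeff
  linear_combination (wpFactor q a A y * wpFactor q a B y * wpFactor q a C y * wpFactor q a D y *
    wpFactor q a E y * wpFactor q a F y) * key

theorem tendsto_mul_pow (w : ℂ) (hq : ‖q‖ < 1) : Tendsto (fun k : ℕ => w * q ^ k) atTop (𝓝 0) := by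
  simpa using (tendsto_pow_atTop_nhds_zero_of_norm_lt_one hq).const_mul w

theorem tendsto_qPochInf_nhds_zero {f : ℕ → ℂ} (hq : ‖q‖ < 1) (hf : Tendsto f atTop (𝓝 0)) :
    Tendsto (fun k => qPochInf (f k) q) atTop (𝓝 1) := by
  simpa [qPochInf_zero] using tendsto_qPochInf hq hf

theorem tendsto_vwpTele (p : Fin 6 → ℂ) (y : ℂ) (hq : ‖q‖ < 1) :
    Tendsto (fun k : ℕ => vwpTele q a p (y * q ^ k)) atTop (𝓝 1) := by
  have : Tendsto (fun k : ℕ => vwpTele q a p (y * q ^ k)) atTop (𝓝 (∏ _i : Fin 6, 1 / 1)) := by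
    refine tendsto_finsetProd _ fun i _ => Tendsto.div ?_ ?_ one_ne_zero
    · refine tendsto_qPochInf_nhds_zero hq ((tendsto_mul_pow (a * y / p i) hq).congr fun k => ?_)
      ring
    · refine tendsto_qPochInf_nhds_zero hq ((tendsto_mul_pow (p i * y) hq).congr fun k => ?_)
      ring
  simpa using this

theorem summable_vwpWeight (p : Fin 6 → ℂ) (y : ℂ) (hq : ‖q‖ < 1) :
    Summable fun k : ℕ => vwpWeight q a p (y * q ^ k) := by
  have h1 : Tendsto (fun k : ℕ => y * (1 - a * (y * q ^ k) ^ 2) *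
      ∏ i, wpFactor q a (p i) (y * q ^ k)) atTop
      (𝓝 (y * (1 - a * 0 ^ 2) * ∏ _i : Fin 6, 1 / 1)) := by
    refine Tendsto.mul ?_ (tendsto_finsetProd _ fun i _ => Tendsto.div ?_ ?_ one_ne_zero)
    · exact (tendsto_const_nhds.sub (((tendsto_mul_pow y hq).pow 2).const_mul a)).const_mul y
    · refine tendsto_qPochInf_nhds_zero hq
        ((tendsto_mul_pow (a * q * y / p i) hq).congr fun k => ?_)
      ring
    · refine tendsto_qPochInf_nhds_zero hq ((tendsto_mul_pow (p i * y) hq).congr fun k => ?_)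
      ring
  have h2 := (Asymptotics.isBigO_refl (fun k : ℕ => q ^ k) atTop).mul (h1.isBigO_one ℂ)
  refine summable_of_isBigO_nat (g := fun k => ‖q‖ ^ k)
    (summable_geometric_of_lt_one (norm_nonneg q) hq) ?_
  refine (h2.congr (fun k => ?_) (fun k => mul_one _)).trans ?_
  · simp only [vwpWeight]; ring
  · exact Asymptotics.IsBigO.of_norm_le fun k => (norm_pow q k).le

/-- The series telescopes: `vwpTele` is 0 at the initial point and tends to 1 along the progression.
The decisive point is that the resulting constant does not depend on the initial point. -/
theorem tsum_vwpWeight_contiguous {A B C D E F y : ℂ} (hq0 : q ≠ 0) (hq : ‖q‖ < 1)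
    (hne : ∀ i, ![A, B, C, D, E, F] i ≠ 0)
    (hy : ∀ i, ∀ k : ℕ, ![A, B, C, D, E, F] i * (y * q ^ k) ≠ 1)
    (h : A * B * C * D * E * F = a ^ 3) (h0 : vwpTele q a ![A, B, C, D, E, F] y = 0) :
    vwpCoeff a F A C D E * ∑' k : ℕ, vwpWeight q a ![A, B * q, C, D, E, F] (y * q ^ k) -
      vwpCoeff a B A C D E * ∑' k : ℕ, vwpWeight q a ![A, B, C, D, E, F * q] (y * q ^ k)
      = -(F - B) := by
  have hs1 := (summable_vwpWeight (a := a) ![A, B * q, C, D, E, F] y hq).hasSum.mul_left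
    (vwpCoeff a F A C D E)
  have hs2 := (summable_vwpWeight (a := a) ![A, B, C, D, E, F * q] y hq).hasSum.mul_left
    (vwpCoeff a B A C D E)
  have h1 := (hs1.sub hs2).tendsto_sum_nat
  refine tendsto_nhds_unique h1 ?_
  have h2 := ((tendsto_vwpTele (a := a) ![A, B, C, D, E, F] y hq).const_sub 0).const_mul (F - B)
  rw [zero_sub, mul_neg_one] at h2
  refine h2.congr fun n => ?_
  rw [← h0]
  have h3 := sum_range_sub' (fun k => vwpTele q a ![A, B, C, D, E, F] (y * q ^ k)) n
  rw [pow_zero, mul_one] at h3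
  rw [← h3, mul_sum]
  refine sum_congr rfl fun k _ => ?_
  rw [pow_succ, ← mul_assoc]
  exact vwpTele_sub hq0 hq hne (fun i => hy i k) h

end Bailey

/-! ### Bailey's sum: both sides satisfy the same first-order recurrence. -/

section Bailey

variable {q a : ℂ}

/-- No product `p i * p j / a` and no quotient of two parameters is an integer power of `q`. -/
structure VwpGeneric (q a : ℂ) (p : Fin 6 → ℂ) : Prop where
  ne_zero : ∀ i, p i ≠ 0
  mul_ne : ∀ i j, ∀ n : ℤ, p i * p j / a * q ^ n ≠ 1
  div_ne : ∀ i j, i ≠ j → ∀ n : ℤ, p i / p j * q ^ n ≠ 1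

theorem VwpGeneric.shift {p : Fin 6 → ℂ} (h : VwpGeneric q a p) (hq0 : q ≠ 0) (n : Fin 6 → ℤ) :
    VwpGeneric q a fun i => p i * q ^ n i where
  ne_zero i := mul_ne_zero (h.ne_zero i) (zpow_ne_zero _ hq0)
  mul_ne i j m := by
    convert h.mul_ne i j (n i + n j + m) using 1
    rw [zpow_add₀ hq0, zpow_add₀ hq0]; ring
  div_ne i j hij m := by
    convert h.div_ne i j hij (n i - n j + m) using 1
    have := zpow_ne_zero (n j) hq0
    have := h.ne_zero j
    rw [zpow_add₀ hq0, zpow_sub₀ hq0]; field_simp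

theorem VwpGeneric.comp {p : Fin 6 → ℂ} (h : VwpGeneric q a p) (σ : Equiv.Perm (Fin 6)) :
    VwpGeneric q a (p ∘ σ) where
  ne_zero _ := h.ne_zero _
  mul_ne _ _ := h.mul_ne _ _
  div_ne _ _ hij := h.div_ne _ _ (σ.injective.ne hij)

/-- The difference of the two very-well-poised series, extended over `y = p₀ q^k / a` and
`y = p₁ q^k / a`. -/
noncomputable def vwpIntegral (q a : ℂ) (p : Fin 6 → ℂ) : ℂ :=
  ∑' k : ℕ, vwpWeight q a p (p 0 / a * q ^ k) - ∑' k : ℕ, vwpWeight q a p (p 1 / a * q ^ k)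

/-- The product evaluation of `vwpIntegral`. -/
noncomputable def vwpValue (q a : ℂ) (p : Fin 6 → ℂ) : ℂ :=
  p 0 / a * (qPochInf q q * qPochInf (q * p 0 / p 1) q * qPochInf (p 1 / p 0) q) *
    (qPochInf (a * q / (p 2 * p 3)) q * qPochInf (a * q / (p 2 * p 4)) q *
      qPochInf (a * q / (p 2 * p 5)) q * qPochInf (a * q / (p 3 * p 4)) q *
      qPochInf (a * q / (p 3 * p 5)) q * qPochInf (a * q / (p 4 * p 5)) q) /
    (qPochInf (p 0 * p 1 / a) q *
      (qPochInf (p 0 * p 2 / a) q * qPochInf (p 0 * p 3 / a) q *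
        qPochInf (p 0 * p 4 / a) q * qPochInf (p 0 * p 5 / a) q) *
      (qPochInf (p 1 * p 2 / a) q * qPochInf (p 1 * p 3 / a) q *
        qPochInf (p 1 * p 4 / a) q * qPochInf (p 1 * p 5 / a) q))

theorem qPochInf_one (hq : ‖q‖ < 1) : qPochInf 1 q = 0 := by
  rw [qPochInf_eq_one_sub_mul 1 hq]; simp

theorem qPochInf_self_ne_zero (hq : ‖q‖ < 1) : qPochInf q q ≠ 0 := by
  refine qPochInf_ne_zero hq fun n h => ?_
  have h1 : ‖q‖ ^ (n + 1) = 1 := by rw [← norm_pow, pow_succ', h, norm_one]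
  exact (pow_lt_one₀ (norm_nonneg q) hq n.succ_ne_zero).ne h1

theorem vwpTele_start {p : Fin 6 → ℂ} (ha : a ≠ 0) (hq : ‖q‖ < 1) (i : Fin 6) (hi : p i ≠ 0) :
    vwpTele q a p (p i / a) = 0 := by
  refine prod_eq_zero (mem_univ i) ?_
  rw [mul_div_cancel₀ _ ha, div_self hi, qPochInf_one hq, zero_div]

theorem vwpWeight_start {p : Fin 6 → ℂ} {y : ℂ} (hq : ‖q‖ < 1) (i : Fin 6)
    (h : a * q * y / p i = 1) : vwpWeight q a p y = 0 := by
  refine mul_eq_zero_of_right _ (prod_eq_zero (mem_univ i) ?_)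
  rw [wpFactor, h, qPochInf_one hq, zero_div]

/-- Subtracting the telescoped relations for the progressions starting at `A / a` and `B / a`
removes the inhomogeneous constant. -/
theorem vwpIntegral_contiguous {A B C D E F : ℂ} (ha : a ≠ 0) (hq0 : q ≠ 0) (hq : ‖q‖ < 1)
    (hg : VwpGeneric q a ![A, B, C, D, E, F]) (h : A * B * C * D * E * F = a ^ 3) :
    vwpCoeff a B A C D E * vwpIntegral q a ![A, B, C, D, E, F * q] =
      vwpCoeff a F A C D E * vwpIntegral q a ![A, B * q, C, D, E, F] := by
  have hy : ∀ i j, ∀ k : ℕ, ![A, B, C, D, E, F] i * (![A, B, C, D, E, F] j / a * q ^ k) ≠ 1 := by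
    intro i j k
    have := hg.mul_ne i j k
    rw [zpow_natCast] at this
    rwa [← mul_assoc, ← mul_div_assoc]
  have e0 := tsum_vwpWeight_contiguous hq0 hq hg.ne_zero (fun i k => hy i 0 k) h
    (vwpTele_start ha hq 0 (hg.ne_zero 0))
  have e1 := tsum_vwpWeight_contiguous hq0 hq hg.ne_zero (fun i k => hy i 1 k) h
    (vwpTele_start ha hq 1 (hg.ne_zero 1))
  have hB : B ≠ 0 := hg.ne_zero 1
  -- For the raised parameter `B * q` the progression has to start one step later. The extra term at
  -- `B / a` vanishes because it contains `(1;q)_∞`.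
  have e2 : ∑' k : ℕ, vwpWeight q a ![A, B * q, C, D, E, F] (B / a * q ^ k) =
      ∑' k : ℕ, vwpWeight q a ![A, B * q, C, D, E, F] (B * q / a * q ^ k) := by
    rw [(summable_vwpWeight _ _ hq).tsum_eq_zero_add,
      vwpWeight_start hq 1 (by simp; field_simp), zero_add]
    refine tsum_congr fun k => ?_
    congr 1; ring
  simp only [Matrix.cons_val_zero, Matrix.cons_val_one] at e0 e1
  simp only [vwpIntegral, Matrix.cons_val_zero, Matrix.cons_val_one]
  rw [← e2]
  linear_combination e1 - e0

theorem vwpCoeff_identity {A B C D E F : ℂ} (hA : A ≠ 0) (hB : B ≠ 0) (hC : C ≠ 0)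
    (hD : D ≠ 0) (hE : E ≠ 0) (hF : F ≠ 0) (h : A * B * C * D * E * F = a ^ 3) :
    vwpCoeff a B A C D E * ((1 - B / A) * ((1 - a / (C * F)) * (1 - a / (D * F)) *
        (1 - a / (E * F))) * (1 - A * F / a)) =
      vwpCoeff a F A C D E * ((1 - A / B) * (1 - A * B / a) * ((1 - B * C / a) * (1 - B * D / a) *
        (1 - B * E / a))) := by
  obtain rfl : A = a ^ 3 / (B * C * D * E * F) := by rw [← h]; field_simp
  have ha : a ≠ 0 := by rintro rfl; simp at hA
  unfold vwpCoeff
  field_simp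
  ring

/-- Each infinite product changes by at most one factor between the two sides, so the relation
reduces to the rational identity `vwpCoeff_identity`. -/
theorem vwpValue_contiguous {A B C D E F : ℂ} (ha : a ≠ 0) (hq0 : q ≠ 0) (hq : ‖q‖ < 1)
    (hg : VwpGeneric q a ![A, B, C, D, E, F]) (h : A * B * C * D * E * F = a ^ 3) :
    vwpCoeff a B A C D E * vwpValue q a ![A, B, C, D, E, F * q] =
      vwpCoeff a F A C D E * vwpValue q a ![A, B * q, C, D, E, F] := by
  have hA : A ≠ 0 := hg.ne_zero 0
  have hB : B ≠ 0 := hg.ne_zero 1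
  have hC : C ≠ 0 := hg.ne_zero 2
  have hD : D ≠ 0 := hg.ne_zero 3
  have hE : E ≠ 0 := hg.ne_zero 4
  have hF : F ≠ 0 := hg.ne_zero 5
  have hne : ∀ i j, 1 - ![A, B, C, D, E, F] i * ![A, B, C, D, E, F] j / a ≠ 0 := fun i j => by
    have := hg.mul_ne i j 0
    rw [zpow_zero, mul_one] at this
    exact sub_ne_zero.2 this.symm
  have n01 : 1 - A * B / a ≠ 0 := hne 0 1
  have n05 : 1 - A * F / a ≠ 0 := hne 0 5
  have n12 : 1 - B * C / a ≠ 0 := hne 1 2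
  have n13 : 1 - B * D / a ≠ 0 := hne 1 3
  have n14 : 1 - B * E / a ≠ 0 := hne 1 4
  have key := vwpCoeff_identity (a := a) hA hB hC hD hE hF h
  have r1 : qPochInf (B / A) q = (1 - B / A) * qPochInf (B * q / A) q := by
    rw [qPochInf_eq_one_sub_mul _ hq]; congr 2; ring
  have r2 : qPochInf (q * A / (B * q)) q = (1 - A / B) * qPochInf (q * A / B) q := by
    rw [show q * A / (B * q) = A / B by field_simp, qPochInf_eq_one_sub_mul _ hq]
    congr 2; ring
  have r3 : ∀ P : ℂ, P ≠ 0 → qPochInf (a * q / (P * (F * q))) q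
      = (1 - a / (P * F)) * qPochInf (a * q / (P * F)) q := fun P hP => by
    rw [show a * q / (P * (F * q)) = a / (P * F) by field_simp, qPochInf_eq_one_sub_mul _ hq]
    congr 2; ring
  have r4 : ∀ P : ℂ, qPochInf (B * P / a) q = (1 - B * P / a) * qPochInf (B * q * P / a) q :=
    fun P => by rw [qPochInf_eq_one_sub_mul _ hq]; congr 2; ring
  have r5 : qPochInf (A * B / a) q = (1 - A * B / a) * qPochInf (A * (B * q) / a) q := by
    rw [qPochInf_eq_one_sub_mul _ hq]; congr 2; ring
  have r6 : qPochInf (A * F / a) q = (1 - A * F / a) * qPochInf (A * (F * q) / a) q := by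
    rw [qPochInf_eq_one_sub_mul _ hq]; congr 2; ring
  have r7 : B * (F * q) / a = B * q * F / a := by ring
  simp only [vwpValue, Matrix.cons_val]
  rw [r2, r1, r3 C hC, r3 D hD, r3 E hE, r4 C, r4 D, r4 E, r5, r6, r7]
  generalize qPochInf (B * q / A) q = t1
  generalize qPochInf (q * A / B) q = t2
  generalize qPochInf (a * q / (C * F)) q = t3
  generalize qPochInf (a * q / (D * F)) q = t4
  generalize qPochInf (a * q / (E * F)) q = t5
  generalize qPochInf (a * q / (C * D)) q = t6
  generalize qPochInf (a * q / (C * E)) q = t7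
  generalize qPochInf (a * q / (D * E)) q = t8
  generalize qPochInf q q = t9
  generalize hX : (qPochInf (A * (B * q) / a) q * (qPochInf (A * C / a) q * qPochInf (A * D / a) q *
    qPochInf (A * E / a) q * qPochInf (A * (F * q) / a) q) * (qPochInf (B * q * C / a) q *
    qPochInf (B * q * D / a) q * qPochInf (B * q * E / a) q * qPochInf (B * q * F / a) q)) = X
  have x1 : (1 - A * B / a) * qPochInf (A * (B * q) / a) q * (qPochInf (A * C / a) q *
      qPochInf (A * D / a) q * qPochInf (A * E / a) q * qPochInf (A * (F * q) / a) q) *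
      ((1 - B * C / a) * qPochInf (B * q * C / a) q * ((1 - B * D / a) * qPochInf (B * q * D / a) q) *
      ((1 - B * E / a) * qPochInf (B * q * E / a) q) * qPochInf (B * q * F / a) q) =
      (1 - A * B / a) * ((1 - B * C / a) * (1 - B * D / a) * (1 - B * E / a)) * X := by
    rw [← hX]; ring
  have x2 : qPochInf (A * (B * q) / a) q * (qPochInf (A * C / a) q * qPochInf (A * D / a) q *
      qPochInf (A * E / a) q * ((1 - A * F / a) * qPochInf (A * (F * q) / a) q)) *
      (qPochInf (B * q * C / a) q * qPochInf (B * q * D / a) q * qPochInf (B * q * E / a) q *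
      qPochInf (B * q * F / a) q) = (1 - A * F / a) * X := by
    rw [← hX]; ring
  rw [x1, x2]
  generalize vwpCoeff a B A C D E = cB at *
  generalize vwpCoeff a F A C D E = cF at *
  generalize 1 - A * B / a = u1 at *
  generalize 1 - A * F / a = u2 at *
  generalize 1 - B * C / a = u3 at *
  generalize 1 - B * D / a = u4 at *
  generalize 1 - B * E / a = u5 at *
  generalize 1 - B / A = v1 at *
  generalize 1 - A / B = v2 at *
  generalize 1 - a / (C * F) = v3 at *
  generalize 1 - a / (D * F) = v4 at *
  generalize 1 - a / (E * F) = v5 at *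
  rcases eq_or_ne X 0 with rfl | hX0
  · simp
  · rw [mul_div_assoc', mul_div_assoc', div_eq_div_iff (by positivity) (by positivity)]
    linear_combination (A / a * t1 * t2 * t3 * t4 * t5 * t6 * t7 * t8 * t9 * X) * key

theorem vwpCoeff_ne_zero {A B C D E F : ℂ} (hg : VwpGeneric q a ![A, B, C, D, E, F]) :
    vwpCoeff a B A C D E ≠ 0 := by
  have hB : B ≠ 0 := hg.ne_zero 1
  have hne : ∀ i, 1 - a / (![A, B, C, D, E, F] i * B) ≠ 0 := fun i h => by
    have h1 := hg.mul_ne i 1 0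
    rw [zpow_zero, mul_one] at h1
    apply h1
    have h2 : a / (![A, B, C, D, E, F] i * B) = 1 := (sub_eq_zero.1 h).symm
    rw [← inv_div]
    exact inv_eq_one.2 h2
  exact mul_ne_zero (pow_ne_zero _ hB)
    (mul_ne_zero (mul_ne_zero (mul_ne_zero (hne 0) (hne 2)) (hne 3)) (hne 4))

theorem vwpValue_ne_zero {p : Fin 6 → ℂ} (ha : a ≠ 0) (hq0 : q ≠ 0) (hq : ‖q‖ < 1)
    (hg : VwpGeneric q a p) : vwpValue q a p ≠ 0 := by
  have h1 : ∀ i j, qPochInf (p i * p j / a) q ≠ 0 := fun i j =>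
    qPochInf_ne_zero hq fun n => by simpa using hg.mul_ne i j n
  have h2 : ∀ i j, qPochInf (a * q / (p i * p j)) q ≠ 0 := fun i j =>
    qPochInf_ne_zero hq fun n h => hg.mul_ne i j (-(n + 1 : ℤ)) (by
      rw [zpow_neg, ← inv_div a, ← mul_inv, inv_eq_one, ← h, zpow_add_one₀ hq0, zpow_natCast]
      ring)
  have h3 : qPochInf (q * p 0 / p 1) q ≠ 0 := qPochInf_ne_zero hq fun n h =>
    hg.div_ne 0 1 (by decide) (n + 1) (by rw [← h, zpow_add_one₀ hq0, zpow_natCast]; ring)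
  have h4 : qPochInf (p 1 / p 0) q ≠ 0 := qPochInf_ne_zero hq fun n => by
    simpa using hg.div_ne 1 0 (by decide) n
  have h5 := qPochInf_self_ne_zero hq
  have h6 := hg.ne_zero 0
  unfold vwpValue
  simp only [ne_eq, div_eq_zero_iff, mul_eq_zero, h1, h2, h3, h4, h5, h6, ha, or_self,
    not_false_eq_true]

/-- The quotient of the two sides is unchanged under `p₁ ↦ p₁ q`, `p₅ ↦ p₅ / q`. -/
theorem vwpRatio_shift_one_five {p : Fin 6 → ℂ} (ha : a ≠ 0) (hq0 : q ≠ 0) (hq : ‖q‖ < 1)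
    (hg : VwpGeneric q a p) (h : ∏ i, p i = a ^ 3 * q) :
    vwpIntegral q a p / vwpValue q a p =
      vwpIntegral q a (fun i => p i * q ^ (![0, 1, 0, 0, 0, -1] : Fin 6 → ℤ) i) /
        vwpValue q a (fun i => p i * q ^ (![0, 1, 0, 0, 0, -1] : Fin 6 → ℤ) i) := by
  have e1 : p = ![p 0, p 1, p 2, p 3, p 4, p 5 / q * q] := by
    funext i; fin_cases i <;> simp [hq0]
  have e2 : (fun i => p i * q ^ (![0, 1, 0, 0, 0, -1] : Fin 6 → ℤ) i) =
      ![p 0, p 1 * q, p 2, p 3, p 4, p 5 / q] := by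
    funext i; fin_cases i <;> simp [div_eq_mul_inv]
  have e3 : (fun i => p i * q ^ (![0, 0, 0, 0, 0, -1] : Fin 6 → ℤ) i) =
      ![p 0, p 1, p 2, p 3, p 4, p 5 / q] := by
    funext i; fin_cases i <;> simp [div_eq_mul_inv]
  have hg3 := hg.shift hq0 ![0, 0, 0, 0, 0, -1]
  have hg2 := hg.shift hq0 ![0, 1, 0, 0, 0, -1]
  have n1 := vwpValue_ne_zero ha hq0 hq hg
  have n2 := vwpValue_ne_zero ha hq0 hq hg2
  rw [e3] at hg3
  rw [e2] at n2 ⊢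
  have hbal : p 0 * p 1 * p 2 * p 3 * p 4 * (p 5 / q) = a ^ 3 := by
    rw [← mul_div_assoc, div_eq_iff hq0, ← h, Fin.prod_univ_six]
  have c1 := vwpIntegral_contiguous ha hq0 hq hg3 hbal
  have c2 := vwpValue_contiguous ha hq0 hq hg3 hbal
  rw [← e1] at c1 c2
  rw [div_eq_div_iff n1 n2]
  refine mul_left_cancel₀ (vwpCoeff_ne_zero hg3) ?_
  linear_combination vwpValue q a ![p 0, p 1 * q, p 2, p 3, p 4, p 5 / q] * c1 -
    vwpIntegral q a ![p 0, p 1 * q, p 2, p 3, p 4, p 5 / q] * c2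

end Bailey

/-! ### Bailey's sum: symmetry and iterated parameter shifts. -/

section Bailey

variable {q a : ℂ}

theorem vwpWeight_comp (p : Fin 6 → ℂ) (σ : Equiv.Perm (Fin 6)) :
    vwpWeight q a (p ∘ σ) = vwpWeight q a p := by
  funext y
  simp only [vwpWeight, Function.comp_apply]
  rw [Equiv.prod_comp σ fun i => wpFactor q a (p i) y]

/-- The quotient of the two sides of Bailey's summation. -/
noncomputable def vwpRatio (q a : ℂ) (p : Fin 6 → ℂ) : ℂ := vwpIntegral q a p / vwpValue q a p

theorem vwpRatio_comp_swap {p : Fin 6 → ℂ} (i : Fin 6) (hi : i = 2 ∨ i = 3 ∨ i = 4 ∨ i = 5) :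
    vwpRatio q a (p ∘ Equiv.swap i 5) = vwpRatio q a p := by
  have h0 : Equiv.swap i 5 0 = 0 := by
    rcases hi with rfl | rfl | rfl | rfl <;> decide
  have h1 : Equiv.swap i 5 1 = 1 := by
    rcases hi with rfl | rfl | rfl | rfl <;> decide
  rw [vwpRatio, vwpRatio]
  congr 1
  · simp only [vwpIntegral, vwpWeight_comp, Function.comp_apply, h0, h1]
  · have e : ∀ j k l : Fin 6, Equiv.swap j k l = if l = j then k else if l = k then j else l :=
      fun j k l => Equiv.swap_apply_def j k l
    rcases hi with rfl | rfl | rfl | rfl <;>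
    simp only [vwpValue, Function.comp_apply, e, Fin.reduceEq, if_true, if_false] <;>
    simp only [mul_comm (p 5), mul_comm (p 4) (p 3), mul_comm (p 4) (p 2), mul_comm (p 3) (p 2)] <;>
    ring

theorem vwpRatio_comp_swap_zero_one {p : Fin 6 → ℂ} (h0 : p 0 ≠ 0) (h1 : p 1 ≠ 0)
    (hq : ‖q‖ < 1) : vwpRatio q a (p ∘ Equiv.swap 0 1) = vwpRatio q a p := by
  have e : ∀ j k l : Fin 6, Equiv.swap j k l = if l = j then k else if l = k then j else l :=
    fun j k l => Equiv.swap_apply_def j k l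
  have hi : vwpIntegral q a (p ∘ Equiv.swap 0 1) = -vwpIntegral q a p := by
    simp only [vwpIntegral, vwpWeight_comp, Function.comp_apply, Equiv.swap_apply_left,
      Equiv.swap_apply_right]
    ring
  have r1 : qPochInf (p 0 / p 1) q = (1 - p 0 / p 1) * qPochInf (q * p 0 / p 1) q := by
    rw [qPochInf_eq_one_sub_mul _ hq]; congr 2; ring
  have r2 : qPochInf (p 1 / p 0) q = (1 - p 1 / p 0) * qPochInf (q * p 1 / p 0) q := by
    rw [qPochInf_eq_one_sub_mul _ hq]; congr 2; ring
  have hv : vwpValue q a (p ∘ Equiv.swap 0 1) = -vwpValue q a p := by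
    simp only [vwpValue, Function.comp_apply, e, Fin.reduceEq, if_true, if_false]
    rw [r1, r2, mul_comm (p 1) (p 0)]
    have : p 1 / a * (1 - p 0 / p 1) = -(p 0 / a * (1 - p 1 / p 0)) := by field_simp; ring
    linear_combination (qPochInf q q * qPochInf (q * p 0 / p 1) q * qPochInf (q * p 1 / p 0) q *
      (qPochInf (a * q / (p 2 * p 3)) q * qPochInf (a * q / (p 2 * p 4)) q *
      qPochInf (a * q / (p 2 * p 5)) q * qPochInf (a * q / (p 3 * p 4)) q *
      qPochInf (a * q / (p 3 * p 5)) q * qPochInf (a * q / (p 4 * p 5)) q) /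
    (qPochInf (p 0 * p 1 / a) q *
      (qPochInf (p 0 * p 2 / a) q * qPochInf (p 0 * p 3 / a) q *
        qPochInf (p 0 * p 4 / a) q * qPochInf (p 0 * p 5 / a) q) *
      (qPochInf (p 1 * p 2 / a) q * qPochInf (p 1 * p 3 / a) q *
        qPochInf (p 1 * p 4 / a) q * qPochInf (p 1 * p 5 / a) q))) * this
  rw [vwpRatio, vwpRatio, hi, hv, neg_div_neg_eq]

/-- A permutation that preserves the quotient conjugates the basic shift into a shift between
another pair of parameters. -/
theorem vwpRatio_shift_of_perm {p : Fin 6 → ℂ} (ha : a ≠ 0) (hq0 : q ≠ 0) (hq : ‖q‖ < 1)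
    (hg : VwpGeneric q a p) (h : ∏ i, p i = a ^ 3 * q) (σ : Equiv.Perm (Fin 6))
    (hσ : ∀ p : Fin 6 → ℂ, (∀ i, p i ≠ 0) → vwpRatio q a (p ∘ σ) = vwpRatio q a p) :
    vwpRatio q a p =
      vwpRatio q a (fun i => p i * q ^ (![0, 1, 0, 0, 0, -1] : Fin 6 → ℤ) (σ i)) := by
  have h1 := vwpRatio_shift_one_five ha hq0 hq (hg.comp σ.symm)
    (by rw [← h]; exact Equiv.prod_comp σ.symm p)
  have h2 := hσ (p ∘ σ.symm) fun i => hg.ne_zero _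
  have e : (p ∘ σ.symm) ∘ σ = p := by funext i; simp
  rw [e] at h2
  rw [h2]
  refine h1.trans ?_
  rw [← vwpRatio, ← hσ _ ((hg.comp σ.symm).shift hq0 _).ne_zero]
  congr 1
  funext i
  simp

/-- The direction in which Bailey's summation is iterated. -/
def vwpDirection : Fin 6 → ℤ := ![1, 3, -1, -1, -1, -1]

theorem prod_mul_zpow {p : Fin 6 → ℂ} (hq0 : q ≠ 0) (n : Fin 6 → ℤ)
    (hn : ∑ i, n i = 0) : ∏ i, p i * q ^ n i = ∏ i, p i := by
  rw [prod_mul_distrib]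
  have : ∏ i, q ^ n i = q ^ ∑ i, n i := by
    simp only [Fin.prod_univ_six, Fin.sum_univ_six, zpow_add₀ hq0]
  rw [this, hn, zpow_zero, mul_one]

theorem vwpRatio_shift_direction {p : Fin 6 → ℂ} (ha : a ≠ 0) (hq0 : q ≠ 0) (hq : ‖q‖ < 1)
    (hg : VwpGeneric q a p) (h : ∏ i, p i = a ^ 3 * q) :
    vwpRatio q a p = vwpRatio q a fun i => p i * q ^ vwpDirection i := by
  have s : ∀ i : Fin 6, i = 2 ∨ i = 3 ∨ i = 4 ∨ i = 5 → ∀ p : Fin 6 → ℂ, (∀ i, p i ≠ 0) →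
      vwpRatio q a (p ∘ Equiv.swap i 5) = vwpRatio q a p :=
    fun i hi p _ => vwpRatio_comp_swap i hi
  have sum0 : ∀ σ : Equiv.Perm (Fin 6), ∑ i, (![0, 1, 0, 0, 0, -1] : Fin 6 → ℤ) (σ i) = 0 :=
    fun σ => by rw [Equiv.sum_comp σ]; decide
  -- Four moves compose to `vwpDirection`: the parameters 5, 4 and 3 each pass a factor `q` to
  -- parameter 1, and parameter 2 passes one to parameter 0. The uneven split 3 against 1 makes `p 1
  -- / p 0` tend to 0 under iteration.
  rw [vwpRatio_shift_of_perm ha hq0 hq hg h (Equiv.swap 5 5) (s 5 (by simp))]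
  have h1 := (prod_mul_zpow (p := p) hq0 _ (sum0 (Equiv.swap 5 5))).trans h
  have g1 := hg.shift hq0 fun i => (![0, 1, 0, 0, 0, -1] : Fin 6 → ℤ) (Equiv.swap 5 5 i)
  rw [vwpRatio_shift_of_perm ha hq0 hq g1 h1 (Equiv.swap 4 5) (s 4 (by simp))]
  have h2 := (prod_mul_zpow hq0 _ (sum0 (Equiv.swap 4 5))).trans h1
  have g2 := g1.shift hq0 fun i => (![0, 1, 0, 0, 0, -1] : Fin 6 → ℤ) (Equiv.swap 4 5 i)
  rw [vwpRatio_shift_of_perm ha hq0 hq g2 h2 (Equiv.swap 3 5) (s 3 (by simp))]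
  have h3 := (prod_mul_zpow hq0 _ (sum0 (Equiv.swap 3 5))).trans h2
  have g3 := g2.shift hq0 fun i => (![0, 1, 0, 0, 0, -1] : Fin 6 → ℤ) (Equiv.swap 3 5 i)
  rw [vwpRatio_shift_of_perm ha hq0 hq g3 h3 (Equiv.swap 2 5 * Equiv.swap 0 1) (by
    intro p hp
    rw [← s 2 (by simp) p hp,
      ← vwpRatio_comp_swap_zero_one (p := p ∘ Equiv.swap 2 5) (hp _) (hp _) hq]
    rfl)]
  congr 1
  funext i
  have : vwpDirection i = (![0, 1, 0, 0, 0, -1] : Fin 6 → ℤ) (Equiv.swap 5 5 i) +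
      (![0, 1, 0, 0, 0, -1] : Fin 6 → ℤ) (Equiv.swap 4 5 i) +
      (![0, 1, 0, 0, 0, -1] : Fin 6 → ℤ) (Equiv.swap 3 5 i) +
      (![0, 1, 0, 0, 0, -1] : Fin 6 → ℤ) ((Equiv.swap 2 5 * Equiv.swap 0 1 : Equiv.Perm (Fin 6)) i) := by
    revert i; decide
  rw [this, zpow_add₀ hq0, zpow_add₀ hq0, zpow_add₀ hq0]
  ring

theorem vwpRatio_shift_direction_pow {p : Fin 6 → ℂ} (ha : a ≠ 0) (hq0 : q ≠ 0) (hq : ‖q‖ < 1)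
    (hg : VwpGeneric q a p) (h : ∏ i, p i = a ^ 3 * q) (N : ℕ) :
    vwpRatio q a p = vwpRatio q a fun i => p i * q ^ (N * vwpDirection i) := by
  induction N with
  | zero => simp
  | succ N ih =>
    rw [ih, vwpRatio_shift_direction ha hq0 hq (hg.shift hq0 _) ((prod_mul_zpow hq0 _ (by
      rw [← mul_sum, show ∑ i, vwpDirection i = 0 by decide, mul_zero])).trans h)]
    congr 1
    funext i
    rw [mul_assoc, ← zpow_add₀ hq0]
    congr 2
    push_cast; ring

/-- The normalized terms of a very-well-poised series. -/
noncomputable def vwpTerm (q a : ℂ) (p : Fin 6 → ℂ) (y : ℂ) (k : ℕ) : ℂ :=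
  (1 - a * y ^ 2 * q ^ (2 * k)) * (1 - a * y ^ 2)⁻¹ *
    (∏ i, qPoch (p i * y) q k * (qPoch (a * q * y / p i) q k)⁻¹) * q ^ k

theorem vwpWeight_mul_pow {p : Fin 6 → ℂ} {y : ℂ} (hq : ‖q‖ < 1) (h1 : 1 - a * y ^ 2 ≠ 0) (k : ℕ)
    (h2 : ∀ i, qPoch (p i * y) q k ≠ 0) (h3 : ∀ i, qPoch (a * q * y / p i) q k ≠ 0) :
    vwpWeight q a p (y * q ^ k) = vwpWeight q a p y * vwpTerm q a p y k := by
  have e : ∀ i, wpFactor q a (p i) (y * q ^ k) =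
      wpFactor q a (p i) y * (qPoch (p i * y) q k * (qPoch (a * q * y / p i) q k)⁻¹) := by
    intro i
    have h2 := h2 i
    have h3 := h3 i
    rw [wpFactor, wpFactor, qPochInf_eq_mul (a * q * y / p i) hq k, qPochInf_eq_mul (p i * y) hq k,
      show a * q * (y * q ^ k) / p i = a * q * y / p i * q ^ k by ring,
      show p i * (y * q ^ k) = p i * y * q ^ k by ring]
    generalize qPochInf (p i * y * q ^ k) q = u
    rcases eq_or_ne u 0 with rfl | h0
    · simp
    · generalize qPoch (p i * y) q k = v at *
      generalize qPoch (a * q * y / p i) q k = w at *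
      field_simp
  simp only [vwpWeight, vwpTerm, e, prod_mul_distrib]
  have : y * q ^ k * (1 - a * (y * q ^ k) ^ 2) =
      y * (1 - a * y ^ 2) * ((1 - a * y ^ 2 * q ^ (2 * k)) * (1 - a * y ^ 2)⁻¹ * q ^ k) := by
    linear_combination (-(y * q ^ k * (1 - a * y ^ 2 * q ^ (2 * k)))) * mul_inv_cancel₀ h1
  rw [this]
  ring

theorem exists_norm_vwpTerm_le {ι : Type*} {l : Filter ι} {p : ι → Fin 6 → ℂ} {y : ι → ℂ} {w : ℂ}
    (hq : ‖q‖ < 1) (hw : w ≠ 1) (hy : Tendsto (fun i => a * y i ^ 2) l (𝓝 w))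
    (hnum : ∀ j, EventuallyBounded l fun i k => qPoch (p i j * y i) q k)
    (hden : ∀ j, EventuallyBounded l fun i k => (qPoch (a * q * y i / p i j) q k)⁻¹) :
    ∃ C, ∀ᶠ i in l, ∀ k, ‖vwpTerm q a (p i) (y i) k‖ ≤ C * ‖q‖ ^ k := by
  have h1 : EventuallyBounded l fun i (k : ℕ) => 1 - a * y i ^ 2 * q ^ (2 * k) := by
    refine ⟨1 + (‖w‖ + 1), ?_⟩
    filter_upwards [hy.norm.eventually (ge_mem_nhds (lt_add_one ‖w‖))] with i hi k
    refine (norm_sub_le _ _).trans ?_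
    rw [norm_one, norm_mul, norm_pow q]
    gcongr
    calc ‖a * y i ^ 2‖ * ‖q‖ ^ (2 * k) ≤ ‖a * y i ^ 2‖ * 1 := by
          gcongr
          exact pow_le_one₀ (norm_nonneg _) hq.le
      _ ≤ _ := by simpa using hi
  have h2 : EventuallyBounded l fun i (_ : ℕ) => (1 - a * y i ^ 2)⁻¹ :=
    .of_tendsto ((hy.const_sub 1).inv₀ (sub_ne_zero.2 hw.symm))
  obtain ⟨C, hC⟩ := (h1.mul h2).mul
    (EventuallyBounded.prod (s := univ) fun j _ => (hnum j).mul (hden j))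
  refine ⟨C, hC.mono fun i hi k => ?_⟩
  rw [vwpTerm, norm_mul, norm_pow]
  gcongr
  exact hi k

end Bailey

/-! ### Bailey's sum: the limit of the shifted identity. -/

section Bailey

variable {q a : ℂ}

theorem tendsto_mul_zpow_natCast_mul (w : ℂ) (hq : ‖q‖ < 1) {m : ℤ} (hm : 0 ≤ m) :
    ∃ w' : ℂ, (w' = w ∨ w' = 0) ∧ (0 < m → w' = 0) ∧
      Tendsto (fun N : ℕ => w * q ^ (N * m : ℤ)) atTop (𝓝 w') := by
  obtain ⟨n, rfl⟩ := Int.eq_ofNat_of_zero_le hm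
  have e : ∀ N : ℕ, w * q ^ (N * n : ℤ) = w * (q ^ n) ^ N := fun N => by
    rw [← pow_mul, mul_comm n N, ← zpow_natCast q (N * n)]; push_cast; rfl
  simp only [e]
  rcases Nat.eq_zero_or_pos n with rfl | hn
  · exact ⟨w, Or.inl rfl, by simp, by simp⟩
  · refine ⟨0, Or.inr rfl, fun _ => rfl, tendsto_mul_pow w ?_⟩
    rw [norm_pow]
    exact pow_lt_one₀ (norm_nonneg q) hq hn.ne'

theorem VwpGeneric.shifted_den_ne {p : Fin 6 → ℂ} (hg : VwpGeneric q a p) (hq0 : q ≠ 0)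
    (hq : ‖q‖ < 1) (s i : Fin 6) (n : ℕ) : q * p s / p i * q ^ n ≠ 1 := by
  rcases eq_or_ne s i with rfl | hsi
  · rw [mul_div_cancel_right₀ _ (hg.ne_zero s), ← pow_succ']
    intro h
    have : ‖q‖ ^ (n + 1) = 1 := by rw [← norm_pow, h, norm_one]
    exact (pow_lt_one₀ (norm_nonneg q) hq n.succ_ne_zero).ne this
  · have := hg.div_ne s i hsi (n + 1)
    rw [zpow_add_one₀ hq0, zpow_natCast] at this
    convert this using 1
    ring

/-- After division by the leading weight, every remaining infinite product has an argument that is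
multiplied by `q^2` in each step along `vwpDirection`, so all of them tend to 1. -/
theorem vwpValue_eq_weight_mul {p : Fin 6 → ℂ} (ha : a ≠ 0) (hq0 : q ≠ 0) (hq : ‖q‖ < 1)
    (hg : VwpGeneric q a p) :
    vwpValue q a p = vwpWeight q a p (p 0 / a) *
      ((qPochInf (q * p 0 * p 0 / a) q * qPochInf (p 1 / p 0) q *
        (qPochInf (a * q / (p 2 * p 3)) q * qPochInf (a * q / (p 2 * p 4)) q *
        qPochInf (a * q / (p 2 * p 5)) q * qPochInf (a * q / (p 3 * p 4)) q *
        qPochInf (a * q / (p 3 * p 5)) q * qPochInf (a * q / (p 4 * p 5)) q)) /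
      ((qPochInf (q * p 0 / p 2) q * qPochInf (q * p 0 / p 3) q *
        qPochInf (q * p 0 / p 4) q * qPochInf (q * p 0 / p 5) q) *
      (qPochInf (p 1 * p 2 / a) q * qPochInf (p 1 * p 3 / a) q *
        qPochInf (p 1 * p 4 / a) q * qPochInf (p 1 * p 5 / a) q))) := by
  have h0 := hg.ne_zero 0
  have d : ∀ i, qPochInf (q * p 0 / p i) q ≠ 0 := fun i =>
    qPochInf_ne_zero hq (hg.shifted_den_ne hq0 hq 0 i)
  have u : ∀ i j, qPochInf (p i * p j / a) q ≠ 0 := fun i j =>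
    qPochInf_ne_zero hq fun n => by simpa using hg.mul_ne i j n
  have e1 : ∀ i, wpFactor q a (p i) (p 0 / a) =
      qPochInf (q * p 0 / p i) q / qPochInf (p 0 * p i / a) q := fun i => by
    rw [wpFactor]
    congr 2
    · field_simp
    · ring
  have e2 : q * p 0 / p 0 = q := by field_simp
  have e3 : qPochInf (p 0 * p 0 / a) q = (1 - p 0 * p 0 / a) * qPochInf (q * p 0 * p 0 / a) q := by
    rw [qPochInf_eq_one_sub_mul _ hq]; congr 2; ring
  have e4 : 1 - a * (p 0 / a) ^ 2 = 1 - p 0 * p 0 / a := by field_simp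
  have u0 := u 0 0
  rw [e3] at u0
  have u1 := left_ne_zero_of_mul u0
  have u2 := right_ne_zero_of_mul u0
  simp only [vwpWeight, e1, Fin.prod_univ_six, e2, e3, e4]
  rw [vwpValue]
  have d2 := d 2
  have d3 := d 3
  have d4 := d 4
  have d5 := d 5
  have u01 := u 0 1
  have u02 := u 0 2
  have u03 := u 0 3
  have u04 := u 0 4
  have u05 := u 0 5
  have u12 := u 1 2
  have u13 := u 1 3
  have u14 := u 1 4
  have u15 := u 1 5
  generalize qPochInf (q * p 0 / p 2) q = x1 at *
  generalize qPochInf (q * p 0 / p 3) q = x2 at *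
  generalize qPochInf (q * p 0 / p 4) q = x3 at *
  generalize qPochInf (q * p 0 / p 5) q = x4 at *
  generalize qPochInf (p 0 * p 1 / a) q = x5 at *
  generalize qPochInf (p 0 * p 2 / a) q = x6 at *
  generalize qPochInf (p 0 * p 3 / a) q = x7 at *
  generalize qPochInf (p 0 * p 4 / a) q = x8 at *
  generalize qPochInf (p 0 * p 5 / a) q = x9 at *
  generalize qPochInf (p 1 * p 2 / a) q = x10 at *
  generalize qPochInf (p 1 * p 3 / a) q = x11 at *
  generalize qPochInf (p 1 * p 4 / a) q = x12 at *
  generalize qPochInf (p 1 * p 5 / a) q = x13 at *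
  generalize qPochInf (q * p 0 * p 0 / a) q = x14 at *
  generalize 1 - p 0 * p 0 / a = x15 at *
  field_simp

theorem EventuallyBounded.tendsto_mul_zero {ι κ : Type*} {l : Filter ι} {f : ι → ℂ} {g : ι → κ → ℂ}
    (hg : EventuallyBounded l g) (k : κ) (hf : Tendsto f l (𝓝 0)) :
    Tendsto (fun i => f i * g i k) l (𝓝 0) := by
  obtain ⟨C, hC⟩ := hg
  refine squeeze_zero_norm' (a := fun i => ‖f i‖ * C) ?_ (by simpa using hf.norm.mul_const C)
  filter_upwards [hC] with i hi
  rw [norm_mul]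
  gcongr
  exact hi k

theorem EventuallyBounded.comp_tendsto {ι ι' κ : Type*} {l : Filter ι} {l' : Filter ι'}
    {g : ι → κ → ℂ} (hg : EventuallyBounded l g) {φ : ι' → ι} (hφ : Tendsto φ l' l) :
    EventuallyBounded l' fun i k => g (φ i) k := by
  obtain ⟨C, hC⟩ := hg
  exact ⟨C, hφ.eventually hC⟩

theorem VwpGeneric.weight_mul_pow {p : Fin 6 → ℂ} (hg : VwpGeneric q a p) (ha : a ≠ 0)
    (hq0 : q ≠ 0) (hq : ‖q‖ < 1) (s : Fin 6) (k : ℕ) :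
    vwpWeight q a p (p s / a * q ^ k) =
      vwpWeight q a p (p s / a) * vwpTerm q a p (p s / a) k := by
  refine vwpWeight_mul_pow hq (fun h => hg.mul_ne s s 0 ?_) k
    (fun i => qPoch_ne_zero (fun n => ?_) k) (fun i => qPoch_ne_zero (fun n => ?_) k)
  · rw [sub_eq_zero] at h
    rw [h]; field_simp
  · simpa [mul_div_assoc] using hg.mul_ne i s n
  · convert hg.shifted_den_ne hq0 hq s i n using 2
    field_simp

theorem vwpIntegral_eq_weight_mul {p : Fin 6 → ℂ} (ha : a ≠ 0) (hq0 : q ≠ 0) (hq : ‖q‖ < 1)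
    (hg : VwpGeneric q a p) :
    vwpIntegral q a p =
      vwpWeight q a p (p 0 / a) * ∑' k, vwpTerm q a p (p 0 / a) k -
      vwpWeight q a p (p 1 / a) * ∑' k, vwpTerm q a p (p 1 / a) k := by
  simp only [vwpIntegral, hg.weight_mul_pow ha hq0 hq, tsum_mul_left]

/-- **Bailey's nonterminating very-well-poised `₈φ₇` summation**, generic parameters. -/
theorem vwpIntegral_eq_vwpValue {p : Fin 6 → ℂ} (ha : a ≠ 0) (hq0 : q ≠ 0) (hq : ‖q‖ < 1)
    (hg : VwpGeneric q a p) (h : ∏ i, p i = a ^ 3 * q) :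
    vwpIntegral q a p = vwpValue q a p := by
  have hqn : 0 < ‖q‖ := norm_pos_iff.2 hq0
  set P : ℕ → Fin 6 → ℂ := fun N i => p i * q ^ (N * vwpDirection i) with hP
  have hG : ∀ N, VwpGeneric q a (P N) := fun N => hg.shift hq0 fun i => N * vwpDirection i
  have eP : ∀ N i, P N i = p i * q ^ (N * vwpDirection i : ℤ) := fun _ _ => rfl
  -- arguments of the factors
  have enum : ∀ N s i, P N i * (P N s / a) =
      p i * p s / a * q ^ (N * (vwpDirection i + vwpDirection s) : ℤ) := fun N s i => by
    rw [eP, eP, mul_add, zpow_add₀ hq0]; ring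
  have eden : ∀ N s i, a * q * (P N s / a) / P N i =
      q * p s / p i * q ^ (N * (vwpDirection s - vwpDirection i) : ℤ) := fun N s i => by
    have := zpow_ne_zero (N * vwpDirection i : ℤ) hq0
    have := hg.ne_zero i
    rw [eP, eP, mul_sub, zpow_sub₀ hq0]; field_simp
  have dnum : ∀ s i : Fin 6, s = 0 ∨ s = 1 → 0 ≤ vwpDirection i + vwpDirection s := by decide
  have dden : ∀ s i : Fin 6, s = 0 ∧ i ≠ 1 ∨ s = 1 → 0 ≤ vwpDirection s - vwpDirection i := by
    decide
  have tnum : ∀ s i : Fin 6, s = 0 ∨ s = 1 →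
      ∃ w, Tendsto (fun N => P N i * (P N s / a)) atTop (𝓝 w) ∧ ∀ n : ℕ, w * q ^ n ≠ 1 := by
    intro s i hs
    obtain ⟨w, hw, -, hw2⟩ :=
      tendsto_mul_zpow_natCast_mul (p i * p s / a) hq (dnum s i hs)
    refine ⟨w, by simpa only [enum] using hw2, fun n => ?_⟩
    rcases hw with rfl | rfl
    · simpa using hg.mul_ne i s n
    · simp
  have tden : ∀ s i : Fin 6, s = 0 ∧ i ≠ 1 ∨ s = 1 →
      ∃ w, Tendsto (fun N => a * q * (P N s / a) / P N i) atTop (𝓝 w) ∧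
        ∀ n : ℕ, w * q ^ n ≠ 1 := by
    intro s i hs
    obtain ⟨w, hw, -, hw2⟩ :=
      tendsto_mul_zpow_natCast_mul (q * p s / p i) hq (dden s i hs)
    refine ⟨w, by simpa only [eden] using hw2, fun n => ?_⟩
    rcases hw with rfl | rfl
    · exact hg.shifted_den_ne hq0 hq s i n
    · simp
  -- This is the only denominator argument that diverges. Its inverse symbols stay bounded, and for
  -- `k ≥ 1` they tend to 0, which kills every term of the first series except the initial one.
  have e01 : ∀ N, a * q * (P N 0 / a) / P N 1 = q * p 0 / p 1 / q ^ (2 * N) := fun N => by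
    rw [eden, show (N * (vwpDirection 0 - vwpDirection 1) : ℤ) = -((2 * N : ℕ) : ℤ) by
      rw [show vwpDirection 0 - vwpDirection 1 = -2 by decide]; push_cast; ring, zpow_neg,
      zpow_natCast, div_eq_mul_inv (q * p 0 / p 1)]
  have g01 : ∀ n : ℤ, q * p 0 / p 1 * q ^ n ≠ 1 := fun n h =>
    hg.div_ne 0 1 (by decide) (n + 1) (by rw [← h, zpow_add_one₀ hq0]; ring)
  have n01 : q * p 0 / p 1 ≠ 0 := div_ne_zero (mul_ne_zero hq0 (hg.ne_zero 0)) (hg.ne_zero 1)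
  have t2 : Tendsto (fun N : ℕ => 2 * N) atTop atTop :=
    tendsto_id.const_mul_atTop' two_pos
  -- boundedness
  have bnum : ∀ s i : Fin 6, s = 0 ∨ s = 1 →
      EventuallyBounded atTop fun N k => qPoch (P N i * (P N s / a)) q k := fun s i hs => by
    obtain ⟨w, hw, -⟩ := tnum s i hs
    exact eventuallyBounded_qPoch hq hw
  have bden : ∀ s i : Fin 6, s = 0 ∨ s = 1 →
      EventuallyBounded atTop fun N k => (qPoch (a * q * (P N s / a) / P N i) q k)⁻¹ := by
    intro s i hs
    by_cases hsi : s = 0 ∧ i = 1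
    · obtain ⟨rfl, rfl⟩ := hsi
      simp only [e01]
      exact (eventuallyBounded_inv_qPoch_div_pow hqn hq n01 g01).comp_tendsto t2
    · obtain ⟨w, hw, hw'⟩ := tden s i (by tauto)
      exact eventuallyBounded_inv_qPoch hq hw hw'
  have sq : ∀ (N : ℕ) (s : Fin 6), a * (P N s / a) ^ 2 = P N s * (P N s / a) := fun N s => by
    field_simp
  have tsq : ∀ s : Fin 6, s = 0 ∨ s = 1 →
      Tendsto (fun N => a * (P N s / a) ^ 2) atTop (𝓝 0) := fun s hs => by
    obtain ⟨w, -, hw, hw2⟩ :=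
      tendsto_mul_zpow_natCast_mul (p s * p s / a) hq (dnum s s hs)
    obtain rfl : w = 0 := hw (by rcases hs with rfl | rfl <;> decide)
    simpa only [sq, enum] using hw2
  have bterm : ∀ s : Fin 6, s = 0 ∨ s = 1 →
      ∃ C, ∀ᶠ N in atTop, ∀ k, ‖vwpTerm q a (P N) (P N s / a) k‖ ≤ C * ‖q‖ ^ k := fun s hs =>
    exists_norm_vwpTerm_le hq zero_ne_one (tsq s hs) (fun i => bnum s i hs) fun i => bden s i hs
  have geo := summable_geometric_of_lt_one (norm_nonneg q) hq
  -- the first series tends to `1`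
  have T0 : Tendsto (fun N => ∑' k, vwpTerm q a (P N) (P N 0 / a) k) atTop (𝓝 1) := by
    obtain ⟨C, hC⟩ := bterm 0 (Or.inl rfl)
    have : ∑' k : ℕ, (if k = 0 then (1 : ℂ) else 0) = 1 := by simp
    rw [← this]
    refine tendsto_tsum_of_dominated_convergence (geo.mul_left C) (fun k => ?_) hC
    rcases eq_or_ne k 0 with rfl | hk
    · have : Tendsto (fun N => (1 - a * (P N 0 / a) ^ 2) * (1 - a * (P N 0 / a) ^ 2)⁻¹) atTop
          (𝓝 ((1 - 0) * (1 - 0)⁻¹)) :=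
        ((tsq 0 (Or.inl rfl)).const_sub 1).mul
          (((tsq 0 (Or.inl rfl)).const_sub 1).inv₀ (by simp))
      simpa [vwpTerm, qPoch_zero] using this
    · have hlim : ∀ i : Fin 6, ∃ w, (i = 1 → w = 0) ∧
          Tendsto (fun N => qPoch (P N i * (P N 0 / a)) q k *
            (qPoch (a * q * (P N 0 / a) / P N i) q k)⁻¹) atTop (𝓝 w) := by
        intro i
        obtain ⟨w, hw, -⟩ := tnum 0 i (Or.inl rfl)
        have h1 := ((continuous_qPoch q k).tendsto w).comp hw
        by_cases hi : i = 1
        · subst hi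
          refine ⟨qPoch w q k * 0, by simp, h1.mul ?_⟩
          simp only [e01]
          exact (tendsto_inv_qPoch_div_pow hqn hq n01 g01 hk).comp t2
        · obtain ⟨w', hw', hw''⟩ := tden 0 i (Or.inl ⟨rfl, hi⟩)
          exact ⟨_, fun h => absurd h hi, h1.mul
            ((((continuous_qPoch q k).tendsto w').comp hw').inv₀ (qPoch_ne_zero hw'' k))⟩
      choose w hw0 hw using hlim
      have h1 := tendsto_finsetProd (univ : Finset (Fin 6)) fun i _ => hw i
      rw [prod_eq_zero (mem_univ 1) (hw0 1 rfl)] at h1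
      have h2 := (((tsq 0 (Or.inl rfl)).mul_const (q ^ (2 * k))).const_sub 1).mul
        (((tsq 0 (Or.inl rfl)).const_sub 1).inv₀ (by simp))
      simpa [vwpTerm, hk] using (h2.mul h1).mul_const (q ^ k)
  -- the second series is bounded
  have T1 : EventuallyBounded atTop fun N (_ : Unit) =>
      ∑' k, vwpTerm q a (P N) (P N 1 / a) k := by
    obtain ⟨C, hC⟩ := bterm 1 (Or.inr rfl)
    refine ⟨∑' k, C * ‖q‖ ^ k, hC.mono fun N hN _ => ?_⟩
    exact tsum_of_norm_bounded (geo.mul_left C).hasSum hN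
  -- and its coefficient tends to `0`
  have hW0 : ∀ N s i, wpFactor q a (P N i) (P N s / a) ≠ 0 := fun N s i => by
    refine div_ne_zero (qPochInf_ne_zero hq fun n => ?_) (qPochInf_ne_zero hq fun n => ?_)
    · convert (hG N).shifted_den_ne hq0 hq s i n using 2
      field_simp
    · simpa [mul_div_assoc] using (hG N).mul_ne i s n
  have hW : ∀ N s, vwpWeight q a (P N) (P N s / a) ≠ 0 := fun N s => by
    refine mul_ne_zero (mul_ne_zero (div_ne_zero ((hG N).ne_zero s) ha) fun h => ?_)
      (prod_ne_zero_iff.2 fun i _ => hW0 N s i)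
    rw [sub_eq_zero, sq] at h
    apply (hG N).mul_ne s s 0
    rw [zpow_zero, mul_one, mul_div_assoc, ← h]
  have nnum : ∀ N s i, qPochInf (P N i * (P N s / a)) q ≠ 0 := fun N s i =>
    qPochInf_ne_zero hq fun n => by simpa [mul_div_assoc] using (hG N).mul_ne i s n
  have nden : ∀ N s i, qPochInf (a * q * (P N s / a) / P N i) q ≠ 0 := fun N s i =>
    qPochInf_ne_zero hq fun n => by
      convert (hG N).shifted_den_ne hq0 hq s i n using 2
      field_simp
  have K : Tendsto (fun N => vwpWeight q a (P N) (P N 1 / a) / vwpWeight q a (P N) (P N 0 / a) *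
      ∑' k, vwpTerm q a (P N) (P N 1 / a) k) atTop (𝓝 0) := by
    have b1 : EventuallyBounded atTop fun N (_ : Unit) =>
        (1 - a * (P N 1 / a) ^ 2) * (1 - a * (P N 0 / a) ^ 2)⁻¹ :=
      .of_tendsto (((tsq 1 (Or.inr rfl)).const_sub 1).mul
        (((tsq 0 (Or.inl rfl)).const_sub 1).inv₀ (by simp)))
    have b2 : EventuallyBounded atTop fun N (_ : Unit) =>
        ∏ i, (qPochInf (a * q * (P N 1 / a) / P N i) q * qPochInf (P N i * (P N 0 / a)) q *
          (qPochInf (P N i * (P N 1 / a)) q)⁻¹ *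
          (qPochInf (a * q * (P N 0 / a) / P N i) q)⁻¹) := by
      refine .prod fun i _ => (((EventuallyBounded.mul ?_ ?_).mul ?_).mul ?_)
      · obtain ⟨w, hw, -⟩ := tden 1 i (Or.inr rfl)
        exact .of_tendsto (tendsto_qPochInf hq hw)
      · obtain ⟨w, hw, -⟩ := tnum 0 i (Or.inl rfl)
        exact .of_tendsto (tendsto_qPochInf hq hw)
      · obtain ⟨w, hw, hw'⟩ := tnum 1 i (Or.inr rfl)
        exact (eventuallyBounded_inv_qPoch hq hw hw').inv_qPochInf hq fun N => nnum N 1 i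
      · exact (bden 0 i (Or.inl rfl)).inv_qPochInf hq fun N => nden N 0 i
    -- The decay of the quotient of weights is taken from the factor `y` of `vwpWeight`, where the
    -- exponents differ by 3 - 1 = 2. The other factors only need to be bounded.
    have h0 : Tendsto (fun N => P N 1 / P N 0) atTop (𝓝 0) := by
      obtain ⟨w, -, hw, hw2⟩ :=
        tendsto_mul_zpow_natCast_mul (p 1 / p 0) hq (m := 2) (by norm_num)
      obtain rfl : w = 0 := hw (by norm_num)
      refine hw2.congr fun N => ?_
      rw [eP, eP, show (N * vwpDirection 1 : ℤ) = N * 2 + N * vwpDirection 0 by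
        rw [show vwpDirection 1 = 2 + vwpDirection 0 by decide]; ring, zpow_add₀ hq0]
      have := zpow_ne_zero (N * vwpDirection 0 : ℤ) hq0
      have := hg.ne_zero 0
      field_simp
    refine (((b1.mul b2).mul T1).tendsto_mul_zero () h0).congr fun N => ?_
    rw [← mul_assoc, ← mul_assoc]
    congr 1
    rw [eq_div_iff (hW N 0)]
    simp only [vwpWeight]
    have e1 : ∀ i, wpFactor q a (P N i) (P N 1 / a) =
        (qPochInf (a * q * (P N 1 / a) / P N i) q * qPochInf (P N i * (P N 0 / a)) q *
          (qPochInf (P N i * (P N 1 / a)) q)⁻¹ *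
          (qPochInf (a * q * (P N 0 / a) / P N i) q)⁻¹) * wpFactor q a (P N i) (P N 0 / a) := by
      intro i
      have h1 := nnum N 1 i
      have h2 := nden N 0 i
      have h3 := nnum N 0 i
      rw [wpFactor, wpFactor]
      generalize qPochInf (a * q * (P N 1 / a) / P N i) q = x1 at *
      generalize qPochInf (a * q * (P N 0 / a) / P N i) q = x2 at *
      generalize qPochInf (P N i * (P N 0 / a)) q = x3 at *
      generalize qPochInf (P N i * (P N 1 / a)) q = x4 at *
      field_simp
    simp only [e1]
    rw [prod_mul_distrib (f := fun i => qPochInf (a * q * (P N 1 / a) / P N i) q *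
      qPochInf (P N i * (P N 0 / a)) q * (qPochInf (P N i * (P N 1 / a)) q)⁻¹ *
      (qPochInf (a * q * (P N 0 / a) / P N i) q)⁻¹)]
    have h5 : 1 - a * (P N 0 / a) ^ 2 ≠ 0 := fun h => by
      have := hW N 0
      simp [vwpWeight, h] at this
    have h6 := (hG N).ne_zero 0
    generalize (∏ i, wpFactor q a (P N i) (P N 0 / a)) = y1
    generalize (∏ i, (qPochInf (a * q * (P N 1 / a) / P N i) q *
      qPochInf (P N i * (P N 0 / a)) q * (qPochInf (P N i * (P N 1 / a)) q)⁻¹ *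
      (qPochInf (a * q * (P N 0 / a) / P N i) q)⁻¹)) = y2
    generalize 1 - a * (P N 1 / a) ^ 2 = y3
    generalize 1 - a * (P N 0 / a) ^ 2 = y4 at *
    field_simp
  -- the normalized value tends to `1`
  have V : Tendsto (fun N => vwpValue q a (P N) / vwpWeight q a (P N) (P N 0 / a)) atTop
      (𝓝 1) := by
    have two : ∀ {f : ℕ → ℂ} {w : ℂ} (m : ℤ), 0 < m → (∀ N : ℕ, f N = w * q ^ (N * m : ℤ)) →
        Tendsto (fun N => qPochInf (f N) q) atTop (𝓝 1) := by
      intro f w m hm hf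
      obtain ⟨w', -, hw, hw2⟩ := tendsto_mul_zpow_natCast_mul w hq hm.le
      obtain rfl : w' = 0 := hw hm
      exact tendsto_qPochInf_nhds_zero hq (hw2.congr fun N => (hf N).symm)
    have zne : ∀ m : ℤ, q ^ m ≠ 0 := fun m => zpow_ne_zero m hq0
    have v1 : Tendsto (fun N => qPochInf (q * P N 0 * P N 0 / a) q) atTop (𝓝 1) :=
      two (w := q * p 0 * p 0 / a) 2 two_pos fun N => by
        rw [eP, show vwpDirection 0 = 1 by decide, mul_two, zpow_add₀ hq0, mul_one]; ring
    have v2 : Tendsto (fun N => qPochInf (P N 1 / P N 0) q) atTop (𝓝 1) :=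
      two (w := p 1 / p 0) 2 two_pos fun N => by
        have := hg.ne_zero 0
        have := zne N
        rw [eP, eP, show vwpDirection 0 = 1 by decide, show vwpDirection 1 = 1 + 2 by decide,
          mul_add (N : ℤ) 1 2, zpow_add₀ hq0, mul_one]
        field_simp
    have dlow : ∀ i : Fin 6, i = 2 ∨ i = 3 ∨ i = 4 ∨ i = 5 → vwpDirection i = -1 := by decide
    have v3 : ∀ i j : Fin 6, i = 2 ∨ i = 3 ∨ i = 4 ∨ i = 5 → j = 2 ∨ j = 3 ∨ j = 4 ∨ j = 5 →
        Tendsto (fun N => qPochInf (a * q / (P N i * P N j)) q) atTop (𝓝 1) := fun i j hi hj =>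
      two (w := a * q / (p i * p j)) 2 two_pos fun N => by
        have := hg.ne_zero i
        have := hg.ne_zero j
        have := zne N
        rw [eP, eP, dlow i hi, dlow j hj, mul_two, zpow_add₀ hq0, mul_neg_one, zpow_neg]
        field_simp
    have v4 : ∀ i : Fin 6, i = 2 ∨ i = 3 ∨ i = 4 ∨ i = 5 →
        Tendsto (fun N => qPochInf (q * P N 0 / P N i) q) atTop (𝓝 1) := fun i hi =>
      two (w := q * p 0 / p i) 2 two_pos fun N => by
        have := hg.ne_zero i
        have := zne N
        rw [eP, eP, dlow i hi, show vwpDirection 0 = 1 by decide, mul_two, zpow_add₀ hq0,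
          mul_neg_one, zpow_neg, mul_one]
        field_simp
    have v5 : ∀ i : Fin 6, i = 2 ∨ i = 3 ∨ i = 4 ∨ i = 5 →
        Tendsto (fun N => qPochInf (P N 1 * P N i / a) q) atTop (𝓝 1) := fun i hi =>
      two (w := p 1 * p i / a) 2 two_pos fun N => by
        have := zne N
        rw [eP, eP, dlow i hi, show vwpDirection 1 = 2 + 1 by decide,
          mul_add (N : ℤ) 2 1, zpow_add₀ hq0, mul_neg_one, zpow_neg, mul_one]
        field_simp
    have key := ((v1.mul v2).mul ((((((v3 2 3 (by simp) (by simp)).mul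
      (v3 2 4 (by simp) (by simp))).mul (v3 2 5 (by simp) (by simp))).mul
      (v3 3 4 (by simp) (by simp))).mul (v3 3 5 (by simp) (by simp))).mul
      (v3 4 5 (by simp) (by simp)))).div
      (((((v4 2 (by simp)).mul (v4 3 (by simp))).mul (v4 4 (by simp))).mul (v4 5 (by simp))).mul
      ((((v5 2 (by simp)).mul (v5 3 (by simp))).mul (v5 4 (by simp))).mul (v5 5 (by simp))))
      (by simp)
    simp only [mul_one, div_one] at key
    refine key.congr fun N => ?_
    rw [Pi.div_apply, eq_div_iff (hW N 0), vwpValue_eq_weight_mul ha hq0 hq (hG N), mul_comm]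
  have hR : Tendsto (fun N => vwpRatio q a (P N)) atTop (𝓝 ((1 - 0) / 1)) := by
    refine ((T0.sub K).div V one_ne_zero).congr fun N => ?_
    rw [vwpRatio, vwpIntegral_eq_weight_mul ha hq0 hq (hG N)]
    have h1 := hW N 0
    have h2 := vwpValue_ne_zero ha hq0 hq (hG N)
    rw [Pi.div_apply]
    field_simp
  have hR' : vwpRatio q a p = 1 := by
    have := tendsto_nhds_unique hR
      ((tendsto_const_nhds (x := vwpRatio q a p)).congr fun N =>
        vwpRatio_shift_direction_pow ha hq0 hq hg h N)
    simpa using this.symm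
  exact (div_eq_one_iff_eq (vwpValue_ne_zero ha hq0 hq hg)).1 hR'

end Bailey

/-! ### The determinant of a change of polynomial basis. -/

section Determinant

open Polynomial

variable {R : Type*} [CommRing R]

/-- `∏_{m<i} (X - γ_m) ∏_{m<j} (X - δ_m)`. -/
noncomputable def twoNodePoly (γ δ : ℕ → R) (i j : ℕ) : R[X] :=
  (∏ m ∈ range i, (X - C (γ m))) * ∏ m ∈ range j, (X - C (δ m))

theorem twoNodePoly_monic (γ δ : ℕ → R) (i j : ℕ) : (twoNodePoly γ δ i j).Monic :=
  (monic_prod_of_monic _ _ fun _ _ => monic_X_sub_C _).mul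
    (monic_prod_of_monic _ _ fun _ _ => monic_X_sub_C _)

theorem twoNodePoly_natDegree [Nontrivial R] (γ δ : ℕ → R) (i j : ℕ) :
    (twoNodePoly γ δ i j).natDegree = i + j := by
  have h : ∀ (ε : ℕ → R) n, (∏ m ∈ range n, (X - C (ε m))).natDegree = n := fun ε n => by
    rw [natDegree_prod_of_monic _ _ fun _ _ => monic_X_sub_C _]
    simp
  rw [twoNodePoly, (monic_prod_of_monic _ _ fun _ _ => monic_X_sub_C _).natDegree_mul
    (monic_prod_of_monic _ _ fun _ _ => monic_X_sub_C _), h, h]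

theorem twoNodePoly_succ (γ δ : ℕ → R) (i j : ℕ) :
    twoNodePoly γ δ i (j + 1) =
      C (γ i - δ j) * twoNodePoly γ δ i j + twoNodePoly γ δ (i + 1) j := by
  simp only [twoNodePoly, prod_range_succ, C_sub]
  ring

/-- The coefficient matrix of the polynomials `twoNodePoly γ δ (r - 1 - j) j`. -/
noncomputable def twoNodeMatrix (γ δ : ℕ → R) (r : ℕ) : Matrix (Fin r) (Fin r) R :=
  .of fun i j => (twoNodePoly γ δ j.rev j).coeff i

/-- Adjacent columns satisfy `twoNodePoly_succ`, so subtracting the preceding column lowers the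
degree and leaves a multiple `γ - δ` of a column of the next smaller matrix. The last row then has a
single nonzero entry, the leading coefficient 1 in column 0. Expansion along it gives the induction
step and the sign. -/
theorem det_twoNodeMatrix [Nontrivial R] (γ δ : ℕ → R) (r : ℕ) :
    (twoNodeMatrix γ δ r).det =
      (∏ s ∈ range r, (-1) ^ s) * ∏ s ∈ range r, ∏ j ∈ range s, (γ (s - 1 - j) - δ j) := by
  induction r with
  | zero => simp
  | succ r ih =>
    let B : Matrix (Fin (r + 1)) (Fin (r + 1)) R := .of fun i => Fin.cons
      ((twoNodePoly γ δ r 0).coeff i)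
      fun j : Fin r => (γ j.rev - δ j) * (twoNodePoly γ δ j.rev j).coeff i
    have hB : (twoNodeMatrix γ δ (r + 1)).det = B.det := by
      refine Matrix.det_eq_of_forall_col_eq_smul_add_pred (fun _ => 1) (fun i => ?_) fun i j => ?_
      · simp [twoNodeMatrix, B]
      · simp only [twoNodeMatrix, B, Matrix.of_apply, Fin.cons_succ, Fin.rev_succ,
          Fin.val_castSucc, Fin.val_succ, one_mul, Fin.rev_castSucc]
        rw [twoNodePoly_succ, coeff_add, coeff_C_mul]
    rw [hB, Matrix.det_succ_row _ (Fin.last r), Fin.sum_univ_succ, sum_eq_zero, add_zero]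
    · have e1 : B (Fin.last r) 0 = 1 := by
        have := twoNodePoly_monic γ δ r 0
        rw [Monic, leadingCoeff, twoNodePoly_natDegree, add_zero] at this
        simpa [B] using this
      have e2 : B.submatrix (Fin.last r).succAbove (Fin.succAbove 0) =
          .of fun i j => (γ j.rev - δ j) * twoNodeMatrix γ δ r i j := by
        ext i j
        simp [B, twoNodeMatrix]
      rw [e1, e2, Matrix.det_mul_row, ih, prod_range_succ, prod_range_succ _ r]
      have e3 : ∏ j : Fin r, (γ j.rev - δ j) = ∏ j ∈ range r, (γ (r - 1 - j) - δ j) := by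
        rw [prod_range]
        refine prod_congr rfl fun j _ => ?_
        rw [Fin.val_rev, Nat.sub_sub, add_comm 1]
      rw [e3]
      simp only [Fin.val_last, Fin.val_zero, add_zero]
      ring
    · intro j _
      have : (twoNodePoly γ δ j.rev j).coeff r = 0 := by
        apply coeff_eq_zero_of_natDegree_lt
        rw [twoNodePoly_natDegree, Fin.val_rev]
        omega
      have e : B (Fin.last r) j.succ = 0 := by
        simp only [B, Matrix.of_apply, Fin.cons_succ, Fin.val_last]
        rw [this, mul_zero]
      rw [e]; simp

end Determinant

/-! ### Well-poised products as a basis of the type-C Vandermonde space. -/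

section Moments

open Polynomial

/-- The factor by which a well-poised factor changes when its parameter is multiplied by `q`. -/
noncomputable def wpPair (a P y : ℂ) : ℂ := (1 - a * y / P) * (1 - P * y)

/-- `∏_{m<i} (1-ay/(cq^m))(1-cq^m y) ∏_{m<j} (1-ay/(dq^m))(1-dq^m y)`. -/
noncomputable def wpShift (q a c d : ℂ) (i j : ℕ) (y : ℂ) : ℂ :=
  (∏ m ∈ range i, wpPair a (c * q ^ m) y) * ∏ m ∈ range j, wpPair a (d * q ^ m) y

/-- The functions `(1+ay²)^j y^{r-1-j}`. -/
noncomputable def projMonomial (a : ℂ) {r : ℕ} (j : Fin r) (y : ℂ) : ℂ :=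
  (1 + a * y ^ 2) ^ (j : ℕ) * y ^ (j.rev : ℕ)

/-- The nodes `cq^m + a/(cq^m)`. -/
noncomputable def wpNode (q a c : ℂ) (m : ℕ) : ℂ := c * q ^ m + a / (c * q ^ m)

variable {q a : ℂ}

/-- With `t = (1 + a y^2) / y` one has `wpPair a P y = y (t - (P + a / P))`. Hence `wpShift` is
`y^(r-1)` times a monic polynomial of degree `r - 1` in `t` with the roots `wpNode`, while
`projMonomial a k y` is `y^(r-1) t^k`. -/
theorem wpShift_eq_sum {c d y : ℂ} (hc : c ≠ 0) (hd : d ≠ 0) (hq0 : q ≠ 0) (hy : y ≠ 0) {r : ℕ}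
    (j : Fin r) :
    wpShift q a c d j.rev j y = ∑ k : Fin r, projMonomial a k y *
      twoNodeMatrix (wpNode q a c) (wpNode q a d) r k j := by
  have hr : (j.rev : ℕ) + j = r - 1 := by rw [Fin.val_rev]; omega
  set t := (1 + a * y ^ 2) / y with ht
  have h1 : ∀ P : ℂ, P ≠ 0 → wpPair a P y = y * (t - (P + a / P)) := fun P hP => by
    rw [wpPair, ht]; field_simp; ring
  have h2 : wpShift q a c d j.rev j y =
      y ^ (r - 1) * (twoNodePoly (wpNode q a c) (wpNode q a d) j.rev j).eval t := by
    have hcm : ∀ m, c * q ^ m ≠ 0 := fun m => mul_ne_zero hc (pow_ne_zero m hq0)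
    have hdm : ∀ m, d * q ^ m ≠ 0 := fun m => mul_ne_zero hd (pow_ne_zero m hq0)
    simp only [wpShift, twoNodePoly, eval_mul, eval_prod, eval_sub, eval_X, eval_C, wpNode,
      h1 _ (hcm _), h1 _ (hdm _), prod_mul_distrib, prod_const, card_range]
    rw [← hr, pow_add]
    ring
  rw [h2, eval_eq_sum_range' (n := r) (by rw [twoNodePoly_natDegree, hr]; have := j.2; omega),
    mul_sum, ← Fin.sum_univ_eq_sum_range (fun k => y ^ (r - 1) *
      ((twoNodePoly (wpNode q a c) (wpNode q a d) j.rev j).coeff k * t ^ k))]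
  refine sum_congr rfl fun k _ => ?_
  have hk : r - 1 = (k.rev : ℕ) + k := by rw [Fin.val_rev]; omega
  rw [projMonomial, twoNodeMatrix, Matrix.of_apply, ht, div_pow, hk, pow_add]
  field_simp

theorem det_projMonomial (a : ℂ) {r : ℕ} (y : Fin r → ℂ) :
    (Matrix.of fun i j => projMonomial a j (y i)).det =
      ∏ i : Fin r, ∏ j : Fin r with i < j, ((y i - y j) * (1 - a * y i * y j)) := by
  have := Matrix.det_projVandermonde (fun i => 1 + a * y i ^ 2) y
  refine Eq.trans ?_ (this.trans ?_)
  · rfl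
  · refine prod_congr rfl fun i _ => prod_congr (by ext; simp) fun j _ => ?_
    ring

theorem det_wpShift {c d : ℂ} (hc : c ≠ 0) (hd : d ≠ 0) (hq0 : q ≠ 0) {r : ℕ} {y : Fin r → ℂ}
    (hy : ∀ i, y i ≠ 0) :
    (Matrix.of fun i j : Fin r => wpShift q a c d j.rev j (y i)).det =
      (∏ i : Fin r, ∏ j : Fin r with i < j, ((y i - y j) * (1 - a * y i * y j))) *
        (twoNodeMatrix (wpNode q a c) (wpNode q a d) r).det := by
  rw [← det_projMonomial, ← Matrix.det_mul]
  congr 1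
  ext i j
  rw [Matrix.of_apply, wpShift_eq_sum hc hd hq0 (hy i), Matrix.mul_apply]
  rfl

theorem wpNode_sub {c d : ℂ} (hc : c ≠ 0) (hd : d ≠ 0) (hq0 : q ≠ 0) (m n : ℕ) :
    wpNode q a c m - wpNode q a d n =
      (c * q ^ m - d * q ^ n) * (1 - a / (c * d) / q ^ (m + n)) := by
  rw [wpNode, wpNode, pow_add]
  field_simp
  ring

/-- In `wpNode_sub` one factor is free of `a` and the other depends only on the sum of the two
indices, so the latter repeats `s` times at level `s`. The factor free of `a` cancels later against
the same determinant with `a / f` in place of `a`. -/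
theorem det_twoNodeMatrix_wpNode {c d : ℂ} (hc : c ≠ 0) (hd : d ≠ 0) (hq0 : q ≠ 0) (r : ℕ) :
    (twoNodeMatrix (wpNode q a c) (wpNode q a d) r).det =
      ((∏ s ∈ range r, (-1) ^ s) *
        ∏ s ∈ range r, ∏ j ∈ range s, (c * q ^ (s - 1 - j) - d * q ^ j)) *
      ∏ s ∈ range r, (1 - a * q / (c * d) / q ^ s) ^ s := by
  rw [det_twoNodeMatrix, mul_assoc]
  congr 1
  rw [← prod_mul_distrib]
  refine prod_congr rfl fun s _ => ?_
  have : (1 - a * q / (c * d) / q ^ s) ^ s =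
      ∏ j ∈ range s, (1 - a * q / (c * d) / q ^ s) := by simp
  rw [this, ← prod_mul_distrib]
  refine prod_congr rfl fun j hj => ?_
  rw [wpNode_sub hc hd hq0]
  congr 2
  have : s = (s - 1 - j + j) + 1 := by have := mem_range.1 hj; omega
  conv_rhs => rw [this, pow_succ]
  field_simp

theorem wpFactor_mul_pow {P y : ℂ} (hq0 : q ≠ 0) (hq : ‖q‖ < 1) (h : ∀ m : ℕ, P * q ^ m * y ≠ 1)
    (i : ℕ) :
    wpFactor q a (P * q ^ i) y = (∏ m ∈ range i, wpPair a (P * q ^ m) y) * wpFactor q a P y := by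
  induction i with
  | zero => simp
  | succ i ih =>
    rw [pow_succ, ← mul_assoc, wpFactor_mul_right hq0 hq (h i), ih, prod_range_succ, wpPair]
    ring

/-- Passing from `(u q^(1-r);q)_∞` to `(u q^(-i);q)_∞` splits off the factors `1 - u q^(-s)` with `i
< s < r`, so over all `i` the index `s` occurs `s` times. These are the powers in
`det_twoNodeMatrix_wpNode`. -/
theorem qPochInf_pow_eq (u : ℂ) (hq0 : q ≠ 0) (hq : ‖q‖ < 1) (r : ℕ) :
    qPochInf (u * q / q ^ r) q ^ r =
      (∏ i ∈ range r, qPochInf (u / q ^ i) q) * ∏ s ∈ range r, (1 - u / q ^ s) ^ s := by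
  induction r with
  | zero => simp
  | succ r ih =>
    have e1 : u * q / q ^ (r + 1) = u / q ^ r := by rw [pow_succ]; field_simp
    have e2 : u / q ^ r * q = u * q / q ^ r := by ring
    rw [prod_range_succ, prod_range_succ, e1, pow_succ, mul_mul_mul_comm, ← ih]
    nth_rewrite 1 [qPochInf_eq_one_sub_mul (u / q ^ r) hq]
    rw [e2, mul_pow]
    ring

end Moments

/-! ### One-dimensional moments of shifted weights, for generic parameters. -/

section Generic

variable {q a b c d e f x : ℂ}

/-- The six symmetric parameters of the very-well-poised series attached to `x`. -/
noncomputable def crPar (a b c d e f x : ℂ) : Fin 6 → ℂ := ![a * x, b, c, d, e, f / x]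

/-- The coefficient of the second one-dimensional series. -/
noncomputable def crKap (q a b c d e f x : ℂ) : ℂ :=
  qPochInfs [a * x ^ 2 * q, c * x, d * x, e * x, f] q
      / qPochInfs [a * x / b, a * x * q / c, a * x * q / d, a * x * q / e, a * x ^ 2 * q / f] q
  * (qPochInfs [b / (a * x), b * q / c, b * q / d, b * q / e, b * x * q / f] q
      / qPochInfs [b ^ 2 * q / a, b * c / a, b * d / a, b * e / a, b * f / (a * x)] q)

/-- The one-dimensional two-term sum of `h`. -/
noncomputable def crMoment (q a b c d e f x : ℂ) (h : ℂ → ℂ) : ℂ :=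
  ∑' k : ℕ, vwpTerm q a (crPar a b c d e f x) x k * h (x * q ^ k) +
    crKap q a b c d e f x *
      ∑' k : ℕ, vwpTerm q a (crPar a b c d e f x) (b / a) k * h (b / a * q ^ k)

/-- The part of the product side depending on `x`. -/
noncomputable def crRow (q a b c d e f x : ℂ) : ℂ :=
  qPochInf (a * x ^ 2 * q) q * qPochInf (b / (a * x)) q * qPochInf (a * x * q / (c * f)) q *
    qPochInf (a * x * q / (d * f)) q * qPochInf (a * x * q / (e * f)) q /
  (qPochInf (a * x * q / c) q * qPochInf (a * x * q / d) q * qPochInf (a * x * q / e) q *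
    qPochInf (a * x ^ 2 * q / f) q * qPochInf (b * f / (a * x)) q)

theorem VwpGeneric.weight_ne_zero {p : Fin 6 → ℂ} (hg : VwpGeneric q a p) (ha : a ≠ 0)
    (hq0 : q ≠ 0) (hq : ‖q‖ < 1) (s : Fin 6) : vwpWeight q a p (p s / a) ≠ 0 := by
  refine mul_ne_zero (mul_ne_zero (div_ne_zero (hg.ne_zero s) ha) fun h => ?_)
    (prod_ne_zero_iff.2 fun i _ => div_ne_zero (qPochInf_ne_zero hq fun n => ?_)
      (qPochInf_ne_zero hq fun n => ?_))
  · rw [sub_eq_zero] at h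
    apply hg.mul_ne s s 0
    rw [zpow_zero, mul_one, h]; field_simp
  · convert hg.shifted_den_ne hq0 hq s i n using 2
    field_simp
  · simpa [mul_div_assoc] using hg.mul_ne i s n

/-- The coefficient is minus the quotient of the initial weights of the two progressions. Multiplied
by the weight at `x`, a `crMoment` is therefore a difference of two unnormalized series, as in
`vwpIntegral`. -/
theorem crKap_mul_weight (ha : a ≠ 0) (hq0 : q ≠ 0) (hq : ‖q‖ < 1) (hx : x ≠ 0) (hf : f ≠ 0)
    (hg : VwpGeneric q a (crPar a b c d e f x)) :
    crKap q a b c d e f x * vwpWeight q a (crPar a b c d e f x) x =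
      -vwpWeight q a (crPar a b c d e f x) (b / a) := by
  have hb : b ≠ 0 := hg.ne_zero 1
  have hc : c ≠ 0 := hg.ne_zero 2
  have hd : d ≠ 0 := hg.ne_zero 3
  have he : e ≠ 0 := hg.ne_zero 4
  have u : ∀ s i, qPochInf (crPar a b c d e f x i * (crPar a b c d e f x s / a)) q ≠ 0 :=
    fun s i => qPochInf_ne_zero hq fun n => by simpa [mul_div_assoc] using hg.mul_ne i s n
  have v : ∀ s i, qPochInf (a * q * (crPar a b c d e f x s / a) / crPar a b c d e f x i) q ≠ 0 :=
    fun s i => qPochInf_ne_zero hq fun n => by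
      convert hg.shifted_den_ne hq0 hq s i n using 2
      field_simp
  have w : ∀ s, 1 - a * (crPar a b c d e f x s / a) ^ 2 ≠ 0 := fun s h => by
    apply hg.mul_ne s s 0
    rw [sub_eq_zero] at h
    rw [zpow_zero, mul_one, h]; field_simp
  have hp0 : crPar a b c d e f x 0 / a = x := by simp [crPar]; field_simp
  have hp1 : crPar a b c d e f x 1 / a = b / a := rfl
  have u0 := u 0
  have u1 := u 1
  have v0 := v 0
  have v1 := v 1
  have w0 := w 0
  have w1 := w 1
  rw [hp0] at u0 v0 w0
  rw [hp1] at u1 v1 w1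
  clear u v w
  have r1 : qPochInf (a * x * x) q = (1 - a * x ^ 2) * qPochInf (a * x ^ 2 * q) q := by
    rw [qPochInf_eq_one_sub_mul _ hq]; congr 2 <;> ring
  have r2 : qPochInf (b * (b / a)) q = (1 - a * (b / a) ^ 2) * qPochInf (b ^ 2 * q / a) q := by
    rw [qPochInf_eq_one_sub_mul _ hq]; congr 2 <;> field_simp
  have r3 : qPochInf (b / (a * x)) q = (1 - b / (a * x)) * qPochInf (a * q * (b / a) / (a * x)) q := by
    rw [qPochInf_eq_one_sub_mul _ hq]; congr 2; field_simp
  have r4 : qPochInf (a * x / b) q = (1 - a * x / b) * qPochInf (a * q * x / b) q := by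
    rw [qPochInf_eq_one_sub_mul _ hq]; congr 2; ring
  have s1 : ∀ P, a * x * q / P = a * q * x / P := fun P => by ring
  have s2 : ∀ P, b * q / P = a * q * (b / a) / P := fun P => by field_simp
  have s3 : ∀ P, b * P / a = P * (b / a) := fun P => by ring
  have s4 : a * x ^ 2 * q / f = a * q * x / (f / x) := by field_simp
  have s5 : b * x * q / f = a * q * (b / a) / (f / x) := by field_simp
  have s6 : b * f / (a * x) = f / x * (b / a) := by field_simp
  have s7 : f / x * x = f := by field_simp
  have s8 : a * q * x / (a * x) = q := by field_simp
  have s9 : a * q * (b / a) / b = q := by field_simp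
  have s10 : a * x * (b / a) = b * x := by field_simp
  have n1 : 1 - a * x / b ≠ 0 := fun h => by
    apply hg.div_ne 0 1 (by decide) 0
    rw [sub_eq_zero] at h
    simpa [crPar] using h.symm
  have n2 : 1 - b / (a * x) = -(b / (a * x)) * (1 - a * x / b) := by field_simp; ring
  simp only [crKap, vwpWeight, wpFactor, Fin.prod_univ_six, qPochInfs, List.map_cons, List.map_nil,
    List.prod_cons, List.prod_nil, mul_one]
  have z00 := u0 0; have z01 := u0 1; have z02 := u0 2
  have z03 := u0 3; have z04 := u0 4; have z05 := u0 5
  have z10 := u1 0; have z11 := u1 1; have z12 := u1 2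
  have z13 := u1 3; have z14 := u1 4; have z15 := u1 5
  have y00 := v0 0; have y01 := v0 1; have y02 := v0 2
  have y03 := v0 3; have y04 := v0 4; have y05 := v0 5
  simp only [crPar, Matrix.cons_val] at *
  rw [r1] at z00
  rw [r2] at z11
  rw [r1, r2, r3, r4]
  simp only [s1, s2, s3, s4, s5, s6, s7, s8, s9, s10] at *
  have z00' := right_ne_zero_of_mul z00
  have z11' := right_ne_zero_of_mul z11
  rw [n2]
  generalize qPochInf (a * x ^ 2 * q) q = x1 at *
  generalize qPochInf (b ^ 2 * q / a) q = x2 at *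
  generalize qPochInf (a * q * x / b) q = x3 at *
  generalize qPochInf (a * q * x / c) q = x4 at *
  generalize qPochInf (a * q * x / d) q = x5 at *
  generalize qPochInf (a * q * x / e) q = x6 at *
  generalize qPochInf (a * q * x / (f / x)) q = x7 at *
  generalize qPochInf (c * (b / a)) q = x8 at *
  generalize qPochInf (d * (b / a)) q = x9 at *
  generalize qPochInf (e * (b / a)) q = x10 at *
  generalize qPochInf (f / x * (b / a)) q = x11 at *
  generalize qPochInf (b * x) q = x12 at *
  generalize qPochInf (c * x) q = x13 at *
  generalize qPochInf (d * x) q = x14 at *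
  generalize qPochInf (e * x) q = x15 at *
  generalize qPochInf f q = x16 at *
  generalize 1 - a * x / b = t1 at *
  generalize 1 - a * x ^ 2 = t2 at *
  generalize 1 - a * (b / a) ^ 2 = t3 at *
  field_simp

theorem qPochInf_div_pow_mul (w u : ℂ) (hq0 : q ≠ 0) (hq : ‖q‖ < 1) (i : ℕ) :
    qPochInf (w * q / q ^ i) q * qPochInf u q =
      (∏ m ∈ range i, ((1 - w / q ^ m) * (1 - u * q ^ m))) * qPochInf (w * q) q *
        qPochInf (u * q ^ i) q := by
  induction i with
  | zero => simp
  | succ i ih =>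
    have e1 : w * q / q ^ (i + 1) = w / q ^ i := by rw [pow_succ]; field_simp
    have e2 : w / q ^ i * q = w * q / q ^ i := by ring
    have e3 : u * q ^ i * q = u * q ^ (i + 1) := by ring
    rw [e1, qPochInf_eq_one_sub_mul (w / q ^ i) hq, e2, mul_assoc, ih, prod_range_succ,
      qPochInf_eq_one_sub_mul (u * q ^ i) hq, e3]
    ring

/-- Cancellation with every infinite product replaced by a letter. Only the letters that actually
cancel have to be nonzero. -/
theorem vwp_cancellation (x Q Xb Bx cd ce de mc md Cf Df Ef C C' D D' E F bx bc bd be bf X Y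
    Xc Xd Xe Xf : ℂ) (hQ : X ≠ 0) (hY : Y ≠ 0)
    (hXc : Xc ≠ 0) (hXd : Xd ≠ 0) (hXe : Xe ≠ 0) (hXf : Xf ≠ 0) (hC : C' ≠ 0) (hD : D' ≠ 0) :
    x * (Q * Xb * Bx) * (cd * ce * (mc * Cf * C' / C) * de * (md * Df * D' / D) * Ef) /
      (bx * (C' * D' * E * F) * (bc * bd * be * bf)) =
    x * Y * (Q / (Y * X) * (Xb / bx) * (Xc / C) * (Xd / D) * (Xe / E) * (Xf / F)) *
      (X * Bx * Cf * Df * Ef / (Xc * Xd * Xe * Xf * bf) * (mc * md) *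
        (cd * ce * de / (bc * bd * be))) := by
  have e1 : x * (Q * Xb * Bx) * (cd * ce * (mc * Cf * C' / C) * de * (md * Df * D' / D) * Ef) /
      (bx * (C' * D' * E * F) * (bc * bd * be * bf)) = (C' / C') * (D' / D') *
      (x * Q * Xb * Bx * cd * ce * mc * Cf * C⁻¹ * de * md * Df * D⁻¹ * Ef * bx⁻¹ * E⁻¹ * F⁻¹ *
        bc⁻¹ * bd⁻¹ * be⁻¹ * bf⁻¹) := by
    simp only [div_eq_mul_inv, mul_inv]; ring
  have e2 : x * Y * (Q / (Y * X) * (Xb / bx) * (Xc / C) * (Xd / D) * (Xe / E) * (Xf / F)) *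
      (X * Bx * Cf * Df * Ef / (Xc * Xd * Xe * Xf * bf) * (mc * md) *
        (cd * ce * de / (bc * bd * be))) = (Y / Y) * (X / X) * (Xc / Xc) * (Xd / Xd) * (Xe / Xe) *
      (Xf / Xf) *
      (x * Q * Xb * Bx * cd * ce * mc * Cf * C⁻¹ * de * md * Df * D⁻¹ * Ef * bx⁻¹ * E⁻¹ * F⁻¹ *
        bc⁻¹ * bd⁻¹ * be⁻¹ * bf⁻¹) := by
    simp only [div_eq_mul_inv, mul_inv]; ring
  rw [e1, e2, div_self hQ, div_self hY, div_self hXc, div_self hXd, div_self hXe, div_self hXf,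
    div_self hC, div_self hD]
  ring

/-- This is the source of `a / f`. The factors pairing `c q^i` with `f / x` and with `a x` change by
`∏ (1 - a x / (f c q^m)) (1 - c q^m x)`, which is a product of `wpPair (a / f)`; the same happens
for `d`. The remaining dependence on `i, j` is free of `x`. -/
theorem vwpValue_shift_eq (ha : a ≠ 0) (hq0 : q ≠ 0) (hq : ‖q‖ < 1) (hx : x ≠ 0) (hf : f ≠ 0)
    (hg : VwpGeneric q a (crPar a b c d e f x)) (i j : ℕ) :
    vwpValue q a (crPar a b (c * q ^ i) (d * q ^ j) e f x) =
      vwpWeight q a (crPar a b c d e f x) x *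
        (crRow q a b c d e f x * wpShift q (a / f) c d i j x *
          (qPochInf (a * q / (c * d) / q ^ (i + j)) q * qPochInf (a * q / (c * e) / q ^ i) q *
            qPochInf (a * q / (d * e) / q ^ j) q /
            (qPochInf (b * c / a * q ^ i) q * qPochInf (b * d / a * q ^ j) q *
              qPochInf (b * e / a) q))) := by
  have hb : b ≠ 0 := hg.ne_zero 1
  have hc : c ≠ 0 := hg.ne_zero 2
  have hd : d ≠ 0 := hg.ne_zero 3
  have he : e ≠ 0 := hg.ne_zero 4
  have u : ∀ i, qPochInf (crPar a b c d e f x i * (crPar a b c d e f x 0 / a)) q ≠ 0 :=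
    fun i => qPochInf_ne_zero hq fun n => by simpa [mul_div_assoc] using hg.mul_ne i 0 n
  have v : ∀ i, qPochInf (a * q * (crPar a b c d e f x 0 / a) / crPar a b c d e f x i) q ≠ 0 :=
    fun i => qPochInf_ne_zero hq fun n => by
      convert hg.shifted_den_ne hq0 hq 0 i n using 2
      field_simp
  have hp0 : crPar a b c d e f x 0 / a = x := by simp [crPar]; field_simp
  rw [hp0] at u v
  have hm : ∀ P, P ≠ 0 → ∀ i, qPochInf (a * x / (P * f) * q / q ^ i) q * qPochInf (P * x) q =
      (∏ m ∈ range i, wpPair (a / f) (P * q ^ m) x) * qPochInf (a * x / (P * f) * q) q *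
        qPochInf (P * x * q ^ i) q := fun P hP i => by
    rw [qPochInf_div_pow_mul _ _ hq0 hq]
    congr 2
    refine prod_congr rfl fun m _ => ?_
    rw [wpPair]
    congr 2
    · field_simp
    · ring
  have m1 := hm c hc i
  have m2 := hm d hd j
  have r1 : qPochInf (a * x * x) q = (1 - a * x ^ 2) * qPochInf (a * x ^ 2 * q) q := by
    rw [qPochInf_eq_one_sub_mul _ hq]; congr 2 <;> ring
  have ne1 : qPochInf (a * x / (c * f) * q) q = qPochInf (a * x * q / (c * f)) q := by
    congr 1; ring
  have ne2 : qPochInf (a * x / (d * f) * q) q = qPochInf (a * x * q / (d * f)) q := by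
    congr 1; ring
  rw [ne1] at m1
  rw [ne2] at m2
  have z0 := u 0; have z1 := u 1; have z2 := u 2
  have z3 := u 3; have z4 := u 4; have z5 := u 5
  have y0 := v 0; have y1 := v 1; have y2 := v 2
  have y3 := v 3; have y4 := v 4; have y5 := v 5
  have c1 : qPochInf (c * x * q ^ i) q ≠ 0 := fun h => z2 (by
    simp only [crPar, Matrix.cons_val]; rw [qPochInf_eq_mul _ hq i, h, mul_zero])
  have c2 : qPochInf (d * x * q ^ j) q ≠ 0 := fun h => z3 (by
    simp only [crPar, Matrix.cons_val]; rw [qPochInf_eq_mul _ hq j, h, mul_zero])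
  simp only [crPar, Matrix.cons_val] at z0 z1 z2 z3 z4 z5 y0 y1 y2 y3 y4 y5
  rw [r1] at z0
  have z0' := right_ne_zero_of_mul z0
  have z0'' := left_ne_zero_of_mul z0
  simp only [vwpValue, vwpWeight, wpFactor, Fin.prod_univ_six, crPar, Matrix.cons_val, crRow,
    wpShift]
  rw [r1]
  have t1 : a * x / a = x := by field_simp
  have t2 : q * (a * x) / b = a * q * x / b := by ring
  have t3 : a * q / (c * q ^ i * (d * q ^ j)) = a * q / (c * d) / q ^ (i + j) := by
    rw [pow_add]; field_simp
  have t4 : a * q / (c * q ^ i * e) = a * q / (c * e) / q ^ i := by field_simp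
  have t5 : a * q / (c * q ^ i * (f / x)) = a * x / (c * f) * q / q ^ i := by field_simp
  have t6 : a * q / (d * q ^ j * e) = a * q / (d * e) / q ^ j := by field_simp
  have t7 : a * q / (d * q ^ j * (f / x)) = a * x / (d * f) * q / q ^ j := by field_simp
  have t8 : a * q / (e * (f / x)) = a * x * q / (e * f) := by field_simp
  have t9 : a * x * b / a = b * x := by field_simp
  have t10 : a * x * (c * q ^ i) / a = c * x * q ^ i := by field_simp
  have t11 : a * x * (d * q ^ j) / a = d * x * q ^ j := by field_simp
  have t12 : a * x * e / a = e * x := by field_simp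
  have t13 : a * x * (f / x) / a = f / x * x := by field_simp
  have t14 : b * (c * q ^ i) / a = b * c / a * q ^ i := by ring
  have t15 : b * (d * q ^ j) / a = b * d / a * q ^ j := by ring
  have t16 : b * (f / x) / a = b * f / (a * x) := by field_simp
  have t17 : a * q * x / (a * x) = q := by field_simp
  have t18 : ∀ P, a * x * q / P = a * q * x / P := fun P => by ring
  have t19 : a * x ^ 2 * q / f = a * q * x / (f / x) := by field_simp
  rw [t18 c, t18 d, t18 e]
  rw [t17] at y0 ⊢
  rw [t1, t2, t3, t4, t5, t6, t7, t8, t9, t10, t11, t12, t13, t14, t15, t16, t19]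
  rw [← eq_div_iff z2] at m1
  rw [← eq_div_iff z3] at m2
  rw [m1, m2]
  exact vwp_cancellation _ _ _ _ _ _ _ _ _ _ _ _ _ _ _ _ _ _ _ _ _ _ _ _ _ _ _ _ _
    z0' z0'' y2 y3 y4 y5 c1 c2

/-- By `wpFactor_mul_pow`, inserting `wpShift` into the weight raises `c` to `c q^i` and `d` to `d
q^j`. The hypothesis on `i + j` is Bailey's balancing condition for the raised parameters. -/
theorem crMoment_wpShift (ha : a ≠ 0) (hq0 : q ≠ 0) (hq : ‖q‖ < 1) (hx : x ≠ 0) (hf : f ≠ 0)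
    (hg : VwpGeneric q a (crPar a b c d e f x)) (i j : ℕ)
    (hbal : a ^ 2 * q = b * c * d * e * f * q ^ (i + j)) :
    crMoment q a b c d e f x (wpShift q a c d i j) =
      crRow q a b c d e f x * wpShift q (a / f) c d i j x *
        (qPochInf (a * q / (c * d) / q ^ (i + j)) q * qPochInf (a * q / (c * e) / q ^ i) q *
          qPochInf (a * q / (d * e) / q ^ j) q /
          (qPochInf (b * c / a * q ^ i) q * qPochInf (b * d / a * q ^ j) q *
            qPochInf (b * e / a) q)) := by
  have hp0 : crPar a b c d e f x 0 / a = x := by simp [crPar]; field_simp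
  have hp1 : crPar a b c d e f x 1 / a = b / a := rfl
  have hW := hg.weight_ne_zero ha hq0 hq 0
  rw [hp0] at hW
  refine mul_left_cancel₀ hW ?_
  rw [← vwpValue_shift_eq ha hq0 hq hx hf hg]
  have hg' : VwpGeneric q a (crPar a b (c * q ^ i) (d * q ^ j) e f x) := by
    convert hg.shift hq0 ![0, 0, i, j, 0, 0] using 1
    funext m
    fin_cases m <;> simp [crPar]
  have hP : ∏ m, crPar a b (c * q ^ i) (d * q ^ j) e f x m = a ^ 3 * q := by
    simp only [Fin.prod_univ_six, crPar, Matrix.cons_val]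
    have : a ^ 3 * q = a * (a ^ 2 * q) := by ring
    rw [this, hbal, pow_add]
    field_simp
  rw [← vwpIntegral_eq_vwpValue ha hq0 hq hg' hP]
  have hw : ∀ (s : Fin 6) (k : ℕ),
      vwpWeight q a (crPar a b (c * q ^ i) (d * q ^ j) e f x) (crPar a b c d e f x s / a * q ^ k) =
      vwpWeight q a (crPar a b c d e f x) (crPar a b c d e f x s / a) *
        (vwpTerm q a (crPar a b c d e f x) (crPar a b c d e f x s / a) k *
          wpShift q a c d i j (crPar a b c d e f x s / a * q ^ k)) := by
    intro s k
    rw [← mul_assoc, ← hg.weight_mul_pow ha hq0 hq s k]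
    have h1 : ∀ l : Fin 6, ∀ m : ℕ, crPar a b c d e f x l * q ^ m *
        (crPar a b c d e f x s / a * q ^ k) ≠ 1 := fun l m => by
      have := hg.mul_ne l s (m + k : ℕ)
      rw [zpow_natCast, pow_add] at this
      convert this using 1
      ring
    simp only [vwpWeight, Fin.prod_univ_six]
    simp only [wpShift]
    have h2 := wpFactor_mul_pow (a := a) hq0 hq (h1 2) i
    have h3 := wpFactor_mul_pow (a := a) hq0 hq (h1 3) j
    simp only [crPar, Matrix.cons_val] at h2 h3 ⊢
    rw [h2, h3]
    ring
  have hk := crKap_mul_weight ha hq0 hq hx hf hg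
  have e0 : crPar a b (c * q ^ i) (d * q ^ j) e f x 0 / a = crPar a b c d e f x 0 / a := rfl
  have e1 : crPar a b (c * q ^ i) (d * q ^ j) e f x 1 / a = crPar a b c d e f x 1 / a := rfl
  rw [vwpIntegral, e0, e1, tsum_congr (hw 0), tsum_congr (hw 1), tsum_mul_left, tsum_mul_left,
    hp0, hp1]
  rw [crMoment]
  linear_combination (∑' k : ℕ, vwpTerm q a (crPar a b c d e f x) (b / a) k *
    wpShift q a c d i j (b / a * q ^ k)) * hk

end Generic

/-! ### Summability and continuity of the one-dimensional series. -/

section Limits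

variable {q a : ℂ} {ι : Type*} {l : Filter ι}

theorem eventuallyBounded_projMonomial {y : ι → ℂ} {w : ℂ} (hq : ‖q‖ < 1) (hy : Tendsto y l (𝓝 w))
    {r : ℕ} (j : Fin r) : EventuallyBounded l fun i (k : ℕ) => projMonomial a j (y i * q ^ k) := by
  refine ⟨(1 + ‖a‖ * (‖w‖ + 1) ^ 2) ^ (j : ℕ) * (‖w‖ + 1) ^ (j.rev : ℕ), ?_⟩
  filter_upwards [hy.norm.eventually (ge_mem_nhds (lt_add_one ‖w‖))] with i hi k
  have h1 : ‖y i * q ^ k‖ ≤ ‖w‖ + 1 := by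
    rw [norm_mul, norm_pow]
    calc ‖y i‖ * ‖q‖ ^ k ≤ ‖y i‖ * 1 := by
          gcongr
          exact pow_le_one₀ (norm_nonneg _) hq.le
      _ ≤ _ := by simpa using hi
  have h2 : ‖1 + a * (y i * q ^ k) ^ 2‖ ≤ 1 + ‖a‖ * (‖w‖ + 1) ^ 2 := by
    refine (norm_add_le _ _).trans ?_
    rw [norm_one, norm_mul, norm_pow]
    gcongr
  rw [projMonomial, norm_mul, norm_pow, norm_pow]
  gcongr

theorem exists_norm_vwpTerm_mul_le {p : ι → Fin 6 → ℂ} {y : ι → ℂ} {p₀ : Fin 6 → ℂ} {y₀ : ℂ}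
    (hq : ‖q‖ < 1) (hp : ∀ m, Tendsto (fun i => p i m) l (𝓝 (p₀ m))) (hy : Tendsto y l (𝓝 y₀))
    (hp0 : ∀ m, p₀ m ≠ 0) (hy0 : a * y₀ ^ 2 ≠ 1)
    (hne : ∀ m, ∀ n : ℕ, a * q * y₀ / p₀ m * q ^ n ≠ 1) {r : ℕ} (j : Fin r) :
    ∃ C, ∀ᶠ i in l, ∀ k,
      ‖vwpTerm q a (p i) (y i) k * projMonomial a j (y i * q ^ k)‖ ≤ C * ‖q‖ ^ k := by
  obtain ⟨C, hC⟩ := exists_norm_vwpTerm_le (a := a) hq hy0 ((hy.pow 2).const_mul a)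
    (fun m => eventuallyBounded_qPoch hq ((hp m).mul hy))
    (fun m => eventuallyBounded_inv_qPoch hq ((hy.const_mul (a * q)).div (hp m) (hp0 m)) (hne m))
  obtain ⟨D, hD⟩ := eventuallyBounded_projMonomial (a := a) hq hy j
  refine ⟨C * D, ?_⟩
  filter_upwards [hC, hD] with i h1 h2 k
  rw [norm_mul, mul_right_comm]
  exact mul_le_mul (h1 k) (h2 k) (norm_nonneg _) ((norm_nonneg _).trans (h1 k))

theorem summable_norm_vwpTerm_mul {p : Fin 6 → ℂ} {y : ℂ} (hq : ‖q‖ < 1) (hp0 : ∀ m, p m ≠ 0)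
    (hy0 : a * y ^ 2 ≠ 1) (hne : ∀ m, ∀ n : ℕ, a * q * y / p m * q ^ n ≠ 1) {r : ℕ} (j : Fin r) :
    Summable fun k => ‖vwpTerm q a p y k * projMonomial a j (y * q ^ k)‖ := by
  obtain ⟨C, hC⟩ := exists_norm_vwpTerm_mul_le (a := a) (l := (⊤ : Filter Unit))
    (p := fun _ => p) (y := fun _ => y) hq (fun m => tendsto_const_nhds) tendsto_const_nhds
    hp0 hy0 hne j
  refine ((summable_geometric_of_lt_one (norm_nonneg q) hq).mul_left C).of_nonneg_of_le
    (fun k => norm_nonneg _) ?_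
  simpa using hC

theorem tendsto_vwpTerm {p : ι → Fin 6 → ℂ} {y : ι → ℂ} {p₀ : Fin 6 → ℂ} {y₀ : ℂ}
    (hp : ∀ m, Tendsto (fun i => p i m) l (𝓝 (p₀ m))) (hy : Tendsto y l (𝓝 y₀))
    (hp0 : ∀ m, p₀ m ≠ 0) (hy0 : a * y₀ ^ 2 ≠ 1)
    (hne : ∀ m, ∀ n : ℕ, a * q * y₀ / p₀ m * q ^ n ≠ 1) (k : ℕ) :
    Tendsto (fun i => vwpTerm q a (p i) (y i) k) l (𝓝 (vwpTerm q a p₀ y₀ k)) := by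
  have hsq := (hy.pow 2).const_mul a
  refine (((hsq.mul_const _).const_sub 1).mul ((hsq.const_sub 1).inv₀
    (sub_ne_zero.2 hy0.symm))).mul (tendsto_finsetProd _ fun m _ => ?_) |>.mul_const _
  refine Tendsto.mul (((continuous_qPoch q k).tendsto _).comp ((hp m).mul hy)) ?_
  exact (((continuous_qPoch q k).tendsto _).comp
    ((hy.const_mul (a * q)).div (hp m) (hp0 m))).inv₀ (qPoch_ne_zero (hne m) k)

theorem tendsto_tsum_vwpTerm_mul {p : ι → Fin 6 → ℂ} {y : ι → ℂ} {p₀ : Fin 6 → ℂ} {y₀ : ℂ}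
    (hq : ‖q‖ < 1) (hp : ∀ m, Tendsto (fun i => p i m) l (𝓝 (p₀ m))) (hy : Tendsto y l (𝓝 y₀))
    (hp0 : ∀ m, p₀ m ≠ 0) (hy0 : a * y₀ ^ 2 ≠ 1)
    (hne : ∀ m, ∀ n : ℕ, a * q * y₀ / p₀ m * q ^ n ≠ 1) {r : ℕ} (j : Fin r) :
    Tendsto (fun i => ∑' k, vwpTerm q a (p i) (y i) k * projMonomial a j (y i * q ^ k)) l
      (𝓝 (∑' k, vwpTerm q a p₀ y₀ k * projMonomial a j (y₀ * q ^ k))) := by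
  obtain ⟨C, hC⟩ := exists_norm_vwpTerm_mul_le hq hp hy hp0 hy0 hne j
  refine tendsto_tsum_of_dominated_convergence
    ((summable_geometric_of_lt_one (norm_nonneg q) hq).mul_left C) (fun k => ?_) hC
  refine (tendsto_vwpTerm hp hy hp0 hy0 hne k).mul ?_
  have : Continuous fun y => projMonomial a j (y * q ^ k) := by
    unfold projMonomial; fun_prop
  exact (this.tendsto y₀).comp hy

end Limits

/-! ### The determinant of moments, for generic parameters. -/

section Generic

variable {q a b c d e f : ℂ} {r : ℕ}

/-- The matrix of moments of the functions `projMonomial`. -/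
noncomputable def crMatrix (q a b c d e f : ℂ) (x : Fin r → ℂ) : Matrix (Fin r) (Fin r) ℂ :=
  .of fun i j => crMoment q a b c d e f (x i) (projMonomial a j)

/-- The part of the product side which does not depend on the `x i`. -/
noncomputable def crCol (q a b c d e : ℂ) (i : ℕ) : ℂ :=
  qPochInf (a * q ^ (1 - (i : ℤ)) / (c * d)) q * qPochInf (a * q ^ (1 - (i : ℤ)) / (c * e)) q *
    qPochInf (a * q ^ (1 - (i : ℤ)) / (d * e)) q /
  (qPochInf (b * c * q ^ i / a) q * qPochInf (b * d * q ^ i / a) q * qPochInf (b * e * q ^ i / a) q)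

theorem crMoment_wpShift_eq_sum {x : ℂ} (ha : a ≠ 0) (hq0 : q ≠ 0) (hq : ‖q‖ < 1) (hx : x ≠ 0)
    (hg : VwpGeneric q a (crPar a b c d e f x)) (j : Fin r) :
    crMoment q a b c d e f x (wpShift q a c d j.rev j) =
      ∑ k : Fin r, crMoment q a b c d e f x (projMonomial a k) *
        twoNodeMatrix (wpNode q a c) (wpNode q a d) r k j := by
  have hb : b ≠ 0 := hg.ne_zero 1
  have hc : c ≠ 0 := hg.ne_zero 2
  have hd : d ≠ 0 := hg.ne_zero 3
  have hp0 : crPar a b c d e f x 0 / a = x := by simp [crPar]; field_simp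
  have hp1 : crPar a b c d e f x 1 / a = b / a := rfl
  have hs : ∀ (s : Fin 6) (k : Fin r), Summable fun n : ℕ =>
      vwpTerm q a (crPar a b c d e f x) (crPar a b c d e f x s / a) n *
        projMonomial a k (crPar a b c d e f x s / a * q ^ n) := fun s k => by
    refine (summable_norm_vwpTerm_mul hq hg.ne_zero (fun h => hg.mul_ne s s 0 ?_)
      (fun m n => ?_) k).of_norm
    · rw [zpow_zero, mul_one, ← h]; field_simp
    · convert hg.shifted_den_ne hq0 hq s m n using 2
      field_simp
  have key : ∀ s : Fin 6, crPar a b c d e f x s / a ≠ 0 →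
      ∑' n : ℕ, vwpTerm q a (crPar a b c d e f x) (crPar a b c d e f x s / a) n *
        wpShift q a c d j.rev j (crPar a b c d e f x s / a * q ^ n) =
      ∑ k : Fin r, (∑' n : ℕ, vwpTerm q a (crPar a b c d e f x) (crPar a b c d e f x s / a) n *
        projMonomial a k (crPar a b c d e f x s / a * q ^ n)) *
        twoNodeMatrix (wpNode q a c) (wpNode q a d) r k j := fun s hs0 => by
    simp only [← tsum_mul_right]
    rw [← Summable.tsum_finsetSum fun k _ => (hs s k).mul_right _]
    refine tsum_congr fun n => ?_
    rw [wpShift_eq_sum hc hd hq0 (mul_ne_zero hs0 (pow_ne_zero n hq0)), mul_sum]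
    exact sum_congr rfl fun k _ => (mul_assoc _ _ _).symm
  have k0 := key 0 (by rw [hp0]; exact hx)
  have k1 := key 1 (by rw [hp1]; exact div_ne_zero hb ha)
  rw [hp0] at k0
  rw [hp1] at k1
  simp only [crMoment, k0, k1, mul_sum, add_mul, sum_add_distrib, mul_assoc]

/-- Let `K` and `K'` be the transition matrices for `a` and `a / f`. The shifted moments give
`crMatrix * K = diag(row) * V' * K' * diag(col)`, where `V'` is the type-C Vandermonde matrix for `a
/ f`. Taking determinants leaves the quotient `det K' / det K` to be absorbed into the column
factors. -/
theorem det_crMatrix_of_generic {x : Fin r → ℂ} (ha : a ≠ 0) (hq0 : q ≠ 0) (hq : ‖q‖ < 1)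
    (hx : ∀ i, x i ≠ 0) (hf : f ≠ 0) (hg : ∀ i, VwpGeneric q a (crPar a b c d e f (x i)))
    (hbal : a ^ 2 * q ^ (2 - (r : ℤ)) = b * c * d * e * f) :
    (crMatrix q a b c d e f x).det = (∏ i, crRow q a b c d e f (x i)) *
      (∏ i : Fin r, crCol q a b c d e i) *
      ∏ i : Fin r, ∏ j : Fin r with i < j, ((x i - x j) * (1 - a / f * x i * x j)) := by
  rcases r.eq_zero_or_pos with rfl | hpos
  · simp
  obtain ⟨n, hr⟩ : ∃ n, r = n + 1 := ⟨r - 1, by omega⟩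
  have hg0 := hg ⟨0, hpos⟩
  have hb : b ≠ 0 := hg0.ne_zero 1
  have hc : c ≠ 0 := hg0.ne_zero 2
  have hd : d ≠ 0 := hg0.ne_zero 3
  have he : e ≠ 0 := hg0.ne_zero 4
  have hbal' : a ^ 2 * q = b * c * d * e * f * q ^ n := by
    rw [← hbal, hr, mul_assoc, ← zpow_natCast q n, ← zpow_add₀ hq0]
    push_cast
    rw [show (2 - ((n : ℤ) + 1) + n) = 1 by ring, zpow_one]
  set u := a * q / (c * d) with hu
  set u' := a / f * q / (c * d) with hu'
  -- The balancing condition turns the parameter of `K'` into `b e / a`. This is how the powers in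
  -- `det K'` come to match the column denominators `(b e / a;q)_∞`.
  have hu1 : u' = b * e / a * q ^ n := by
    rw [hu']
    field_simp
    linear_combination hbal'
  -- the transition matrices
  set X := (∏ s ∈ range r, (-1 : ℂ) ^ s) *
        ∏ s ∈ range r, ∏ j ∈ range s, (c * q ^ (s - 1 - j) - d * q ^ j) with hX
  have hK : (twoNodeMatrix (wpNode q a c) (wpNode q a d) r).det =
      X * ∏ s ∈ range r, (1 - u / q ^ s) ^ s := det_twoNodeMatrix_wpNode hc hd hq0 r
  have hK' : (twoNodeMatrix (wpNode q (a / f) c) (wpNode q (a / f) d) r).det =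
      X * ∏ s ∈ range r, (1 - u' / q ^ s) ^ s := det_twoNodeMatrix_wpNode hc hd hq0 r
  have hX0 : X ≠ 0 := by
    refine mul_ne_zero (prod_ne_zero_iff.2 fun s _ => pow_ne_zero s (by norm_num))
      (prod_ne_zero_iff.2 fun s _ => prod_ne_zero_iff.2 fun j _ h => ?_)
    apply hg0.div_ne 2 3 (by decide) ((s - 1 - j : ℕ) - (j : ℤ))
    simp only [crPar, Matrix.cons_val]
    rw [sub_eq_zero] at h
    rw [zpow_sub₀ hq0, zpow_natCast, zpow_natCast, div_mul_div_comm, h, div_self]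
    exact mul_ne_zero hd (pow_ne_zero j hq0)
  have hu0 : ∏ s ∈ range r, (1 - u / q ^ s) ^ s ≠ 0 := by
    refine prod_ne_zero_iff.2 fun s _ => pow_ne_zero s fun h => ?_
    apply hg0.mul_ne 2 3 (s - 1)
    simp only [crPar, Matrix.cons_val]
    rw [sub_eq_zero, eq_comm, div_eq_one_iff_eq (pow_ne_zero s hq0)] at h
    rw [zpow_sub_one₀ hq0, zpow_natCast, ← h, hu]
    field_simp
  have hbe : ∀ s : ℕ, qPochInf (b * e / a * q ^ s) q ≠ 0 := fun s =>
    qPochInf_ne_zero hq fun m h => hg0.mul_ne 1 4 (s + m : ℕ) (by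
      rw [zpow_natCast, pow_add, ← mul_assoc]; exact h)
  have p1 := qPochInf_pow_eq u hq0 hq r
  have p2 := qPochInf_pow_eq u' hq0 hq r
  have e1 : u * q / q ^ r = u / q ^ n := by rw [hr, pow_succ]; field_simp
  have e2 : u' * q / q ^ r = b * e / a := by rw [hu1, hr, pow_succ]; field_simp
  rw [e1] at p1
  rw [e2] at p2
  have hbe0 : qPochInf (b * e / a) q ≠ 0 := by simpa using hbe 0
  -- the matrix of shifted moments
  let col : Fin r → ℂ := fun j =>
    qPochInf (u / q ^ n) q * qPochInf (a * q / (c * e) / q ^ (j.rev : ℕ)) q *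
      qPochInf (a * q / (d * e) / q ^ (j : ℕ)) q /
      (qPochInf (b * c / a * q ^ (j.rev : ℕ)) q * qPochInf (b * d / a * q ^ (j : ℕ)) q *
        qPochInf (b * e / a) q)
  have hprod : (crMatrix q a b c d e f x).det *
      (twoNodeMatrix (wpNode q a c) (wpNode q a d) r).det =
      (∏ i, crRow q a b c d e f (x i)) * ((∏ j, col j) *
      ((∏ i : Fin r, ∏ j : Fin r with i < j, ((x i - x j) * (1 - a / f * x i * x j))) *
        (twoNodeMatrix (wpNode q (a / f) c) (wpNode q (a / f) d) r).det)) := by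
    rw [← det_wpShift hc hd hq0 hx, ← Matrix.det_mul_row, ← Matrix.det_mul_column,
      ← Matrix.det_mul]
    congr 1
    ext i j
    have hj : (j.rev : ℕ) + j = n := by rw [Fin.val_rev]; omega
    rw [Matrix.mul_apply]
    simp only [crMatrix, Matrix.of_apply]
    rw [← crMoment_wpShift_eq_sum ha hq0 hq (hx i) (hg i) j,
      crMoment_wpShift ha hq0 hq (hx i) hf (hg i) _ _ (by rw [hj]; exact hbal'), hj]
    simp only [col]
    ring
  -- Every column carries the same factors `(u / q^n;q)_∞` and `(b e / a;q)_∞`. By `qPochInf_pow_eq`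
  -- their `r`-th powers become products over distinct shifts, and the correction factors are those
  -- of `det K` and `det K'`. The reversal of indices does not affect the products over all columns.
  have hcol : (∏ j, col j) * ∏ s ∈ range r, (1 - u' / q ^ s) ^ s =
      (∏ i : Fin r, crCol q a b c d e i) * ∏ s ∈ range r, (1 - u / q ^ s) ^ s := by
    have z : ∀ (w P : ℂ) (i : ℕ), a * q ^ (1 - (i : ℤ)) / P = a * q / P / q ^ i := fun w P i => by
      rw [zpow_sub₀ hq0, zpow_one, zpow_natCast]; ring
    have rv : ∀ g : ℕ → ℂ, ∏ j : Fin r, g (j.rev : ℕ) = ∏ j : Fin r, g j := fun g =>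
      Equiv.prod_comp Fin.revPerm fun j : Fin r => g j
    have f1 : ∀ i : ℕ, crCol q a b c d e i = qPochInf (u / q ^ i) q *
        qPochInf (a * q / (c * e) / q ^ i) q * qPochInf (a * q / (d * e) / q ^ i) q /
        (qPochInf (b * c / a * q ^ i) q * qPochInf (b * d / a * q ^ i) q *
          qPochInf (b * e / a * q ^ i) q) := fun i => by
      rw [crCol, z 0, z 0, z 0]
      congr 5 <;> ring
    simp only [col, f1, prod_div_distrib, prod_mul_distrib]
    rw [rv fun j => qPochInf (a * q / (c * e) / q ^ j) q, rv fun j => qPochInf (b * c / a * q ^ j) q]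
    simp only [prod_const, card_univ, Fintype.card_fin]
    rw [p1, p2, prod_range fun i => qPochInf (u / q ^ i) q]
    have f2 : ∏ i ∈ range r, qPochInf (u' / q ^ i) q =
        ∏ i : Fin r, qPochInf (b * e / a * q ^ (i : ℕ)) q := by
      rw [prod_range, ← rv fun j => qPochInf (b * e / a * q ^ j) q]
      refine prod_congr rfl fun i _ => ?_
      have hi : n = (i.rev : ℕ) + i := by rw [Fin.val_rev]; omega
      congr 1
      rw [hu1, hi, pow_add]
      field_simp
    rw [f2]
    have h3 : ∏ s ∈ range r, (1 - u' / q ^ s) ^ s ≠ 0 := fun h => by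
      rw [h, mul_zero] at p2
      exact pow_ne_zero r hbe0 p2
    generalize (∏ s ∈ range r, (1 - u' / q ^ s) ^ s) = y1 at *
    generalize (∏ s ∈ range r, (1 - u / q ^ s) ^ s) = y2 at *
    generalize (∏ i : Fin r, qPochInf (b * e / a * q ^ (i : ℕ)) q) = y3 at *
    generalize (∏ i : Fin r, qPochInf (b * c / a * q ^ (i : ℕ)) q) = y4 at *
    generalize (∏ i : Fin r, qPochInf (b * d / a * q ^ (i : ℕ)) q) = y5 at *
    rw [div_mul_eq_mul_div, ← mul_assoc _ y3 y1, mul_div_mul_right _ _ h3]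
    ring
  rw [hK, hK'] at hprod
  refine mul_right_cancel₀ (mul_ne_zero hX0 hu0) ?_
  rw [hprod]
  linear_combination (∏ i, crRow q a b c d e f (x i)) * X *
    (∏ i : Fin r, ∏ j : Fin r with i < j, ((x i - x j) * (1 - a / f * x i * x j))) * hcol

end Generic

/-! ### Generic position by a one-parameter perturbation. -/

section Perturbation

variable {q a : ℂ}

/-- For large `|k|` the modulus of `q ^ k` excludes equality uniformly near `u = 1`. Each of the
finitely many other `k` is handled by the nonzero derivative of `w * u ^ n * q ^ k` at 1. -/
theorem eventually_mul_zpow_ne_one {w : ℂ} (hw : w ≠ 0) (hq0 : q ≠ 0) (hq : ‖q‖ < 1) {n : ℤ}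
    (hn : n ≠ 0) : ∀ᶠ u : ℂ in 𝓝[≠] 1, ∀ k : ℤ, w * u ^ n * q ^ k ≠ 1 := by
  have hw' : 0 < ‖w‖ := norm_pos_iff.2 hw
  have hq' : 0 < ‖q‖ := norm_pos_iff.2 hq0
  have hder : ∀ v : ℂ, HasDerivAt (fun u : ℂ => v * u ^ n) (v * n) 1 := fun v => by
    simpa using (hasDerivAt_zpow n (1 : ℂ) (Or.inl one_ne_zero)).const_mul v
  obtain ⟨M, hM1, hM2⟩ : ∃ M : ℕ, (∀ m ≥ M, ‖q‖ ^ m < (2 * ‖w‖)⁻¹) ∧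
      ∀ m ≥ M, ‖q‖ ^ m < ‖w‖ / 2 := by
    have h := tendsto_pow_atTop_nhds_zero_of_lt_one (norm_nonneg q) hq
    obtain ⟨M1, h1⟩ := eventually_atTop.1 (h.eventually_lt_const (inv_pos.2 (mul_pos two_pos hw')))
    obtain ⟨M2, h2⟩ := eventually_atTop.1 (h.eventually_lt_const (half_pos hw'))
    exact ⟨max M1 M2, fun m hm => h1 m (le_trans (le_max_left _ _) hm),
      fun m hm => h2 m (le_trans (le_max_right _ _) hm)⟩
  have hnorm : Tendsto (fun u : ℂ => ‖w * u ^ n‖) (𝓝[≠] 1) (𝓝 ‖w‖) := by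
    have := (hder w).continuousAt.norm.tendsto
    simp only [one_zpow, mul_one] at this
    exact this.mono_left nhdsWithin_le_nhds
  have hfin : ∀ᶠ u : ℂ in 𝓝[≠] 1, ∀ k ∈ Finset.Icc (-(M : ℤ)) M, w * u ^ n * q ^ k ≠ 1 := by
    rw [eventually_all_finset]
    intro k _
    have := (hder (w * q ^ k)).eventually_ne (c := 1)
      (mul_ne_zero (mul_ne_zero hw (zpow_ne_zero k hq0)) (Int.cast_ne_zero.2 hn))
    filter_upwards [this] with u hu h
    exact hu (by rw [← h]; ring)
  filter_upwards [hfin, hnorm.eventually_lt_const (show ‖w‖ < 2 * ‖w‖ by linarith),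
    hnorm.eventually_const_lt (half_lt_self hw')] with u h1 h2 h3 k
  by_cases hk : k ∈ Finset.Icc (-(M : ℤ)) M
  · exact h1 k hk
  · intro h
    have hN : ‖w * u ^ n‖ * ‖q‖ ^ k = 1 := by rw [← norm_zpow, ← norm_mul, h, norm_one]
    rw [Finset.mem_Icc, not_and_or, not_le, not_le] at hk
    rcases hk with hk | hk
    · obtain ⟨m, rfl⟩ : ∃ m : ℕ, k = -(m : ℤ) := ⟨(-k).toNat, by omega⟩
      have h4 := hM2 m (by omega)
      rw [zpow_neg, zpow_natCast, ← div_eq_mul_inv, div_eq_one_iff_eq (by positivity)] at hN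
      linarith
    · obtain ⟨m, rfl⟩ : ∃ m : ℕ, k = m := ⟨k.toNat, by omega⟩
      have h4 := hM1 m (by omega)
      rw [zpow_natCast] at hN
      have h5 : ‖w * u ^ n‖ * ‖q‖ ^ m < 2 * ‖w‖ * (2 * ‖w‖)⁻¹ :=
        mul_lt_mul'' h2 h4 (norm_nonneg _) (by positivity)
      rw [hN, mul_inv_cancel₀ (by positivity)] at h5
      exact lt_irrefl _ h5

/-- Exponents for which the perturbation `p i ↦ p i * u ^ m i` makes the parameters generic. -/
def perturbationExponent : Fin 6 → ℤ := ![1, 2, 3, 4, -20, 10]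

/-- What matters about the exponents is that all sums of two of them, repetitions included, and all
differences of distinct entries are nonzero. -/
theorem eventually_vwpGeneric {p : Fin 6 → ℂ} (hp : ∀ i, p i ≠ 0) (ha : a ≠ 0) (hq0 : q ≠ 0)
    (hq : ‖q‖ < 1) :
    ∀ᶠ u : ℂ in 𝓝[≠] 1, VwpGeneric q a fun i => p i * u ^ perturbationExponent i := by
  have hu0 : ∀ᶠ u : ℂ in 𝓝[≠] 1, u ≠ 0 :=
    (eventually_ne_nhds one_ne_zero).filter_mono nhdsWithin_le_nhds
  have h1 : ∀ᶠ u : ℂ in 𝓝[≠] 1, ∀ i j, ∀ k : ℤ,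
      p i * p j / a * u ^ (perturbationExponent i + perturbationExponent j) * q ^ k ≠ 1 := by
    rw [eventually_all]; intro i
    rw [eventually_all]; intro j
    exact eventually_mul_zpow_ne_one (div_ne_zero (mul_ne_zero (hp i) (hp j)) ha) hq0 hq
      (by revert i j; decide)
  have h2 : ∀ᶠ u : ℂ in 𝓝[≠] 1, ∀ i j, i ≠ j → ∀ k : ℤ,
      p i / p j * u ^ (perturbationExponent i - perturbationExponent j) * q ^ k ≠ 1 := by
    rw [eventually_all]; intro i
    rw [eventually_all]; intro j
    rw [eventually_imp_distrib_left]; intro hij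
    exact eventually_mul_zpow_ne_one (div_ne_zero (hp i) (hp j)) hq0 hq
      (by revert i j; decide)
  filter_upwards [hu0, h1, h2] with u hu h1 h2
  refine ⟨fun i => mul_ne_zero (hp i) (zpow_ne_zero _ hu), fun i j k => ?_, fun i j hij k => ?_⟩
  · convert h1 i j k using 2
    rw [zpow_add₀ hu]; ring
  · convert h2 i j hij k using 2
    have := zpow_ne_zero (perturbationExponent j) hu
    have := hp j
    rw [zpow_sub₀ hu]; field_simp

end Perturbation

/-! ### Removal of the genericity assumptions. -/

section Continuity

variable {q a : ℂ}

@[fun_prop]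
theorem ContinuousAt.qPochInf {g : ℂ → ℂ} {u₀ : ℂ} (hq : ‖q‖ < 1) (hg : ContinuousAt g u₀) :
    ContinuousAt (fun u => qPochInf (g u) q) u₀ :=
  tendsto_qPochInf hq hg

/-- All factors in the denominators are nonzero, for one `x`. -/
structure CrAdmissible (q a b c d e f x : ℂ) : Prop where
  b_ne : b ≠ 0
  c_ne : c ≠ 0
  d_ne : d ≠ 0
  e_ne : e ≠ 0
  f_ne : f ≠ 0
  x_ne : x ≠ 0
  axx : a * x * x ≠ 1
  bb : ∀ n : ℕ, b ^ 2 / a * q ^ n ≠ 1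
  bc : ∀ n : ℕ, b * c / a * q ^ n ≠ 1
  bd : ∀ n : ℕ, b * d / a * q ^ n ≠ 1
  be : ∀ n : ℕ, b * e / a * q ^ n ≠ 1
  bf : ∀ n : ℕ, b * f / (a * x) * q ^ n ≠ 1
  ab : ∀ n : ℕ, a * x / b * q ^ n ≠ 1
  ac : ∀ n : ℕ, a * x * q / c * q ^ n ≠ 1
  ad : ∀ n : ℕ, a * x * q / d * q ^ n ≠ 1
  ae : ∀ n : ℕ, a * x * q / e * q ^ n ≠ 1
  af : ∀ n : ℕ, a * x ^ 2 * q / f * q ^ n ≠ 1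
  ba : ∀ n : ℕ, b * q / (a * x) * q ^ n ≠ 1
  cb : ∀ n : ℕ, b * q / c * q ^ n ≠ 1
  db : ∀ n : ℕ, b * q / d * q ^ n ≠ 1
  eb : ∀ n : ℕ, b * q / e * q ^ n ≠ 1
  fb : ∀ n : ℕ, b * x * q / f * q ^ n ≠ 1

variable {B C D E F X : ℂ → ℂ} {u₀ : ℂ}

theorem mul_q_pow_ne_one (hq : ‖q‖ < 1) (n : ℕ) : q * q ^ n ≠ 1 := fun h => by
  have : ‖q‖ ^ (n + 1) = 1 := by rw [← norm_pow, pow_succ', h, norm_one]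
  exact (pow_lt_one₀ (norm_nonneg q) hq n.succ_ne_zero).ne this

theorem CrAdmissible.par_ne {b c d e f x : ℂ} (h : CrAdmissible q a b c d e f x) (ha : a ≠ 0)
    (m : Fin 6) : crPar a b c d e f x m ≠ 0 := by
  have := h.b_ne; have := h.c_ne; have := h.d_ne; have := h.e_ne
  have := mul_ne_zero ha h.x_ne
  have := div_ne_zero h.f_ne h.x_ne
  fin_cases m <;> assumption

theorem CrAdmissible.den_ne_left {b c d e f x : ℂ} (h : CrAdmissible q a b c d e f x)
    (ha : a ≠ 0) (hq : ‖q‖ < 1) (m : Fin 6) (n : ℕ) :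
    a * q * x / crPar a b c d e f x m * q ^ n ≠ 1 := by
  have hx := h.x_ne
  have hf := h.f_ne
  have e0 : a * q * x / (a * x) * q ^ n = q * q ^ n := by field_simp
  have e1 : ∀ P, a * q * x / P * q ^ n = a * x * q / P * q ^ n := fun P => by ring
  have e2 : a * q * x / b * q ^ n = a * x / b * q ^ (n + 1) := by ring
  have e3 : a * q * x / (f / x) * q ^ n = a * x ^ 2 * q / f * q ^ n := by field_simp
  fin_cases m <;> simp only [crPar, Fin.zero_eta, Fin.mk_one, Fin.reduceFinMk, Matrix.cons_val]
  · rw [e0]; exact mul_q_pow_ne_one hq n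
  · rw [e2]; exact h.ab (n + 1)
  · rw [e1]; exact h.ac n
  · rw [e1]; exact h.ad n
  · rw [e1]; exact h.ae n
  · rw [e3]; exact h.af n

theorem CrAdmissible.den_ne_right {b c d e f x : ℂ} (h : CrAdmissible q a b c d e f x)
    (ha : a ≠ 0) (hq : ‖q‖ < 1) (m : Fin 6) (n : ℕ) :
    a * q * (b / a) / crPar a b c d e f x m * q ^ n ≠ 1 := by
  have hx := h.x_ne
  have hf := h.f_ne
  have hb := h.b_ne
  have e0 : a * q * (b / a) = b * q := by field_simp
  have e1 : b * q / b = q := by field_simp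
  have e2 : b * q / (f / x) = b * x * q / f := by field_simp
  rw [e0]
  fin_cases m <;> simp only [crPar, Fin.zero_eta, Fin.mk_one, Fin.reduceFinMk, Matrix.cons_val]
  · exact h.ba n
  · rw [e1]; exact mul_q_pow_ne_one hq n
  · exact h.cb n
  · exact h.db n
  · exact h.eb n
  · rw [e2]; exact h.fb n

theorem CrAdmissible.sq_ne_right {b c d e f x : ℂ} (h : CrAdmissible q a b c d e f x)
    (ha : a ≠ 0) : a * (b / a) ^ 2 ≠ 1 := by
  have := h.bb 0
  rw [pow_zero, mul_one] at this
  rwa [show a * (b / a) ^ 2 = b ^ 2 / a by field_simp]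

theorem CrAdmissible.sq_ne_left {b c d e f x : ℂ} (h : CrAdmissible q a b c d e f x) :
    a * x ^ 2 ≠ 1 := by
  have := h.axx
  rwa [show a * x ^ 2 = a * x * x by ring]

theorem continuousAt_crPar (hf : ContinuousAt F u₀) (hb : ContinuousAt B u₀)
    (hc : ContinuousAt C u₀) (hd : ContinuousAt D u₀) (he : ContinuousAt E u₀)
    (hx : ContinuousAt X u₀) (hx0 : X u₀ ≠ 0) (m : Fin 6) :
    ContinuousAt (fun u => crPar a (B u) (C u) (D u) (E u) (F u) (X u) m) u₀ := by
  fin_cases m <;> simp only [crPar, Fin.zero_eta, Fin.mk_one, Fin.reduceFinMk, Matrix.cons_val]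
  · fun_prop
  · exact hb
  · exact hc
  · exact hd
  · exact he
  · exact hf.div hx hx0

theorem continuousAt_crKap (ha : a ≠ 0) (hq : ‖q‖ < 1) (hb : ContinuousAt B u₀)
    (hc : ContinuousAt C u₀) (hd : ContinuousAt D u₀) (he : ContinuousAt E u₀)
    (hf : ContinuousAt F u₀) (hx : ContinuousAt X u₀)
    (h : CrAdmissible q a (B u₀) (C u₀) (D u₀) (E u₀) (F u₀) (X u₀)) :
    ContinuousAt (fun u => crKap q a (B u) (C u) (D u) (E u) (F u) (X u)) u₀ := by
  have hb0 := h.b_ne; have hc0 := h.c_ne; have hd0 := h.d_ne; have he0 := h.e_ne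
  have hf0 := h.f_ne; have hx0 := h.x_ne
  have hax := mul_ne_zero ha hx0
  have n1 : qPochInf (a * X u₀ / B u₀) q * (qPochInf (a * X u₀ * q / C u₀) q *
      (qPochInf (a * X u₀ * q / D u₀) q * (qPochInf (a * X u₀ * q / E u₀) q *
      qPochInf (a * X u₀ ^ 2 * q / F u₀) q))) ≠ 0 :=
    mul_ne_zero (qPochInf_ne_zero hq h.ab) (mul_ne_zero (qPochInf_ne_zero hq h.ac)
      (mul_ne_zero (qPochInf_ne_zero hq h.ad) (mul_ne_zero (qPochInf_ne_zero hq h.ae)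
        (qPochInf_ne_zero hq h.af))))
  have n2 : qPochInf (B u₀ ^ 2 * q / a) q * (qPochInf (B u₀ * C u₀ / a) q *
      (qPochInf (B u₀ * D u₀ / a) q * (qPochInf (B u₀ * E u₀ / a) q *
      qPochInf (B u₀ * F u₀ / (a * X u₀)) q))) ≠ 0 :=
    mul_ne_zero (qPochInf_ne_zero hq fun n => by
      convert h.bb (n + 1) using 1; ring) (mul_ne_zero (qPochInf_ne_zero hq h.bc)
      (mul_ne_zero (qPochInf_ne_zero hq h.bd) (mul_ne_zero (qPochInf_ne_zero hq h.be)
        (qPochInf_ne_zero hq h.bf))))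
  simp only [crKap, qPochInfs, List.map_cons, List.map_nil, List.prod_cons, List.prod_nil, mul_one]
  fun_prop (disch := assumption)

theorem continuousAt_crRow (ha : a ≠ 0) (hq : ‖q‖ < 1) (hb : ContinuousAt B u₀)
    (hc : ContinuousAt C u₀) (hd : ContinuousAt D u₀) (he : ContinuousAt E u₀)
    (hf : ContinuousAt F u₀) (hx : ContinuousAt X u₀)
    (h : CrAdmissible q a (B u₀) (C u₀) (D u₀) (E u₀) (F u₀) (X u₀)) :
    ContinuousAt (fun u => crRow q a (B u) (C u) (D u) (E u) (F u) (X u)) u₀ := by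
  have hb0 := h.b_ne; have hc0 := h.c_ne; have hd0 := h.d_ne; have he0 := h.e_ne
  have hf0 := h.f_ne; have hx0 := h.x_ne
  have hax := mul_ne_zero ha hx0
  have hcf := mul_ne_zero hc0 hf0
  have hdf := mul_ne_zero hd0 hf0
  have hef := mul_ne_zero he0 hf0
  have n1 := mul_ne_zero (mul_ne_zero (mul_ne_zero (mul_ne_zero (qPochInf_ne_zero hq h.ac)
      (qPochInf_ne_zero hq h.ad)) (qPochInf_ne_zero hq h.ae)) (qPochInf_ne_zero hq h.af))
      (qPochInf_ne_zero hq h.bf)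
  simp only [crRow]
  fun_prop (disch := assumption)

theorem continuousAt_crCol (hq : ‖q‖ < 1) (hb : ContinuousAt B u₀)
    (hc : ContinuousAt C u₀) (hd : ContinuousAt D u₀) (he : ContinuousAt E u₀) (hc0 : C u₀ ≠ 0)
    (hd0 : D u₀ ≠ 0) (he0 : E u₀ ≠ 0) (hbc : ∀ n : ℕ, B u₀ * C u₀ / a * q ^ n ≠ 1)
    (hbd : ∀ n : ℕ, B u₀ * D u₀ / a * q ^ n ≠ 1) (hbe : ∀ n : ℕ, B u₀ * E u₀ / a * q ^ n ≠ 1)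
    (i : ℕ) : ContinuousAt (fun u => crCol q a (B u) (C u) (D u) (E u) i) u₀ := by
  have hcd := mul_ne_zero hc0 hd0
  have hce := mul_ne_zero hc0 he0
  have hde := mul_ne_zero hd0 he0
  have n1 : qPochInf (B u₀ * C u₀ * q ^ i / a) q * qPochInf (B u₀ * D u₀ * q ^ i / a) q *
      qPochInf (B u₀ * E u₀ * q ^ i / a) q ≠ 0 := by
    refine mul_ne_zero (mul_ne_zero ?_ ?_) ?_ <;> refine qPochInf_ne_zero hq fun n => ?_
    · convert hbc (i + n) using 1; ring
    · convert hbd (i + n) using 1; ring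
    · convert hbe (i + n) using 1; ring
  simp only [crCol]
  fun_prop (disch := assumption)

theorem continuousAt_crMoment (ha : a ≠ 0) (hq : ‖q‖ < 1) (hb : ContinuousAt B u₀)
    (hc : ContinuousAt C u₀) (hd : ContinuousAt D u₀) (he : ContinuousAt E u₀)
    (hf : ContinuousAt F u₀) (hx : ContinuousAt X u₀)
    (h : CrAdmissible q a (B u₀) (C u₀) (D u₀) (E u₀) (F u₀) (X u₀)) {r : ℕ} (j : Fin r) :
    ContinuousAt (fun u => crMoment q a (B u) (C u) (D u) (E u) (F u) (X u) (projMonomial a j))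
      u₀ := by
  have hp := fun m => continuousAt_crPar (a := a) hf hb hc hd he hx h.x_ne m
  refine ContinuousAt.add ?_ ((continuousAt_crKap ha hq hb hc hd he hf hx h).mul ?_)
  · exact tendsto_tsum_vwpTerm_mul hq hp hx (h.par_ne ha) h.sq_ne_left (h.den_ne_left ha hq) j
  · exact tendsto_tsum_vwpTerm_mul hq hp (hb.div_const a) (h.par_ne ha) (h.sq_ne_right ha)
      (h.den_ne_right ha hq) j

theorem det_crMatrix_of_eventually {r : ℕ} {X : Fin r → ℂ → ℂ} (hr : 0 < r) (ha : a ≠ 0)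
    (hq : ‖q‖ < 1) (hb : ContinuousAt B u₀) (hc : ContinuousAt C u₀) (hd : ContinuousAt D u₀)
    (he : ContinuousAt E u₀) (hf : ContinuousAt F u₀) (hx : ∀ i, ContinuousAt (X i) u₀)
    (h : ∀ i, CrAdmissible q a (B u₀) (C u₀) (D u₀) (E u₀) (F u₀) (X i u₀))
    (hev : ∀ᶠ u : ℂ in 𝓝[≠] u₀,
      (crMatrix q a (B u) (C u) (D u) (E u) (F u) fun i => X i u).det =
        (∏ i, crRow q a (B u) (C u) (D u) (E u) (F u) (X i u)) *
        (∏ i : Fin r, crCol q a (B u) (C u) (D u) (E u) i) *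
        ∏ i : Fin r, ∏ j : Fin r with i < j,
          ((X i u - X j u) * (1 - a / F u * X i u * X j u))) :
    (crMatrix q a (B u₀) (C u₀) (D u₀) (E u₀) (F u₀) fun i => X i u₀).det =
      (∏ i, crRow q a (B u₀) (C u₀) (D u₀) (E u₀) (F u₀) (X i u₀)) *
      (∏ i : Fin r, crCol q a (B u₀) (C u₀) (D u₀) (E u₀) i) *
      ∏ i : Fin r, ∏ j : Fin r with i < j,
        ((X i u₀ - X j u₀) * (1 - a / F u₀ * X i u₀ * X j u₀)) := by
  have h0 := h ⟨0, hr⟩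
  have hf0 := h0.f_ne
  have L : ContinuousAt
      (fun u : ℂ => (crMatrix q a (B u) (C u) (D u) (E u) (F u) fun i => X i u).det) u₀ := by
    have hM : ContinuousAt
        (fun u : ℂ => crMatrix q a (B u) (C u) (D u) (E u) (F u) fun i => X i u) u₀ :=
      continuousAt_pi.2 fun i => continuousAt_pi.2 fun j =>
        continuousAt_crMoment ha hq hb hc hd he hf (hx i) (h i) j
    have hdet : Continuous fun M : Matrix (Fin r) (Fin r) ℂ => M.det := continuous_id.matrix_det
    exact hdet.continuousAt.comp hM
  have R : ContinuousAt (fun u : ℂ =>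
      (∏ i, crRow q a (B u) (C u) (D u) (E u) (F u) (X i u)) *
      (∏ i : Fin r, crCol q a (B u) (C u) (D u) (E u) i) *
      ∏ i : Fin r, ∏ j : Fin r with i < j,
        ((X i u - X j u) * (1 - a / F u * X i u * X j u))) u₀ := by
    have h1 := fun i => continuousAt_crRow ha hq hb hc hd he hf (hx i) (h i)
    have h2 := fun i : ℕ =>
      continuousAt_crCol hq hb hc hd he h0.c_ne h0.d_ne h0.e_ne h0.bc h0.bd h0.be i
    have h3 : ∀ i j, ContinuousAt (fun u => (X i u - X j u) * (1 - a / F u * X i u * X j u)) u₀ :=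
      fun i j => by
        have hi := hx i
        have hj := hx j
        fun_prop (disch := assumption)
    refine (ContinuousAt.mul ?_ ?_).mul ?_
    · exact tendsto_finsetProd _ fun i _ => h1 i
    · exact tendsto_finsetProd _ fun i _ => h2 i
    · exact tendsto_finsetProd _ fun i _ => tendsto_finsetProd _ fun j _ => h3 i j
  have hLR := L.tendsto.mono_left (nhdsWithin_le_nhds (s := {u₀}ᶜ))
  have hRR := R.tendsto.mono_left (nhdsWithin_le_nhds (s := {u₀}ᶜ))
  exact tendsto_nhds_unique (hLR.congr' hev) hRR

theorem det_crMatrix {b c d e f : ℂ} {r : ℕ} {x : Fin r → ℂ} (ha : a ≠ 0) (hq0 : q ≠ 0)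
    (hq : ‖q‖ < 1) (h : ∀ i, CrAdmissible q a b c d e f (x i))
    (hbal : a ^ 2 * q ^ (2 - (r : ℤ)) = b * c * d * e * f) :
    (crMatrix q a b c d e f x).det = (∏ i, crRow q a b c d e f (x i)) *
      (∏ i : Fin r, crCol q a b c d e i) *
      ∏ i : Fin r, ∏ j : Fin r with i < j, ((x i - x j) * (1 - a / f * x i * x j)) := by
  -- For `r = 0` the hypothesis `h` says nothing about `b, …, f`, but the determinant and all
  -- products are empty.
  rcases r.eq_zero_or_pos with rfl | hpos
  · simp
  have h0 := h ⟨0, hpos⟩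
  obtain ⟨Z, hZ⟩ : ∃ Z : ℤ → ℂ → ℂ, ∀ n u, Z n u = u ^ n := ⟨fun n u => u ^ n, fun _ _ => rfl⟩
  have hZ1 : ∀ n, Z n 1 = 1 := fun n => by rw [hZ, one_zpow]
  have hz : ∀ (w : ℂ) (n : ℤ), ContinuousAt (fun u : ℂ => w * Z n u) 1 := fun w n => by
    simp only [hZ]
    exact continuousAt_const.mul (continuousAt_zpow₀ (1 : ℂ) n (Or.inl one_ne_zero))
  -- The exponent of `f` is 11 because `x` carries 1 and `f / x` must carry 10. Since 2 + 3 + 4 - 20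
  -- + 11 = 0 and `a` stays fixed, the balancing condition is preserved.
  have key := det_crMatrix_of_eventually (X := fun i u => x i * Z 1 u) hpos ha hq (hz b 2) (hz c 3)
    (hz d 4) (hz e (-20)) (hz f 11) (fun i => hz (x i) 1)
    (fun i => by simpa only [hZ1, mul_one] using h i) ?_
  · simpa only [hZ1, mul_one] using key
  have hgen : ∀ᶠ u : ℂ in 𝓝[≠] 1, ∀ i, VwpGeneric q a
      fun m => crPar a b c d e f (x i) m * u ^ perturbationExponent m :=
    eventually_all.2 fun i => eventually_vwpGeneric ((h i).par_ne ha) ha hq0 hq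
  have hu0 : ∀ᶠ u : ℂ in 𝓝[≠] 1, u ≠ 0 :=
    (eventually_ne_nhds one_ne_zero).filter_mono nhdsWithin_le_nhds
  filter_upwards [hgen, hu0] with u hg hu
  have hZ0 : ∀ n, Z n u ≠ 0 := fun n => by rw [hZ]; exact zpow_ne_zero n hu
  refine det_crMatrix_of_generic ha hq0 hq (fun i => mul_ne_zero (h i).x_ne (hZ0 1))
    (mul_ne_zero h0.f_ne (hZ0 11)) (fun i => ?_) ?_
  · convert hg i using 1
    funext m
    have hx0 := (h i).x_ne
    have h11 : Z 11 u = Z 10 u * Z 1 u := by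
      rw [hZ, hZ, hZ, ← zpow_add₀ hu]; norm_num
    have := hZ0 1
    rw [← hZ]
    fin_cases m <;> simp only [crPar, perturbationExponent, Fin.zero_eta, Fin.mk_one,
      Fin.reduceFinMk, Matrix.cons_val]
    · ring
    · rw [h11]
      field_simp
  · have : Z 2 u * Z 3 u * Z 4 u * Z (-20) u * Z 11 u = 1 := by
      simp only [hZ]
      rw [← zpow_add₀ hu, ← zpow_add₀ hu, ← zpow_add₀ hu, ← zpow_add₀ hu]; norm_num
    rw [hbal]
    linear_combination -(b * c * d * e * f) * this

end Continuity

/-! ### Determinants of series and products over pairs. -/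

section Combinatorics

theorem summable_norm_prod_and_tsum_prod {r : ℕ} (g : Fin r → ℕ → ℂ)
    (hg : ∀ i, Summable fun n => ‖g i n‖) :
    (Summable fun k : Fin r → ℕ => ‖∏ i, g i (k i)‖) ∧
      ∑' k : Fin r → ℕ, ∏ i, g i (k i) = ∏ i, ∑' n, g i n := by
  induction r with
  | zero => exact ⟨(hasSum_fintype _).summable, by simp⟩
  | succ r ih =>
    obtain ⟨h1, h2⟩ := ih (fun i => g i.succ) fun i => hg i.succ
    have h0 := hg 0
    let e : ℕ × (Fin r → ℕ) ≃ (Fin (r + 1) → ℕ) := Fin.consEquiv fun _ => ℕ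
    have he : ∀ z : ℕ × (Fin r → ℕ),
        ∏ i, g i (e z i) = g 0 z.1 * ∏ i, g (Fin.succ i) (z.2 i) := fun z => by
      rw [Fin.prod_univ_succ]; rfl
    constructor
    · rw [← e.summable_iff]
      have := Summable.mul_norm h0 h1
      refine this.congr fun z => ?_
      simp only [Function.comp, he]
    · rw [← e.tsum_eq, Fin.prod_univ_succ, ← h2, tsum_mul_tsum_of_summable_norm h0 h1]
      exact tsum_congr he

/-- Multilinearity of the determinant in its rows, for rows given by absolutely convergent
series. -/
theorem summable_det_and_tsum_det {r : ℕ} (g : Fin r → Fin r → ℕ → ℂ)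
    (hg : ∀ i j, Summable fun n => ‖g i j n‖) :
    (Summable fun k : Fin r → ℕ => (Matrix.of fun i j => g i j (k i)).det) ∧
      ∑' k : Fin r → ℕ, (Matrix.of fun i j => g i j (k i)).det =
        (Matrix.of fun i j => ∑' n, g i j n).det := by
  have h := fun σ : Equiv.Perm (Fin r) =>
    summable_norm_prod_and_tsum_prod (fun i => g i (σ i)) fun i => hg i (σ i)
  have hs : ∀ σ : Equiv.Perm (Fin r), Summable fun k : Fin r → ℕ =>
      ((Equiv.Perm.sign σ : ℤ) : ℂ) * ∏ i, g i (σ i) (k i) := fun σ =>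
    (h σ).1.of_norm.mul_left _
  have hd : ∀ A : Fin r → Fin r → ℂ, (Matrix.of A).det =
      ∑ σ : Equiv.Perm (Fin r), ((Equiv.Perm.sign σ : ℤ) : ℂ) * ∏ i, A i (σ i) := fun A => by
    rw [← Matrix.det_transpose, Matrix.det_apply']
    rfl
  simp only [hd]
  refine ⟨summable_sum fun σ _ => hs σ, ?_⟩
  rw [Summable.tsum_finsetSum fun σ _ => hs σ]
  refine sum_congr rfl fun σ _ => ?_
  rw [tsum_mul_left, (h σ).2]

/-- A pair with one index in `S` and one outside may occur in either order; the symmetry of `F`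
allows both to be written with the index in `S` first. -/
theorem prod_lt_split {r : ℕ} (S : Finset (Fin r)) (F : Fin r → Fin r → ℂ)
    (hF : ∀ i j, F i j = F j i) :
    ∏ i, ∏ j with i < j, F i j = (∏ i ∈ S, ∏ j ∈ S with i < j, F i j) *
      (∏ i ∈ Sᶜ, ∏ j ∈ Sᶜ with i < j, F i j) * ∏ i ∈ S, ∏ j ∈ Sᶜ, F i j := by
  have hm : ∏ i ∈ S, ∏ j ∈ Sᶜ, F i j =
      (∏ i ∈ S, ∏ j ∈ Sᶜ, if i < j then F i j else 1) *
        ∏ i ∈ Sᶜ, ∏ j ∈ S, if i < j then F i j else 1 := by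
    rw [prod_comm (s := Sᶜ), ← prod_mul_distrib]
    refine prod_congr rfl fun i hi => ?_
    rw [← prod_mul_distrib]
    refine prod_congr rfl fun j hj => ?_
    rcases lt_trichotomy i j with h | rfl | h
    · simp [h, h.not_gt]
    · exact absurd hi (mem_compl.1 hj)
    · simp [h, h.not_gt, hF i j]
  simp only [prod_filter]
  rw [hm, ← prod_mul_prod_compl S]
  simp only [← prod_mul_prod_compl S fun j => if _ < j then F _ j else 1, prod_mul_distrib]
  ring

theorem prod_lt_const {ι : Type*} [LinearOrder ι] (T : Finset ι) (z : ℂ) :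
    ∏ i ∈ T, ∏ j ∈ T with i < j, z = z ^ (#T).choose 2 := by
  induction T using Finset.induction_on_max with
  | empty => simp
  | insert m T hT ih =>
    have hm : m ∉ T := fun h => lt_irrefl m (hT m h)
    have h1 : ∏ j ∈ insert m T with m < j, z = 1 := by
      rw [filter_insert, if_neg (lt_irrefl m), filter_false_of_mem fun j hj => (hT j hj).not_gt,
        prod_empty]
    have h2 : ∀ i ∈ T, ∏ j ∈ insert m T with i < j, z = z * ∏ j ∈ T with i < j, z := fun i hi => by
      rw [filter_insert, if_pos (hT i hi), prod_insert fun h => hm (mem_filter.1 h).1]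
    rw [prod_insert hm, h1, prod_congr rfl h2, prod_mul_distrib, ih, prod_const,
      card_insert_of_notMem hm, Nat.choose_succ_succ' #T 1, Nat.choose_one_right, pow_add, one_mul]

end Combinatorics

/-! ### Matching the multiple series and the product with determinants. -/

section Terms

variable {q a b c d e f : ℂ}

theorem vwpTerm_crPar_left {x : ℂ} (ha : a ≠ 0) (hx : x ≠ 0) (k : ℕ) :
    vwpTerm q a (crPar a b c d e f x) x k =
      (1 - a * x ^ 2 * q ^ (2 * k)) / (1 - a * x ^ 2) *
        (qPochs [a * x ^ 2, b * x, c * x, d * x, e * x, f] q k /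
          qPochs [q, a * x * q / b, a * x * q / c, a * x * q / d, a * x * q / e,
            a * x ^ 2 * q / f] q k) * q ^ k := by
  have e1 : a * x * x = a * x ^ 2 := by ring
  have e2 : f / x * x = f := by field_simp
  have e3 : a * q * x / (a * x) = q := by field_simp
  have e4 : a * q * x / (f / x) = a * x ^ 2 * q / f := by field_simp
  have e5 : a * q * x = a * x * q := by ring
  simp only [vwpTerm, Fin.prod_univ_six, crPar, Matrix.cons_val, qPochs, List.map_cons,
    List.map_nil, List.prod_cons, List.prod_nil, e1, e2, e3, e4]
  simp only [e5, div_eq_mul_inv, mul_inv]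
  ring

theorem vwpTerm_crPar_right {x : ℂ} (ha : a ≠ 0) (hb : b ≠ 0) (hx : x ≠ 0) (k : ℕ) :
    vwpTerm q a (crPar a b c d e f x) (b / a) k =
      (1 - b ^ 2 * q ^ (2 * k) / a) / (1 - b ^ 2 / a) *
        (qPochs [b ^ 2 / a, b * x, b * c / a, b * d / a, b * e / a, b * f / (a * x)] q k /
          qPochs [q, b * q / (a * x), b * q / c, b * q / d, b * q / e, b * x * q / f] q k) *
        q ^ k := by
  have e1 : a * x * (b / a) = b * x := by field_simp
  have e2 : b * (b / a) = b ^ 2 / a := by ring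
  have e3 : f / x * (b / a) = b * f / (a * x) := by ring
  have e4 : a * q * (b / a) = b * q := by field_simp
  have e5 : b * q / b = q := by field_simp
  have e6 : b * q / (f / x) = b * x * q / f := by field_simp
  have e7 : ∀ P, P * (b / a) = b * P / a := fun P => by ring
  have e8 : a * (b / a) ^ 2 = b ^ 2 / a := by field_simp
  simp only [vwpTerm, Fin.prod_univ_six, crPar, Matrix.cons_val, qPochs, List.map_cons,
    List.map_nil, List.prod_cons, List.prod_nil, e1, e2, e3, e4, e5, e6, e7 c, e7 d, e7 e, e8]
  simp only [div_eq_mul_inv, mul_inv]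
  ring

variable {r : ℕ} {x : Fin r → ℂ} {S : Finset (Fin r)}

/-- The product `∏_{i<j} (x_i - x_j) (1 - a x_i x_j)`. -/
noncomputable def crVandermonde (a : ℂ) (x : Fin r → ℂ) : ℂ :=
  ∏ i : Fin r, ∏ j : Fin r with i < j, ((x i - x j) * (1 - a * x i * x j))

/-- The term of the matrix entry in row `i` and column `j`, taken from the first series if
`i ∈ S` and from the second one otherwise. -/
noncomputable def crEntry (q a b c d e f : ℂ) (x : Fin r → ℂ) (S : Finset (Fin r))
    (i j : Fin r) (n : ℕ) : ℂ :=
  vwpTerm q a (crPar a b c d e f (x i)) (if i ∈ S then x i else b / a) n *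
    projMonomial a j ((if i ∈ S then x i else b / a) * q ^ n)

theorem crVandermonde_ne_zero (hxx : ∀ i j, i ≠ j → x i ≠ x j)
    (haxx : ∀ i j, a * x i * x j ≠ 1) : crVandermonde a x ≠ 0 :=
  prod_ne_zero_iff.2 fun i _ => prod_ne_zero_iff.2 fun j hj =>
    mul_ne_zero (sub_ne_zero.2 (hxx i j (mem_filter.1 hj).2.ne))
      (sub_ne_zero.2 (haxx i j).symm)

/-- Row factors come out of the determinant and leave the type-C Vandermonde product at the points
`y i`. Each pair outside `S` contributes a factor `b / a` from `y i - y j`, which explains the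
binomial exponent. -/
theorem det_crEntry (ha : a ≠ 0) (hb : b ≠ 0) (hx : ∀ i, x i ≠ 0)
    (hxx : ∀ i j, i ≠ j → x i ≠ x j) (haxx : ∀ i j, a * x i * x j ≠ 1) (k : Fin r → ℕ) :
    (Matrix.of fun i j => crEntry q a b c d e f x S i j (k i)).det =
      (b / a) ^ (r - #S).choose 2 * crTerm q a b c d e f x S k * crVandermonde a x := by
  have hL := fun i => vwpTerm_crPar_left (q := q) (b := b) (c := c) (d := d) (e := e) (f := f)
    ha (hx i) (k i)
  have hR := fun i => vwpTerm_crPar_right (q := q) (c := c) (d := d) (e := e) (f := f)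
    ha hb (hx i) (k i)
  set y : Fin r → ℂ := fun i => (if i ∈ S then x i else b / a) * q ^ k i with hy
  set w : Fin r → ℂ := fun i =>
    vwpTerm q a (crPar a b c d e f (x i)) (if i ∈ S then x i else b / a) (k i) with hw
  have hyS : ∀ i ∈ S, y i = x i * q ^ k i := fun i hi => by simp [hy, hi]
  have hyC : ∀ i ∈ Sᶜ, y i = b / a * q ^ k i := fun i hi => by simp [hy, mem_compl.1 hi]
  have hdet : (Matrix.of fun i j => crEntry q a b c d e f x S i j (k i)).det =
      (∏ i, w i) * ∏ i : Fin r, ∏ j : Fin r with i < j, ((y i - y j) * (1 - a * y i * y j)) := by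
    rw [← det_projMonomial, ← Matrix.det_mul_column]
    rfl
  have hquot : ∏ i : Fin r, ∏ j : Fin r with i < j, ((y i - y j) * (1 - a * y i * y j)) =
      (∏ i : Fin r, ∏ j : Fin r with i < j,
        ((y i - y j) * (1 - a * y i * y j)) / ((x i - x j) * (1 - a * x i * x j))) *
      crVandermonde a x := by
    rw [crVandermonde, ← prod_mul_distrib]
    refine prod_congr rfl fun i _ => ?_
    rw [← prod_mul_distrib]
    refine prod_congr rfl fun j hj => (div_mul_cancel₀ _ (mul_ne_zero ?_ ?_)).symm
    · exact sub_ne_zero.2 (hxx i j (mem_filter.1 hj).2.ne)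
    · exact sub_ne_zero.2 (haxx i j).symm
  have hSS : ∏ i ∈ S, ∏ j ∈ S with i < j,
      ((y i - y j) * (1 - a * y i * y j)) / ((x i - x j) * (1 - a * x i * x j)) =
      ∏ i ∈ S, ∏ j ∈ S with i < j,
      ((x i * q ^ k i - x j * q ^ k j) * (1 - a * x i * x j * q ^ (k i + k j)))
      / ((x i - x j) * (1 - a * x i * x j)) := by
    refine prod_congr rfl fun i hi => prod_congr rfl fun j hj => ?_
    rw [hyS i hi, hyS j (mem_filter.1 hj).1, pow_add]
    ring
  have hCC : ∏ i ∈ Sᶜ, ∏ j ∈ Sᶜ with i < j,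
      ((y i - y j) * (1 - a * y i * y j)) / ((x i - x j) * (1 - a * x i * x j)) =
      (b / a) ^ (r - #S).choose 2 * ∏ i ∈ Sᶜ, ∏ j ∈ Sᶜ with i < j,
      ((q ^ k i - q ^ k j) * (1 - b ^ 2 * q ^ (k i + k j) / a))
      / ((x i - x j) * (1 - a * x i * x j)) := by
    have hcard : #Sᶜ = r - #S := by rw [card_compl, Fintype.card_fin]
    rw [← hcard, ← prod_lt_const, ← prod_mul_distrib]
    refine prod_congr rfl fun i hi => ?_
    rw [← prod_mul_distrib]
    refine prod_congr rfl fun j hj => ?_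
    have e1 : a * (b / a * q ^ k i) * (b / a * q ^ k j) = b ^ 2 * q ^ (k i + k j) / a := by
      rw [pow_add]; field_simp
    rw [hyC i hi, hyC j (mem_filter.1 hj).1, e1]
    ring
  have hSC : ∏ i ∈ S, ∏ j ∈ Sᶜ,
      ((y i - y j) * (1 - a * y i * y j)) / ((x i - x j) * (1 - a * x i * x j)) =
      ∏ i ∈ S, ∏ j ∈ Sᶜ,
      ((x i * q ^ k i - b * q ^ k j / a) * (1 - b * x i * q ^ (k i + k j)))
      / ((x i - x j) * (1 - a * x i * x j)) := by
    refine prod_congr rfl fun i hi => prod_congr rfl fun j hj => ?_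
    have e1 : a * (x i * q ^ k i) * (b / a * q ^ k j) = b * x i * q ^ (k i + k j) := by
      rw [pow_add]; field_simp
    rw [hyS i hi, hyC j hj, e1]
    ring
  have hwS := prod_congr rfl fun i (hi : i ∈ S) => (show w i = _ by
    simp only [hw, if_pos hi]; exact hL i)
  have hwC := prod_congr rfl fun i (hi : i ∈ Sᶜ) => (show w i = _ by
    simp only [hw, if_neg (mem_compl.1 hi)]; exact hR i)
  have hqk : q ^ ∑ i, k i = (∏ i ∈ S, q ^ k i) * ∏ i ∈ Sᶜ, q ^ k i := by
    rw [prod_mul_prod_compl, prod_pow_eq_pow_sum]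
  rw [hdet, hquot, prod_lt_split S _ fun i j => ?_, hSS, hCC, hSC, ← prod_mul_prod_compl S, hwS,
    hwC, crTerm, hqk]
  · simp only [prod_mul_distrib]
    ring
  -- Numerator and denominator are both antisymmetric in `i, j`, so the quotient is symmetric, as
  -- `prod_lt_split` requires.
  · rw [← neg_sub (y j), ← neg_sub (x j), neg_mul, neg_mul, neg_div_neg_eq]
    ring_nf

theorem CrAdmissible.summable_norm_crEntry (h : ∀ i, CrAdmissible q a b c d e f (x i)) (ha : a ≠ 0)
    (hq : ‖q‖ < 1) (i j : Fin r) : Summable fun n => ‖crEntry q a b c d e f x S i j n‖ := by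
  by_cases hi : i ∈ S
  · simp only [crEntry, if_pos hi]
    exact summable_norm_vwpTerm_mul hq ((h i).par_ne ha) (h i).sq_ne_left
      ((h i).den_ne_left ha hq) j
  · simp only [crEntry, if_neg hi]
    exact summable_norm_vwpTerm_mul hq ((h i).par_ne ha) ((h i).sq_ne_right ha)
      ((h i).den_ne_right ha hq) j

theorem crCoeff_eq : crCoeff q a b c d e f x S =
    (b / a) ^ (r - #S).choose 2 * ∏ i ∈ Sᶜ, crKap q a b c d e f (x i) := by
  simp only [crCoeff, crKap, prod_mul_distrib, mul_assoc]

/-- Each row of `crMatrix` is the sum of a row of first series and `crKap` times a row of second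
series, so multilinearity produces one determinant for each choice `S` of the rows taken from the
first. The sets `univ` and `∅` in `crEntry` select the two pure cases. -/
theorem det_crMatrix_eq_sum : (crMatrix q a b c d e f x).det =
    ∑ S : Finset (Fin r), (∏ i ∈ Sᶜ, crKap q a b c d e f (x i)) *
      (Matrix.of fun i j => ∑' n, crEntry q a b c d e f x S i j n).det := by
  have h := (Matrix.detRowAlternating (n := Fin r) (R := ℂ)).toMultilinearMap.map_add_univ
    (fun i j => ∑' n, crEntry q a b c d e f x univ i j n)
    (fun i j => crKap q a b c d e f (x i) * ∑' n, crEntry q a b c d e f x ∅ i j n)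
  have hM : (crMatrix q a b c d e f x).det = Matrix.detRowAlternating
      ((fun i j => ∑' n, crEntry q a b c d e f x univ i j n) +
      fun i j => crKap q a b c d e f (x i) * ∑' n, crEntry q a b c d e f x ∅ i j n) := by
    simp only [crEntry, mem_univ, if_true, notMem_empty, if_false]
    rfl
  refine hM.trans (h.trans (sum_congr rfl fun S _ => ?_))
  have hk : ∏ i ∈ Sᶜ, crKap q a b c d e f (x i) =
      ∏ i, if i ∈ S then 1 else crKap q a b c d e f (x i) := by
    rw [← prod_mul_prod_compl S, prod_congr rfl fun i hi => if_pos hi, prod_const_one, one_mul]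
    exact prod_congr rfl fun i hi => (if_neg (mem_compl.1 hi)).symm
  rw [hk, ← Matrix.det_mul_column]
  refine congrArg Matrix.det ?_
  ext i j
  by_cases hi : i ∈ S <;> simp [crEntry, hi]

theorem crProduct_mul_crVandermonde (hne : crVandermonde a x ≠ 0) :
    crProduct q a b c d e f x * crVandermonde a x = (∏ i, crRow q a b c d e f (x i)) *
      (∏ i : Fin r, crCol q a b c d e i) *
      ∏ i : Fin r, ∏ j : Fin r with i < j, ((x i - x j) * (1 - a / f * x i * x j)) := by
  have h1 : (∏ i : Fin r, ∏ j : Fin r with i < j,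
      (1 - a * x i * x j / f) / (1 - a * x i * x j)) * crVandermonde a x =
      ∏ i : Fin r, ∏ j : Fin r with i < j, ((x i - x j) * (1 - a / f * x i * x j)) := by
    rw [crVandermonde, ← prod_mul_distrib]
    refine prod_congr rfl fun i hi => ?_
    rw [← prod_mul_distrib]
    refine prod_congr rfl fun j hj => ?_
    have h2 := prod_ne_zero_iff.1 (prod_ne_zero_iff.1 hne i hi) j hj
    have h3 := right_ne_zero_of_mul h2
    field_simp
  have h2 : (∏ i : Fin r,
      qPochInfs [a * x i ^ 2 * q, b / (a * x i), a * q ^ (1 - ((i : ℕ) : ℤ)) / (c * d),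
          a * q ^ (1 - ((i : ℕ) : ℤ)) / (c * e)] q
      / qPochInfs [a * x i * q / c, a * x i * q / d, a * x i * q / e, a * x i ^ 2 * q / f] q)
    * (∏ i : Fin r,
      qPochInfs [a * x i * q / (c * f), a * q ^ (1 - ((i : ℕ) : ℤ)) / (d * e),
          a * x i * q / (d * f), a * x i * q / (e * f)] q
      / qPochInfs [b * c * q ^ (i : ℕ) / a, b * d * q ^ (i : ℕ) / a, b * e * q ^ (i : ℕ) / a,
          b * f / (a * x i)] q) =
      (∏ i, crRow q a b c d e f (x i)) * ∏ i : Fin r, crCol q a b c d e i := by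
    rw [← prod_mul_distrib, ← prod_mul_distrib]
    refine prod_congr rfl fun i _ => ?_
    simp only [crRow, crCol, qPochInfs, List.map_cons, List.map_nil, List.prod_cons,
      List.prod_nil, div_eq_mul_inv (_ * _), mul_inv, mul_one]
    ring
  rw [← h1, ← h2, crProduct]
  ring

end Terms

theorem corollary5p1 (r : ℕ) (q a b c d e f : ℂ) (x : Fin r → ℂ)
    (hq0 : 0 < ‖q‖) (hq1 : ‖q‖ < 1)
    (hbal : a ^ 2 * q ^ (2 - (r : ℤ)) = b * c * d * e * f)
    (ha : a ≠ 0) (hx : ∀ i, x i ≠ 0)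
    (hxx : ∀ i j, i ≠ j → x i ≠ x j)
    (haxx : ∀ i j, a * x i * x j ≠ 1)
    (hbb : ∀ n : ℕ, b ^ 2 / a * q ^ n ≠ 1)
    (hbc : ∀ n : ℕ, b * c / a * q ^ n ≠ 1)
    (hbd : ∀ n : ℕ, b * d / a * q ^ n ≠ 1)
    (hbe : ∀ n : ℕ, b * e / a * q ^ n ≠ 1)
    (hbf : ∀ i, ∀ n : ℕ, b * f / (a * x i) * q ^ n ≠ 1)
    (hab : ∀ i, ∀ n : ℕ, a * x i / b * q ^ n ≠ 1)
    (hac : ∀ i, ∀ n : ℕ, a * x i * q / c * q ^ n ≠ 1)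
    (had : ∀ i, ∀ n : ℕ, a * x i * q / d * q ^ n ≠ 1)
    (hae : ∀ i, ∀ n : ℕ, a * x i * q / e * q ^ n ≠ 1)
    (haf : ∀ i, ∀ n : ℕ, a * x i ^ 2 * q / f * q ^ n ≠ 1)
    (hba : ∀ i, ∀ n : ℕ, b * q / (a * x i) * q ^ n ≠ 1)
    (hcb : ∀ n : ℕ, b * q / c * q ^ n ≠ 1)
    (hdb : ∀ n : ℕ, b * q / d * q ^ n ≠ 1)
    (heb : ∀ n : ℕ, b * q / e * q ^ n ≠ 1)
    (hfb : ∀ i, ∀ n : ℕ, b * x i * q / f * q ^ n ≠ 1) :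
    (∀ S : Finset (Fin r), Summable (crTerm q a b c d e f x S)) ∧
    ∑ S : Finset (Fin r), crCoeff q a b c d e f x S * ∑' k : Fin r → ℕ, crTerm q a b c d e f x S k
      = crProduct q a b c d e f x := by
  have hq : q ≠ 0 := norm_pos_iff.1 hq0
  -- The balancing condition with `a ≠ 0` and `q ≠ 0` forces all of `b, c, d, e, f` to be nonzero.
  have hp : b * c * d * e * f ≠ 0 :=
    hbal ▸ mul_ne_zero (pow_ne_zero 2 ha) (zpow_ne_zero _ hq)
  simp only [mul_ne_zero_iff] at hp
  obtain ⟨⟨⟨⟨hb, hc⟩, hd⟩, he⟩, hf⟩ := hp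
  have h : ∀ i, CrAdmissible q a b c d e f (x i) := fun i =>
    ⟨hb, hc, hd, he, hf, hx i, haxx i i, hbb, hbc, hbd, hbe, hbf i, hab i, hac i, had i, hae i,
      haf i, hba i, hcb, hdb, heb, hfb i⟩
  have hV : crVandermonde a x ≠ 0 := crVandermonde_ne_zero hxx haxx
  have hba0 : ∀ n : ℕ, (b / a) ^ n ≠ 0 := fun n => pow_ne_zero n (div_ne_zero hb ha)
  have hT := fun S : Finset (Fin r) =>
    summable_det_and_tsum_det (crEntry q a b c d e f x S)
      (CrAdmissible.summable_norm_crEntry h ha hq1)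
  simp only [det_crEntry ha hb hx hxx haxx] at hT
  -- The determinants equal the terms only up to the nonzero constants `crVandermonde` and a power
  -- of `b / a`; both are removed here, for summability as well as for the identity.
  refine ⟨fun S => ?_, mul_right_cancel₀ hV ?_⟩
  · have := (hT S).1
    rwa [summable_mul_right_iff hV, summable_mul_left_iff (hba0 _)] at this
  · rw [crProduct_mul_crVandermonde hV, ← det_crMatrix ha hq hq1 h hbal, det_crMatrix_eq_sum,
      sum_mul]
    refine sum_congr rfl fun S _ => ?_
    rw [← (hT S).2, tsum_mul_right, tsum_mul_left, crCoeff_eq]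
    ring
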